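/- **Proposition (shadows of $\mathcal{LG}_k$).** Let $k$ be a commutative ring. *The bicategory $\mathcal{LG}_k$.* A *potential* is a polynomial $W\in R=k[x_1,\dots,x_n]$ ($n\ge 0$) such that the sequence $\partial_{x_1}W,\dots,\partial_{x_n}W$ is quasi-regular, $R/(\partial_{x_1}W,\dots,\partial_{x_n}W)$ is a finitely generated free $k$-module, and the Koszul complex of $\partial_{x_1}W,\dots,\partial_{x_n}W$ is exact except in degree $0$. Objects of $\mathcal{LG}_k$ are pairs $(R,W)$ with $W\in R=k[x_1,\dots,x_n]$ a potential. A *matrix factorisation* of $w\in E$ over a commutative ring $E$ is a $\mathbb Z_2$-graded $E$-module, free as an $E$-module, with an odd $E$-linear map $d$ such that $d^2=w$; morphisms are homotopy classes of even maps commuting with $d$. The category $\mathcal{LG}_k((R,W),(S,V))$ is the full subcategory of matrix factorisations of $V\otimes 1-1\otimes W$ over $S\otimes_k R$ which are direct summands, up to homotopy, of finite-rank ones. Composition is $(Y,X)\mapsto Y\otimes X$ (tensor product over the middle ring, with differential $d_Y\otimes1+1\otimes d_X$ and Koszul signs), with the usual associators. With $R^{\mathrm e}=R\otimes_kR=k[x,x']$,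 the unit of $(R,W)$ is $\Delta_W=\big(\bigwedge(\bigoplus_i R^{\mathrm e}\theta_i),\ \sum_i\partial_{[i]}W\,\theta_i+\sum_i(x_i-x_i')\theta_i^*\big)$, where $(x_i-x'_i)\,\partial_{[i]}W=W(x'_1,\dots,x'_{i-1},x_i,\dots,x_n)-W(x'_1,\dots,x'_i,x_{i+1},\dots,x_n)$. The unit actions are $\lambda_X=\pi\otimes 1:\Delta_V\otimes X\to X$ and $\rho_X=1\otimes\pi:X\otimes\Delta_W\to X$, where $\pi$ is the projection to $\theta$-degree $0$ followed by multiplication $R^{\mathrm e}\to R$. *Claim.* These data form a bicategory (composites of 1-morphisms are again 1-morphisms, and $\lambda,\rho$ are isomorphisms), and this bicategory has shadows $$\langle\!\langle-\rangle\!\rangle:\mathcal{LG}_k\big((R,W),(R,W)\big)\longrightarrow\mathcal M_2(k),\qquad Z\longmapsto H^*(Z\otimes_{R^{\mathrm e}}R)$$ with values in the category $\mathcal M_2(k)$ of $\mathbb Z_2$-graded $k$-modules, with $\theta:\langle\!\langle Y\otimes X\rangle\!\rangle\to\langle\!\langle X\otimes Y\rangle\!\rangle$, for $X:(R,W)\to(S,V)$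 and $Y:(S,V)\to(R,W)$ (in either order of the two factors), induced by the graded swap $y\otimes x\mapsto(-1)^{|x||y|}\,x\otimes y$. Explicitly: these assignments are well-defined functors and morphisms of graded $k$-modules, $\theta$ is a natural isomorphism, and, whenever the composites make sense, $$\langle\!\langle\alpha^{-1}\rangle\!\rangle\circ\theta_{X\otimes Y,Z}=\theta_{Y,Z\otimes X}\circ\langle\!\langle\alpha\rangle\!\rangle\circ\theta_{X,Y\otimes Z}\circ\langle\!\langle\alpha\rangle\!\rangle:\ \langle\!\langle (X\otimes Y)\otimes Z\rangle\!\rangle\to\langle\!\langle (Z\otimes X)\otimes Y\rangle\!\rangle ,$$ where $\alpha:(A\otimes B)\otimes C\to A\otimes(B\otimes C)$ is the associator, and for every 1-morphism $X:(R,W)\to(R,W)$ $$\langle\!\langle\lambda_X\rangle\!\rangle\circ\theta_{X,\Delta_W}=\langle\!\langle\rho_X\rangle\!\rangle,\qquad \langle\!\langle\rho_X\rangle\!\rangle\circ\theta_{\Delta_W,X}=\langle\!\langle\lambda_X\rangle\!\rangle .$$ -/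

import Mathlib

open CategoryTheory TensorProduct

universe u

noncomputable section

namespace LandauGinzburg

/-! ### Linear factorisations and their homotopy category -/

/-- A linear factorisation of `w ∈ E`: a `ℤ/2`-graded `E`-module `X = X⁰ ⊕ X¹` with an odd
`E`-linear endomorphism `d` such that `d² = w`. The grading is recorded by the idempotent
`E`-linear endomorphism `even`, the projection of `X` onto `X⁰` with kernel `X¹`. -/
structure LinFact (E : Type u) [CommRing E] (w : E) where
  carrier : Type u
  [addCommGroup : AddCommGroup carrier]
  [module : Module E carrier]
  even : carrier →ₗ[E] carrier
  even_even : ∀ x, even (even x) = even x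
  d : carrier →ₗ[E] carrier
  d_even : ∀ x, d (even x) = d x - even (d x)
  d_d : ∀ x, d (d x) = w • x

attribute [instance] LinFact.addCommGroup LinFact.module

namespace LinFact

variable {E : Type u} [CommRing E] {w : E}

/-- The projection onto the odd part. -/
def odd (X : LinFact E w) : X.carrier →ₗ[E] X.carrier := LinearMap.id - X.even

/-- The sign operator `x ↦ (-1)^|x| x`. -/
def sgn (X : LinFact E w) : X.carrier →ₗ[E] X.carrier := X.even - X.odd

/-- A linear map is even if it preserves the gradings. -/
def IsEven {X Y : LinFact E w} (f : X.carrier →ₗ[E] Y.carrier) : Prop :=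
  ∀ x, f (X.even x) = Y.even (f x)

/-- A linear map is odd if it exchanges even and odd parts. -/
def IsOdd {X Y : LinFact E w} (h : X.carrier →ₗ[E] Y.carrier) : Prop :=
  ∀ x, h (X.even x) = h x - Y.even (h x)

/-- Morphisms of linear factorisations: even linear maps commuting with the differentials. -/
@[ext]
structure Mor (X Y : LinFact E w) where
  lin : X.carrier →ₗ[E] Y.carrier
  isEven : IsEven lin
  comm : ∀ x, Y.d (lin x) = lin (X.d x)

/-- Two morphisms are homotopic if `ψ - φ = d h + h d` for some odd linear map `h`. -/
def Homotopic {X Y : LinFact E w} (φ ψ : Mor X Y) : Prop :=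
  ∃ h : X.carrier →ₗ[E] Y.carrier, IsOdd h ∧ ∀ x, Y.d (h x) + h (X.d x) = ψ.lin x - φ.lin x

/-- The identity morphism. -/
def Mor.id (X : LinFact E w) : Mor X X := ⟨LinearMap.id, fun _ => rfl, fun _ => rfl⟩

/-- The composite of morphisms, in diagrammatic order. -/
def Mor.comp {X Y Z : LinFact E w} (φ : Mor X Y) (ψ : Mor Y Z) : Mor X Z where
  lin := ψ.lin ∘ₗ φ.lin
  isEven x := by simp [φ.isEven x, ψ.isEven (φ.lin x)]
  comm x := by simp [← φ.comm x, ψ.comm (φ.lin x)]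

instance homotopySetoid (X Y : LinFact E w) : Setoid (Mor X Y) where
  r := Homotopic
  iseqv :=
    { refl := fun φ => ⟨0, fun x => by simp, by simp⟩
      symm := by
        rintro φ ψ ⟨h, ho, he⟩
        refine ⟨-h, fun x => ?_, fun x => ?_⟩
        · simp [ho x]; abel
        · have := he x
          simp only [LinearMap.neg_apply, map_neg, ← neg_add, this, neg_sub]
      trans := by
        rintro φ ψ χ ⟨h, ho, he⟩ ⟨h', ho', he'⟩
        refine ⟨h + h', fun x => ?_, fun x => ?_⟩
        · simp [ho x, ho' x]; abel
        · simp only [LinearMap.add_apply, map_add]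
          rw [add_add_add_comm, he, he']
          abel }

theorem Homotopic.comp {X Y Z : LinFact E w} {φ φ' : Mor X Y} {ψ ψ' : Mor Y Z}
    (h₁ : Homotopic φ φ') (h₂ : Homotopic ψ ψ') : Homotopic (φ.comp ψ) (φ'.comp ψ') := by
  obtain ⟨h, ho, he⟩ := h₁
  obtain ⟨g, go, ge⟩ := h₂
  refine ⟨ψ.lin ∘ₗ h + g ∘ₗ φ'.lin, fun x => ?_, fun x => ?_⟩
  · simp only [LinearMap.add_apply, LinearMap.comp_apply, map_add]
    rw [ho x, φ'.isEven x, go, map_sub, ψ.isEven]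
    abel
  · have a1 := congrArg ψ.lin (he x)
    rw [map_add, map_sub] at a1
    simp only [LinearMap.add_apply, LinearMap.comp_apply, map_add, Mor.comp]
    rw [ψ.comm, ← φ'.comm]
    calc _ = (ψ.lin (Y.d (h x)) + ψ.lin (h (X.d x))) + (Z.d (g (φ'.lin x)) + g (Y.d (φ'.lin x))) := by
          abel
      _ = _ := by rw [a1, ge]; abel

/-- The homotopy category `HF(E, w)` of linear factorisations. -/
instance : Category (LinFact E w) where
  Hom X Y := Quotient (homotopySetoid X Y)
  id X := ⟦Mor.id X⟧
  comp := Quotient.map₂ Mor.comp fun _ _ h₁ _ _ h₂ => Homotopic.comp h₁ h₂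
  id_comp := by rintro X Y ⟨f⟩; rfl
  comp_id := by rintro X Y ⟨f⟩; rfl
  assoc := by rintro X Y Z V ⟨f⟩ ⟨g⟩ ⟨h⟩; rfl

/-- The homotopy class of a morphism. -/
def Mor.cls {X Y : LinFact E w} (φ : Mor X Y) : X ⟶ Y := Quotient.mk _ φ

theorem Mor.cls_comp {X Y Z : LinFact E w} (φ : Mor X Y) (ψ : Mor Y Z) :
    φ.cls ≫ ψ.cls = (φ.comp ψ).cls := rfl

theorem Mor.cls_id (X : LinFact E w) : (Mor.id X).cls = 𝟙 X := rfl

theorem Mor.cls_eq {X Y : LinFact E w} {φ ψ : Mor X Y} (h : ∀ x, φ.lin x = ψ.lin x) :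
    φ.cls = ψ.cls := congrArg Mor.cls (Mor.ext (LinearMap.ext h))

theorem Mor.cls_eq_iff {X Y : LinFact E w} {φ ψ : Mor X Y} :
    φ.cls = ψ.cls ↔ Homotopic φ ψ := Quotient.eq

theorem cls_surj {X Y : LinFact E w} (f : X ⟶ Y) : ∃ φ : Mor X Y, φ.cls = f :=
  Quotient.exists_rep f

/-- A morphism with a set-theoretic inverse is an isomorphism. -/
def isoOfEquiv {X Y : LinFact E w} (f : Mor X Y) (g : Y.carrier → X.carrier)
    (h₁ : ∀ x, g (f.lin x) = x) (h₂ : ∀ y, f.lin (g y) = y) : X ≅ Y :=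
  let e : X.carrier ≃ₗ[E] Y.carrier := { f.lin with invFun := g, left_inv := h₁, right_inv := h₂ }
  { hom := f.cls
    inv := Mor.cls
      { lin := e.symm.toLinearMap
        isEven := fun y => e.injective (by
          change e (e.symm _) = f.lin (X.even (e.symm y))
          rw [f.isEven, e.apply_symm_apply]
          exact congrArg Y.even (e.apply_symm_apply y).symm)
        comm := fun y => e.injective (by
          change f.lin (X.d (e.symm y)) = e (e.symm _)
          rw [← f.comm, e.apply_symm_apply]
          exact congrArg Y.d (e.apply_symm_apply y)) }
    hom_inv_id := Mor.cls_eq h₁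
    inv_hom_id := Mor.cls_eq h₂ }

/-- A matrix factorisation: the underlying module is free. -/
def IsMF (X : LinFact E w) : Prop := Module.Free E X.carrier

/-- A finite-rank matrix factorisation. -/
def IsFiniteMF (X : LinFact E w) : Prop := Module.Free E X.carrier ∧ Module.Finite E X.carrier

/-- The objects of `hmf(E, w)^ω`: matrix factorisations which are direct summands, in the
homotopy category, of finite-rank matrix factorisations. -/
def IsSummandMF (X : LinFact E w) : Prop :=
  X.IsMF ∧ ∃ Z : LinFact E w, Z.IsFiniteMF ∧ Nonempty (Retract X Z)

end LinFact

/-! ### Tensor products of bimodules -/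

section BimodTensor

variable (k R₃ R₂ R₁ : Type u) [CommRing k] [CommRing R₃] [CommRing R₂] [CommRing R₁]
  [Algebra k R₃] [Algebra k R₂] [Algebra k R₁]

/-- A module `M` over `S ⊗ R`, regarded as an `R`-module. -/
def RightMod (_S _R M : Type u) : Type u := M

/-- A module `M` over `S ⊗ R`, regarded as an `S`-module. -/
def LeftMod (_S _R M : Type u) : Type u := M

variable (M N : Type u) [AddCommGroup M] [AddCommGroup N]

instance : AddCommGroup (RightMod R₃ R₂ M) := inferInstanceAs (AddCommGroup M)
instance : AddCommGroup (LeftMod R₂ R₁ N) := inferInstanceAs (AddCommGroup N)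

variable [Module (R₃ ⊗[k] R₂) M] [Module (R₂ ⊗[k] R₁) N]

abbrev RightMod.module : Module R₂ (RightMod R₃ R₂ M) :=
  Module.compHom M (Algebra.TensorProduct.includeRight : R₂ →ₐ[k] R₃ ⊗[k] R₂).toRingHom

abbrev LeftMod.module : Module R₂ (LeftMod R₂ R₁ N) :=
  Module.compHom N (Algebra.TensorProduct.includeLeft : R₂ →ₐ[k] R₂ ⊗[k] R₁).toRingHom

/-- The tensor product `M ⊗_{R₂} N` of a module `M` over `R₃ ⊗ R₂` and a module `N` over
`R₂ ⊗ R₁`. -/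
def BiTensor : Type u :=
  letI := RightMod.module k R₃ R₂ M
  letI := LeftMod.module k R₂ R₁ N
  RightMod R₃ R₂ M ⊗[R₂] LeftMod R₂ R₁ N

namespace BiTensor

instance : AddCommGroup (BiTensor k R₃ R₂ R₁ M N) := by
  unfold BiTensor; infer_instance

variable {M N}

/-- The pure tensor `m ⊗ n`. -/
def mk (m : M) (n : N) : BiTensor k R₃ R₂ R₁ M N :=
  letI := RightMod.module k R₃ R₂ M
  letI := LeftMod.module k R₂ R₁ N
  (show RightMod R₃ R₂ M from m) ⊗ₜ[R₂] (show LeftMod R₂ R₁ N from n)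

theorem mk_add (m : M) (n n' : N) : mk k R₃ R₂ R₁ m (n + n') = mk k R₃ R₂ R₁ m n + mk k R₃ R₂ R₁ m n' :=
  letI := RightMod.module k R₃ R₂ M
  letI := LeftMod.module k R₂ R₁ N
  TensorProduct.tmul_add (R := R₂) (M := RightMod R₃ R₂ M) (N := LeftMod R₂ R₁ N) m n n'

theorem add_mk (m m' : M) (n : N) : mk k R₃ R₂ R₁ (m + m') n = mk k R₃ R₂ R₁ m n + mk k R₃ R₂ R₁ m' n :=
  letI := RightMod.module k R₃ R₂ M
  letI := LeftMod.module k R₂ R₁ N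
  TensorProduct.add_tmul (R := R₂) (M := RightMod R₃ R₂ M) (N := LeftMod R₂ R₁ N) m m' n

/-- Pure tensors as a biadditive map. -/
def mkHom : M →+ N →+ BiTensor k R₃ R₂ R₁ M N :=
  AddMonoidHom.mk' (fun m => AddMonoidHom.mk' (mk k R₃ R₂ R₁ m) (mk_add k R₃ R₂ R₁ m))
    fun m m' => by ext n; exact add_mk k R₃ R₂ R₁ m m' n

theorem mk_balanced (r : R₂) (m : M) (n : N) :
    mk k R₃ R₂ R₁ (((1 : R₃) ⊗ₜ[k] r) • m) n = mk k R₃ R₂ R₁ m ((r ⊗ₜ[k] (1 : R₁)) • n) :=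
  letI := RightMod.module k R₃ R₂ M
  letI := LeftMod.module k R₂ R₁ N
  TensorProduct.smul_tmul (R := R₂) (M := RightMod R₃ R₂ M) (N := LeftMod R₂ R₁ N) r m n

@[elab_as_elim]
theorem induction {p : BiTensor k R₃ R₂ R₁ M N → Prop} (h0 : p 0)
    (hm : ∀ m n, p (mk k R₃ R₂ R₁ m n)) (ha : ∀ x y, p x → p y → p (x + y)) (x) : p x :=
  letI := RightMod.module k R₃ R₂ M
  letI := LeftMod.module k R₂ R₁ N
  TensorProduct.induction_on (R := R₂) (M := RightMod R₃ R₂ M) (N := LeftMod R₂ R₁ N)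
    (motive := p) x h0 hm ha

/-- The universal property of the tensor product, for biadditive balanced maps. -/
def lift {P : Type u} [AddCommGroup P] (f : M →+ N →+ P)
    (hf : ∀ (r : R₂) m n, f (((1 : R₃) ⊗ₜ[k] r) • m) n = f m ((r ⊗ₜ[k] (1 : R₁)) • n)) :
    BiTensor k R₃ R₂ R₁ M N →+ P :=
  letI := RightMod.module k R₃ R₂ M
  letI := LeftMod.module k R₂ R₁ N
  TensorProduct.liftAddHom (R := R₂) (M := RightMod R₃ R₂ M) (N := LeftMod R₂ R₁ N) f hf

@[simp]
theorem lift_mk {P : Type u} [AddCommGroup P] (f : M →+ N →+ P) (hf) (m : M) (n : N) :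
    lift k R₃ R₂ R₁ f hf (mk k R₃ R₂ R₁ m n) = f m n := rfl

variable {k R₃ R₂ R₁}

@[ext]
theorem addHom_ext {P : Type u} [AddCommGroup P] {f g : BiTensor k R₃ R₂ R₁ M N →+ P}
    (h : ∀ m n, f (mk k R₃ R₂ R₁ m n) = g (mk k R₃ R₂ R₁ m n)) : f = g := by
  ext x
  induction x using induction with
  | h0 => simp
  | hm m n => exact h m n
  | ha x y hx hy => rw [map_add, map_add, hx, hy]

/-- The additive endomorphism `a ⊗ b` for `a ∈ R₃ ⊗ R₂` and `b ∈ R₂ ⊗ R₁`. -/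
def act (a : R₃ ⊗[k] R₂) (b : R₂ ⊗[k] R₁) :
    BiTensor k R₃ R₂ R₁ M N →+ BiTensor k R₃ R₂ R₁ M N :=
  lift k R₃ R₂ R₁
    (AddMonoidHom.mk' (fun m => AddMonoidHom.mk' (fun n => mk k R₃ R₂ R₁ (a • m) (b • n))
      fun n n' => by rw [smul_add, mk_add]) fun m m' => by
        ext n; simp [smul_add, add_mk])
    fun r m n => by
      simp only [AddMonoidHom.mk'_apply]
      rw [smul_comm a, mk_balanced, smul_comm b]

@[simp]
theorem act_mk (a : R₃ ⊗[k] R₂) (b : R₂ ⊗[k] R₁) (m : M) (n : N) :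
    act a b (mk k R₃ R₂ R₁ m n) = mk k R₃ R₂ R₁ (a • m) (b • n) := rfl

/-- The action of `R₃ ⊗ R₁`. -/
def actHom : R₃ ⊗[k] R₁ →+ BiTensor k R₃ R₂ R₁ M N →+ BiTensor k R₃ R₂ R₁ M N :=
  TensorProduct.liftAddHom
    (AddMonoidHom.mk' (fun r => AddMonoidHom.mk'
        (fun s => act (r ⊗ₜ[k] (1 : R₂)) ((1 : R₂) ⊗ₜ[k] s)) fun s s' => by
          ext m n
          simp [tmul_add, add_smul, mk_add])
      fun r r' => by
        ext s m n
        simp [add_tmul, add_smul, add_mk])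
    fun c r s => by
      ext m n
      simp only [AddMonoidHom.mk'_apply, act_mk]
      have h1 : (c • r) ⊗ₜ[k] (1 : R₂) = ((1 : R₃) ⊗ₜ[k] (algebraMap k R₂ c)) * (r ⊗ₜ[k] (1 : R₂)) := by
        simp [Algebra.algebraMap_eq_smul_one, smul_tmul]
      have h2 : (1 : R₂) ⊗ₜ[k] (c • s) = ((algebraMap k R₂ c) ⊗ₜ[k] (1 : R₁)) * ((1 : R₂) ⊗ₜ[k] s) := by
        simp [Algebra.algebraMap_eq_smul_one, smul_tmul]
      rw [h1, h2, mul_smul, mul_smul, mk_balanced]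

instance : SMul (R₃ ⊗[k] R₁) (BiTensor k R₃ R₂ R₁ M N) := ⟨fun e x => actHom e x⟩

theorem smul_mk (r : R₃) (s : R₁) (m : M) (n : N) :
    (r ⊗ₜ[k] s) • mk k R₃ R₂ R₁ m n =
      mk k R₃ R₂ R₁ ((r ⊗ₜ[k] (1 : R₂)) • m) (((1 : R₂) ⊗ₜ[k] s) • n) := rfl

/-- `M ⊗_{R₂} N` is a module over `R₃ ⊗ R₁`. -/
instance : Module (R₃ ⊗[k] R₁) (BiTensor k R₃ R₂ R₁ M N) where
  one_smul x := by
    induction x using induction with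
    | h0 => exact map_zero (actHom 1)
    | hm m n =>
      rw [Algebra.TensorProduct.one_def, smul_mk]
      simp [← Algebra.TensorProduct.one_def]
    | ha x y hx hy => exact (map_add (actHom 1) x y).trans (congrArg₂ (· + ·) hx hy)
  mul_smul e f x := by
    induction x using induction with
    | h0 => exact (map_zero (actHom _)).trans (by
        change 0 = actHom e (actHom f 0); rw [map_zero, map_zero])
    | hm m n =>
      induction e with
      | zero => rw [zero_mul]; change actHom 0 _ = actHom 0 _; rw [map_zero]; rfl
      | add e e' he he' =>
        rw [add_mul]
        change actHom _ _ = actHom _ _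
        rw [map_add, map_add]
        exact congrArg₂ (· + ·) he he'
      | tmul a b =>
        induction f with
        | zero =>
          rw [mul_zero]
          change actHom 0 _ = actHom _ (actHom 0 _)
          rw [map_zero]
          exact (map_zero (actHom _)).symm
        | add e e' he he' =>
          rw [mul_add]
          change actHom _ _ = actHom _ (actHom _ _)
          rw [map_add, map_add]
          refine Eq.trans ?_ (map_add (actHom _) _ _).symm
          exact congrArg₂ (· + ·) he he'
        | tmul a' b' =>
          rw [Algebra.TensorProduct.tmul_mul_tmul, smul_mk, smul_mk, smul_mk, smul_smul, smul_smul]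
          simp
    | ha x y hx hy =>
      change actHom _ _ = actHom _ (actHom _ _)
      rw [map_add, map_add, map_add]
      exact congrArg₂ (· + ·) hx hy
  smul_zero e := map_zero (actHom e)
  smul_add e x y := map_add (actHom e) x y
  add_smul e f x := by
    change actHom _ _ = _
    rw [map_add]; rfl
  zero_smul x := by
    change actHom _ _ = _
    rw [map_zero]; rfl

/-- An additive map out of `M ⊗_{R₂} N` compatible with the action of pure tensors on pure
tensors is linear. -/
def toLin {P : Type u} [AddCommGroup P] [Module (R₃ ⊗[k] R₁) P] (f : BiTensor k R₃ R₂ R₁ M N →+ P)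
    (hf : ∀ (r : R₃) (s : R₁) m n, f ((r ⊗ₜ[k] s) • mk k R₃ R₂ R₁ m n) = (r ⊗ₜ[k] s) • f (mk k R₃ R₂ R₁ m n)) :
    BiTensor k R₃ R₂ R₁ M N →ₗ[R₃ ⊗[k] R₁] P :=
  { f with
    map_smul' := fun e x => by
      change f (e • x) = e • f x
      induction x using induction with
      | h0 => simp
      | hm m n =>
        induction e with
        | zero => simp
        | add e e' he he' => rw [add_smul, map_add, he, he', add_smul]
        | tmul a b => exact hf a b m n
      | ha x y hx hy => rw [smul_add, map_add, hx, hy, map_add, smul_add] }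

/-- Linear maps `M ⊗_{R₂} N → P` from biadditive, balanced, equivariant maps. -/
def liftLin {P : Type u} [AddCommGroup P] [Module (R₃ ⊗[k] R₁) P] (f : M → N → P)
    (h₁ : ∀ m m' n, f (m + m') n = f m n + f m' n)
    (h₂ : ∀ m n n', f m (n + n') = f m n + f m n')
    (h₃ : ∀ (r : R₂) m n, f (((1 : R₃) ⊗ₜ[k] r) • m) n = f m ((r ⊗ₜ[k] (1 : R₁)) • n))
    (h₄ : ∀ (r : R₃) (s : R₁) m n, f ((r ⊗ₜ[k] (1 : R₂)) • m) (((1 : R₂) ⊗ₜ[k] s) • n) = (r ⊗ₜ[k] s) • f m n) :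
    BiTensor k R₃ R₂ R₁ M N →ₗ[R₃ ⊗[k] R₁] P :=
  toLin (lift k R₃ R₂ R₁ (AddMonoidHom.mk' (fun m => AddMonoidHom.mk' (f m) (h₂ m))
    fun m m' => by ext n; exact h₁ m m' n) h₃) h₄

@[simp]
theorem liftLin_mk {P : Type u} [AddCommGroup P] [Module (R₃ ⊗[k] R₁) P] (f : M → N → P)
    (h₁ h₂ h₃ h₄) (m : M) (n : N) :
    liftLin (k := k) (R₃ := R₃) (R₂ := R₂) (R₁ := R₁) f h₁ h₂ h₃ h₄ (mk k R₃ R₂ R₁ m n) = f m n := rfl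

variable {M' N' : Type u} [AddCommGroup M'] [AddCommGroup N']
  [Module (R₃ ⊗[k] R₂) M'] [Module (R₂ ⊗[k] R₁) N']

/-- The tensor product `f ⊗ g` of linear maps. -/
def map (f : M →ₗ[R₃ ⊗[k] R₂] M') (g : N →ₗ[R₂ ⊗[k] R₁] N') :
    BiTensor k R₃ R₂ R₁ M N →ₗ[R₃ ⊗[k] R₁] BiTensor k R₃ R₂ R₁ M' N' :=
  liftLin (fun m n => mk k R₃ R₂ R₁ (f m) (g n))
    (fun m m' n => by rw [map_add, add_mk])
    (fun m n n' => by rw [map_add, mk_add])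
    (fun r m n => by rw [map_smul, map_smul, mk_balanced])
    (fun r s m n => by rw [map_smul, map_smul, smul_mk])

@[simp]
theorem map_mk (f : M →ₗ[R₃ ⊗[k] R₂] M') (g : N →ₗ[R₂ ⊗[k] R₁] N') (m : M) (n : N) :
    map f g (mk k R₃ R₂ R₁ m n) = mk k R₃ R₂ R₁ (f m) (g n) := rfl

theorem mk_sub (m : M) (n n' : N) :
    mk k R₃ R₂ R₁ m (n - n') = mk k R₃ R₂ R₁ m n - mk k R₃ R₂ R₁ m n' :=
  map_sub (mkHom k R₃ R₂ R₁ m) n n'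

theorem sub_mk (m m' : M) (n : N) :
    mk k R₃ R₂ R₁ (m - m') n = mk k R₃ R₂ R₁ m n - mk k R₃ R₂ R₁ m' n := by
  have := map_sub (mkHom k R₃ R₂ R₁ (N := N)) m m'
  exact DFunLike.congr_fun this n

/-- Two linear maps which agree on pure tensors are equal. -/
theorem ext_apply {P : Type u} [AddCommGroup P] {f g : BiTensor k R₃ R₂ R₁ M N → P}
    (hf : ∀ x y, f (x + y) = f x + f y) (hg : ∀ x y, g (x + y) = g x + g y)
    (h : ∀ m n, f (mk k R₃ R₂ R₁ m n) = g (mk k R₃ R₂ R₁ m n)) (x) : f x = g x :=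
  DFunLike.congr_fun (addHom_ext (f := AddMonoidHom.mk' f hf) (g := AddMonoidHom.mk' g hg) h) x

end BiTensor

end BimodTensor

/-! ### Tensor products of linear factorisations -/

/-- Linear factorisations of `V - W` over `S ⊗ R`, where `V ∈ S` and `W ∈ R`. -/
abbrev BiFact (k S R : Type u) [CommRing k] [CommRing S] [CommRing R] [Algebra k S] [Algebra k R]
    (V : S) (W : R) := LinFact (S ⊗[k] R) (V ⊗ₜ[k] (1 : R) - (1 : S) ⊗ₜ[k] W)

namespace BiFact

open BiTensor LinFact

section

variable {k R₅ R₄ R₃ R₂ R₁ : Type u} [CommRing k] [CommRing R₅] [CommRing R₄] [CommRing R₃]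
  [CommRing R₂] [CommRing R₁] [Algebra k R₅] [Algebra k R₄] [Algebra k R₃] [Algebra k R₂]
  [Algebra k R₁] {V₅ : R₅} {V₄ : R₄} {V₃ : R₃} {V₂ : R₂} {V₁ : R₁}

/-- The tensor product `Y ⊗_{R₂} X`, graded by total degree, with differential
`y ⊗ x ↦ d y ⊗ x + (-1)^|y| y ⊗ d x`. -/
abbrev tensor (Y : BiFact k R₃ R₂ V₃ V₂) (X : BiFact k R₂ R₁ V₂ V₁) : BiFact k R₃ R₁ V₃ V₁ where
  carrier := BiTensor k R₃ R₂ R₁ Y.carrier X.carrier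
  even := BiTensor.map Y.even X.even + BiTensor.map Y.odd X.odd
  even_even := ext_apply (by intros; simp only [map_add]) (by intros; simp only [map_add])
    fun y x => by
      simp only [LinearMap.add_apply, map_add, map_mk, odd, LinearMap.sub_apply, LinearMap.id_apply,
        map_sub, even_even, sub_mk, mk_sub]
      abel
  d := BiTensor.map Y.d LinearMap.id + BiTensor.map Y.sgn X.d
  d_even := ext_apply (by intros; simp only [map_add]) (by intros; simp only [map_add]; abel)
    fun y x => by
      simp only [LinearMap.add_apply, map_add, map_mk, odd, sgn, LinearMap.sub_apply,
        LinearMap.id_apply, map_sub, even_even, d_even, sub_mk, mk_sub]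
      abel
  d_d := ext_apply (by intros; simp only [map_add]) (by intros; simp only [smul_add])
    fun y x => by
      have h1 : mk k R₃ R₂ R₁ ((V₃ ⊗ₜ[k] (1 : R₂) - (1 : R₃) ⊗ₜ[k] V₂) • y) x
          + mk k R₃ R₂ R₁ y ((V₂ ⊗ₜ[k] (1 : R₁) - (1 : R₂) ⊗ₜ[k] V₁) • x)
          = (V₃ ⊗ₜ[k] (1 : R₁) - (1 : R₃) ⊗ₜ[k] V₁) • mk k R₃ R₂ R₁ y x := by
        rw [sub_smul, sub_smul, sub_smul, sub_mk, mk_sub, mk_balanced, smul_mk, smul_mk]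
        simp [← Algebra.TensorProduct.one_def]
      simp only [LinearMap.add_apply, map_add, map_mk, odd, sgn, LinearMap.sub_apply,
        LinearMap.id_apply, map_sub, even_even, d_even, d_d, sub_mk, mk_sub]
      rw [← h1]
      abel

theorem tensor_d_mk (Y : BiFact k R₃ R₂ V₃ V₂) (X : BiFact k R₂ R₁ V₂ V₁) (y : Y.carrier)
    (x : X.carrier) : (tensor Y X).d (mk k R₃ R₂ R₁ y x) =
      mk k R₃ R₂ R₁ (Y.d y) x + mk k R₃ R₂ R₁ (Y.sgn y) (X.d x) := rfl

theorem tensor_even_mk (Y : BiFact k R₃ R₂ V₃ V₂) (X : BiFact k R₂ R₁ V₂ V₁) (y : Y.carrier)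
    (x : X.carrier) : (tensor Y X).even (mk k R₃ R₂ R₁ y x) =
      mk k R₃ R₂ R₁ (Y.even y) (X.even x) + mk k R₃ R₂ R₁ (Y.odd y) (X.odd x) := rfl

theorem tensor_ext {P : Type u} [AddCommGroup P] (Y : BiFact k R₃ R₂ V₃ V₂)
    (X : BiFact k R₂ R₁ V₂ V₁) {f g : (tensor Y X).carrier → P}
    (hf : ∀ x y, f (x + y) = f x + f y) (hg : ∀ x y, g (x + y) = g x + g y)
    (h : ∀ y x, f (mk k R₃ R₂ R₁ y x) = g (mk k R₃ R₂ R₁ y x)) (t) : f t = g t :=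
  BiTensor.ext_apply hf hg h t

/-- The tensor product of morphisms. -/
def tensorMor {Y Y' : BiFact k R₃ R₂ V₃ V₂} {X X' : BiFact k R₂ R₁ V₂ V₁} (φ : Mor Y Y')
    (ψ : Mor X X') : Mor (tensor Y X) (tensor Y' X') where
  lin := BiTensor.map φ.lin ψ.lin
  isEven := tensor_ext _ _ (by intros; simp only [map_add]) (by intros; simp only [map_add])
    fun y x => by
      simp only [LinearMap.add_apply, map_mk, map_add, odd, LinearMap.sub_apply,
        LinearMap.id_apply, map_sub, φ.isEven y, ψ.isEven x]
  comm := tensor_ext _ _ (by intros; simp only [map_add]) (by intros; simp only [map_add])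
    fun y x => by
      simp only [LinearMap.add_apply, map_mk, map_add, odd, sgn, LinearMap.sub_apply,
        LinearMap.id_apply, map_sub, φ.isEven y, φ.comm, ψ.comm]

theorem tensorMor_homotopic {Y Y' : BiFact k R₃ R₂ V₃ V₂} {X X' : BiFact k R₂ R₁ V₂ V₁}
    {φ φ' : Mor Y Y'} {ψ ψ' : Mor X X'} (h₁ : Homotopic φ φ') (h₂ : Homotopic ψ ψ') :
    Homotopic (tensorMor φ ψ) (tensorMor φ' ψ') := by
  obtain ⟨h, ho, he⟩ := h₁
  obtain ⟨g, go, ge⟩ := h₂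
  refine ⟨BiTensor.map h ψ.lin + BiTensor.map (Y'.sgn ∘ₗ φ'.lin) g, ?_, ?_⟩
  · refine tensor_ext _ _ (by intros; simp only [map_add])
      (by intros; simp only [map_add]; abel) fun y x => ?_
    simp only [tensor_even_mk, LinearMap.add_apply, map_add, map_mk, odd, sgn, LinearMap.sub_apply,
      LinearMap.id_apply, LinearMap.comp_apply, map_sub, even_even, ho y, go x, φ'.isEven y,
      ψ.isEven x, sub_mk, mk_sub]
    abel
  · refine tensor_ext _ _ (by intros; simp only [map_add]; abel)
      (by intros; simp only [map_add]; abel) fun y x => ?_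
    have e1 : φ'.lin y = Y'.d (h y) + h (Y.d y) + φ.lin y := by rw [he]; abel
    have e2 : ψ'.lin x = X'.d (g x) + g (X.d x) + ψ.lin x := by rw [ge]; abel
    have e3 := φ'.comm y
    have a1 : mk k R₃ R₂ R₁ (φ'.lin y) (ψ'.lin x) - mk k R₃ R₂ R₁ (φ.lin y) (ψ.lin x) =
        mk k R₃ R₂ R₁ (Y'.d (h y) + h (Y.d y)) (ψ.lin x)
        + mk k R₃ R₂ R₁ (φ'.lin y) (X'.d (g x) + g (X.d x)) := by
      rw [e2, mk_add, e1]
      simp only [add_mk, mk_add]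
      abel
    change _ = mk k R₃ R₂ R₁ (φ'.lin y) (ψ'.lin x) - mk k R₃ R₂ R₁ (φ.lin y) (ψ.lin x)
    rw [a1]
    simp only [tensor_d_mk, LinearMap.add_apply, map_add, map_mk, odd, sgn, LinearMap.sub_apply,
      LinearMap.id_apply, LinearMap.comp_apply, map_sub, even_even, d_even, sub_mk, mk_sub, add_mk,
      mk_add, φ'.isEven y, ho y, ← φ'.comm, ψ.comm]
    abel

/-- The tensor product of homotopy classes of morphisms. -/
def tensorHom {Y Y' : BiFact k R₃ R₂ V₃ V₂} {X X' : BiFact k R₂ R₁ V₂ V₁} (φ : Y ⟶ Y')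
    (ψ : X ⟶ X') : tensor Y X ⟶ tensor Y' X' :=
  Quotient.map₂ tensorMor (fun _ _ h₁ _ _ h₂ => tensorMor_homotopic h₁ h₂) φ ψ

theorem tensorHom_cls {Y Y' : BiFact k R₃ R₂ V₃ V₂} {X X' : BiFact k R₂ R₁ V₂ V₁} (φ : Mor Y Y')
    (ψ : Mor X X') : tensorHom φ.cls ψ.cls = (tensorMor φ ψ).cls := rfl

theorem tensorHom_id (Y : BiFact k R₃ R₂ V₃ V₂) (X : BiFact k R₂ R₁ V₂ V₁) :
    tensorHom (𝟙 Y) (𝟙 X) = 𝟙 (tensor Y X) :=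
  Mor.cls_eq (tensor_ext _ _ (by intros; simp only [map_add]) (by intros; simp only [map_add])
    fun _ _ => rfl)

theorem tensorHom_comp {Y Y' Y'' : BiFact k R₃ R₂ V₃ V₂} {X X' X'' : BiFact k R₂ R₁ V₂ V₁}
    (φ : Y ⟶ Y') (φ' : Y' ⟶ Y'') (ψ : X ⟶ X') (ψ' : X' ⟶ X'') :
    tensorHom (φ ≫ φ') (ψ ≫ ψ') = tensorHom φ ψ ≫ tensorHom φ' ψ' := by
  obtain ⟨φ, rfl⟩ := cls_surj φ
  obtain ⟨φ', rfl⟩ := cls_surj φ'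
  obtain ⟨ψ, rfl⟩ := cls_surj ψ
  obtain ⟨ψ', rfl⟩ := cls_surj ψ'
  exact Mor.cls_eq (tensor_ext _ _ (by intros; simp only [map_add]) (by intros; simp only [map_add])
    fun _ _ => rfl)

section assoc

variable {M₃ M₂ M₁ : Type u} [AddCommGroup M₃] [AddCommGroup M₂] [AddCommGroup M₁]
  [Module (R₄ ⊗[k] R₃) M₃] [Module (R₃ ⊗[k] R₂) M₂] [Module (R₂ ⊗[k] R₁) M₁]

def assocInvAux (z : M₃) : BiTensor k R₃ R₂ R₁ M₂ M₁ →+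
    BiTensor k R₄ R₂ R₁ (BiTensor k R₄ R₃ R₂ M₃ M₂) M₁ :=
  BiTensor.lift k R₃ R₂ R₁
    (AddMonoidHom.mk' (fun y => AddMonoidHom.mk'
        (fun x => mk k R₄ R₂ R₁ (mk k R₄ R₃ R₂ z y) x) (fun x x' => mk_add _ _ _ _ _ _ _))
      fun y y' => by ext x; simp [mk_add, add_mk])
    fun r y x => by
      simp only [AddMonoidHom.mk'_apply]
      rw [← mk_balanced, smul_mk]
      simp [← Algebra.TensorProduct.one_def]

theorem assocInvAux_mk (z : M₃) (y : M₂) (x : M₁) :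
    assocInvAux (k := k) (R₄ := R₄) (R₃ := R₃) (R₂ := R₂) (R₁ := R₁) z (mk k R₃ R₂ R₁ y x) =
      mk k R₄ R₂ R₁ (mk k R₄ R₃ R₂ z y) x := rfl

def assocAux (x : M₁) : BiTensor k R₄ R₃ R₂ M₃ M₂ →+
    BiTensor k R₄ R₃ R₁ M₃ (BiTensor k R₃ R₂ R₁ M₂ M₁) :=
  BiTensor.lift k R₄ R₃ R₂
    (AddMonoidHom.mk' (fun z => AddMonoidHom.mk'
        (fun y => mk k R₄ R₃ R₁ z (mk k R₃ R₂ R₁ y x)) (fun y y' => by rw [add_mk, mk_add]))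
      fun z z' => by ext y; simp [add_mk])
    (fun r z y => by
      simp only [AddMonoidHom.mk'_apply]
      rw [mk_balanced, smul_mk]
      simp [← Algebra.TensorProduct.one_def])

theorem assocAux_mk (z : M₃) (y : M₂) (x : M₁) :
    assocAux (k := k) (R₄ := R₄) (R₃ := R₃) (R₂ := R₂) (R₁ := R₁) x (mk k R₄ R₃ R₂ z y) =
      mk k R₄ R₃ R₁ z (mk k R₃ R₂ R₁ y x) := rfl

/-- The map `z ⊗ (y ⊗ x) ↦ (z ⊗ y) ⊗ x`. -/
def assocInvLin :
    BiTensor k R₄ R₃ R₁ M₃ (BiTensor k R₃ R₂ R₁ M₂ M₁) →ₗ[R₄ ⊗[k] R₁]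
      BiTensor k R₄ R₂ R₁ (BiTensor k R₄ R₃ R₂ M₃ M₂) M₁ :=
  BiTensor.liftLin (fun z t => assocInvAux z t)
    (fun z z' t => by
      induction t using BiTensor.induction with
      | h0 => simp only [map_zero, add_zero]
      | hm y x => simp only [assocInvAux_mk, add_mk]
      | ha t t' h h' => rw [map_add, map_add, map_add, h, h']; abel)
    (fun z t t' => map_add _ _ _)
    (fun r z t => by
      induction t using BiTensor.induction with
      | h0 => simp only [map_zero, smul_zero]
      | hm y x =>
        rw [smul_mk, assocInvAux_mk, assocInvAux_mk, mk_balanced, ← Algebra.TensorProduct.one_def,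
          one_smul]
      | ha t t' h h' => rw [smul_add, map_add, map_add, h, h'])
    (fun r s z t => by
      induction t using BiTensor.induction with
      | h0 => simp only [map_zero, smul_zero]
      | hm y x =>
        rw [smul_mk, assocInvAux_mk, assocInvAux_mk, smul_mk, smul_mk,
          ← Algebra.TensorProduct.one_def]
      | ha t t' h h' => rw [smul_add, map_add, map_add, h, h', smul_add])

theorem assocInvLin_mk (z : M₃) (y : M₂) (x : M₁) :
    assocInvLin (mk k R₄ R₃ R₁ z (mk k R₃ R₂ R₁ y x)) =
      mk k R₄ R₂ R₁ (mk k R₄ R₃ R₂ z y) x := rfl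

/-- The map `(z ⊗ y) ⊗ x ↦ z ⊗ (y ⊗ x)`. -/
def assocLin :
    BiTensor k R₄ R₂ R₁ (BiTensor k R₄ R₃ R₂ M₃ M₂) M₁ →ₗ[R₄ ⊗[k] R₁]
      BiTensor k R₄ R₃ R₁ M₃ (BiTensor k R₃ R₂ R₁ M₂ M₁) :=
  BiTensor.liftLin (fun t x => assocAux x t)
    (fun t t' x => map_add _ _ _)
    (fun t x x' => by
      induction t using BiTensor.induction with
      | h0 => simp only [map_zero, add_zero]
      | hm z y => simp only [assocAux_mk, mk_add]
      | ha t t' h h' => rw [map_add, map_add, map_add, h, h']; abel)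
    (fun r t x => by
      induction t using BiTensor.induction with
      | h0 => simp only [map_zero, smul_zero]
      | hm z y =>
        rw [smul_mk, assocAux_mk, assocAux_mk, ← mk_balanced, ← Algebra.TensorProduct.one_def,
          one_smul]
      | ha t t' h h' => rw [smul_add, map_add, map_add, h, h'])
    (fun r s t x => by
      induction t using BiTensor.induction with
      | h0 => simp only [map_zero, smul_zero]
      | hm z y =>
        rw [smul_mk, assocAux_mk, assocAux_mk, smul_mk, smul_mk,
          ← Algebra.TensorProduct.one_def]
      | ha t t' h h' => rw [smul_add, map_add, map_add, h, h', smul_add])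

theorem assocLin_mk (z : M₃) (y : M₂) (x : M₁) :
    assocLin (mk k R₄ R₂ R₁ (mk k R₄ R₃ R₂ z y) x) =
      mk k R₄ R₃ R₁ z (mk k R₃ R₂ R₁ y x) := rfl

end assoc

theorem tensor_ext₃ {P : Type u} [AddCommGroup P] (Z : BiFact k R₄ R₃ V₄ V₃)
    (Y : BiFact k R₃ R₂ V₃ V₂) (X : BiFact k R₂ R₁ V₂ V₁)
    {f g : (tensor (tensor Z Y) X).carrier → P}
    (hf : ∀ x y, f (x + y) = f x + f y) (hg : ∀ x y, g (x + y) = g x + g y)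
    (h : ∀ z y x, f (mk k R₄ R₂ R₁ (mk k R₄ R₃ R₂ z y) x) =
      g (mk k R₄ R₂ R₁ (mk k R₄ R₃ R₂ z y) x)) (t) : f t = g t := by
  refine tensor_ext _ _ hf hg (fun t x => ?_) t
  exact tensor_ext Z Y (f := fun t => f (mk k R₄ R₂ R₁ t x)) (g := fun t => g (mk k R₄ R₂ R₁ t x))
    (fun a b => by rw [add_mk, hf]) (fun a b => by rw [add_mk, hg]) (fun z y => h z y x) t

theorem tensor_ext₃' {P : Type u} [AddCommGroup P] (Z : BiFact k R₄ R₃ V₄ V₃)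
    (Y : BiFact k R₃ R₂ V₃ V₂) (X : BiFact k R₂ R₁ V₂ V₁)
    {f g : (tensor Z (tensor Y X)).carrier → P}
    (hf : ∀ x y, f (x + y) = f x + f y) (hg : ∀ x y, g (x + y) = g x + g y)
    (h : ∀ z y x, f (mk k R₄ R₃ R₁ z (mk k R₃ R₂ R₁ y x)) =
      g (mk k R₄ R₃ R₁ z (mk k R₃ R₂ R₁ y x))) (t) : f t = g t := by
  refine tensor_ext _ _ hf hg (fun z t => ?_) t
  exact tensor_ext Y X (f := fun t => f (mk k R₄ R₃ R₁ z t)) (g := fun t => g (mk k R₄ R₃ R₁ z t))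
    (fun a b => by rw [mk_add, hf]) (fun a b => by rw [mk_add, hg]) (fun y x => h z y x) t

theorem tensor_ext₄ {P : Type u} [AddCommGroup P] (T : BiFact k R₅ R₄ V₅ V₄)
    (Z : BiFact k R₄ R₃ V₄ V₃) (Y : BiFact k R₃ R₂ V₃ V₂) (X : BiFact k R₂ R₁ V₂ V₁)
    {f g : (tensor (tensor (tensor T Z) Y) X).carrier → P}
    (hf : ∀ x y, f (x + y) = f x + f y) (hg : ∀ x y, g (x + y) = g x + g y)
    (h : ∀ s z y x, f (mk k R₅ R₂ R₁ (mk k R₅ R₃ R₂ (mk k R₅ R₄ R₃ s z) y) x) =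
      g (mk k R₅ R₂ R₁ (mk k R₅ R₃ R₂ (mk k R₅ R₄ R₃ s z) y) x)) (t) : f t = g t := by
  refine tensor_ext _ _ hf hg (fun t x => ?_) t
  exact tensor_ext₃ T Z Y (f := fun t => f (mk k R₅ R₂ R₁ t x))
    (g := fun t => g (mk k R₅ R₂ R₁ t x))
    (fun a b => by rw [add_mk, hf]) (fun a b => by rw [add_mk, hg]) (fun s z y => h s z y x) t

/-- The associator `(Z ⊗ Y) ⊗ X → Z ⊗ (Y ⊗ X)`. -/
def assocMor (Z : BiFact k R₄ R₃ V₄ V₃) (Y : BiFact k R₃ R₂ V₃ V₂) (X : BiFact k R₂ R₁ V₂ V₁) :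
    Mor (tensor (tensor Z Y) X) (tensor Z (tensor Y X)) where
  lin := assocLin
  isEven := tensor_ext₃ _ _ _ (by intros; simp only [map_add]) (by intros; simp only [map_add])
    fun z y x => by
      simp only [odd, LinearMap.sub_apply, LinearMap.add_apply, LinearMap.id_apply, map_add,
        map_sub, map_mk, sub_mk, mk_sub, mk_add, add_mk, assocLin_mk]
      abel
  comm := tensor_ext₃ _ _ _ (by intros; simp only [map_add]) (by intros; simp only [map_add])
    fun z y x => by
      simp only [odd, sgn, LinearMap.sub_apply, LinearMap.add_apply, LinearMap.id_apply, map_add,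
        map_sub, map_mk, sub_mk, mk_sub, mk_add, add_mk, assocLin_mk]
      abel

/-- The associator in the homotopy category. -/
def assoc (Z : BiFact k R₄ R₃ V₄ V₃) (Y : BiFact k R₃ R₂ V₃ V₂) (X : BiFact k R₂ R₁ V₂ V₁) :
    tensor (tensor Z Y) X ≅ tensor Z (tensor Y X) :=
  isoOfEquiv (assocMor Z Y X) (fun t => assocInvLin t)
    (tensor_ext₃ _ _ _ (by intros; simp only [map_add]) (fun _ _ => rfl) fun _ _ _ => rfl)
    (tensor_ext₃' _ _ _ (by intros; simp only [map_add]) (fun _ _ => rfl) fun _ _ _ => rfl)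

theorem assoc_hom (Z : BiFact k R₄ R₃ V₄ V₃) (Y : BiFact k R₃ R₂ V₃ V₂)
    (X : BiFact k R₂ R₁ V₂ V₁) : (assoc Z Y X).hom = (assocMor Z Y X).cls := rfl

theorem assoc_naturality {Z Z' : BiFact k R₄ R₃ V₄ V₃} {Y Y' : BiFact k R₃ R₂ V₃ V₂}
    {X X' : BiFact k R₂ R₁ V₂ V₁} (ζ : Z ⟶ Z') (η : Y ⟶ Y') (ξ : X ⟶ X') :
    tensorHom (tensorHom ζ η) ξ ≫ (assoc Z' Y' X').hom =
      (assoc Z Y X).hom ≫ tensorHom ζ (tensorHom η ξ) := by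
  obtain ⟨ζ, rfl⟩ := cls_surj ζ
  obtain ⟨η, rfl⟩ := cls_surj η
  obtain ⟨ξ, rfl⟩ := cls_surj ξ
  exact Mor.cls_eq (tensor_ext₃ _ _ _ (fun _ _ => map_add _ _ _) (fun _ _ => map_add _ _ _)
    fun _ _ _ => rfl)

theorem pentagon (T : BiFact k R₅ R₄ V₅ V₄) (Z : BiFact k R₄ R₃ V₄ V₃) (Y : BiFact k R₃ R₂ V₃ V₂)
    (X : BiFact k R₂ R₁ V₂ V₁) :
    tensorHom (assoc T Z Y).hom (𝟙 X) ≫ (assoc T (tensor Z Y) X).hom ≫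
      tensorHom (𝟙 T) (assoc Z Y X).hom =
      (assoc (tensor T Z) Y X).hom ≫ (assoc T Z (tensor Y X)).hom :=
  Mor.cls_eq (tensor_ext₄ _ _ _ _ (fun _ _ => map_add _ _ _) (fun _ _ => map_add _ _ _)
    fun _ _ _ _ => rfl)

end

end BiFact

/-! ### Koszul operators -/

section Koszul

variable (k : Type u) [CommRing k] (n : ℕ)

/-- The exterior algebra over `k` on symbols `θ₁, …, θₙ`. -/
abbrev Ext : Type u := ExteriorAlgebra k (Fin n → k)

namespace Ext

variable {n}

/-- The operator `θᵢ ∧ -`. -/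
def wedge (i : Fin n) : Ext k n →ₗ[k] Ext k n :=
  LinearMap.mulLeft k (ExteriorAlgebra.ι k (Pi.single i (1 : k)))

/-- The contraction operator `θᵢ*`. -/
def contract (i : Fin n) : Ext k n →ₗ[k] Ext k n :=
  CliffordAlgebra.contractLeft (LinearMap.proj i)

variable (n)

/-- The projection onto the part of even `θ`-degree. -/
def even : Ext k n →ₗ[k] Ext k n :=
  GradedAlgebra.proj (CliffordAlgebra.evenOdd (0 : QuadraticForm k (Fin n → k))) 0

/-- The projection onto `θ`-degree `0`. -/
def aug : Ext k n →ₐ[k] k := ExteriorAlgebra.algebraMapInv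

variable {k n}

theorem even_even (x : Ext k n) : even k n (even k n x) = even k n x := by
  simp [even, GradedAlgebra.proj_apply]

theorem even_of_mem {i : ZMod 2} {x : Ext k n}
    (hx : x ∈ CliffordAlgebra.evenOdd (0 : QuadraticForm k (Fin n → k)) i) :
    even k n x = if i = 0 then x else 0 := by
  split_ifs with h
  · subst h
    exact DirectSum.decompose_of_mem_same _ hx
  · exact DirectSum.decompose_of_mem_ne _ hx h

theorem ι_mul_even (v : Fin n → k) (x : Ext k n) :
    ExteriorAlgebra.ι k v * even k n x =
      ExteriorAlgebra.ι k v * x - even k n (ExteriorAlgebra.ι k v * x) := by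
  induction x using DirectSum.Decomposition.inductionOn
    (CliffordAlgebra.evenOdd (0 : QuadraticForm k (Fin n → k))) with
  | zero => simp
  | @homogeneous i m =>
    have hv : ExteriorAlgebra.ι k v * (m : Ext k n) ∈
        CliffordAlgebra.evenOdd (0 : QuadraticForm k (Fin n → k)) (1 + i) :=
      SetLike.mul_mem_graded (CliffordAlgebra.ι_mem_evenOdd_one _ _) m.2
    rw [even_of_mem m.2, even_of_mem hv]
    have hi : ∀ i : ZMod 2, i = 0 ∨ i = 1 := by decide
    rcases hi i with rfl | rfl
    · simp
    · have : (1 : ZMod 2) + 1 = 0 := rfl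
      simp [this]
  | add x y hx hy => rw [map_add, mul_add, hx, hy, mul_add, map_add]; abel

theorem wedge_even (i : Fin n) (x : Ext k n) :
    wedge k i (even k n x) = wedge k i x - even k n (wedge k i x) := ι_mul_even _ x

theorem even_one : even k n 1 = 1 := by
  rw [even_of_mem (i := 0) (CliffordAlgebra.one_le_evenOdd_zero _ (Submodule.mem_one.2 ⟨1, by simp⟩))]
  simp

theorem even_algebraMap (r : k) : even k n (algebraMap k _ r) = algebraMap k _ r := by
  rw [Algebra.algebraMap_eq_smul_one, map_smul, even_one]

theorem contract_even (i : Fin n) (x : Ext k n) :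
    contract k i (even k n x) = contract k i x - even k n (contract k i x) := by
  induction x using CliffordAlgebra.left_induction with
  | algebraMap r =>
    have : contract k i (algebraMap k (Ext k n) r) = 0 :=
      CliffordAlgebra.contractLeft_algebraMap (Q := (0 : QuadraticForm k (Fin n → k))) _ r
    erw [even_algebraMap, this]
    simp
  | add x y hx hy => simp only [map_add, hx, hy]; abel
  | ι_mul x v hx =>
    have key : ∀ y : Ext k n, contract k i (ExteriorAlgebra.ι k v * y) =
        v i • y - ExteriorAlgebra.ι k v * contract k i y := fun y =>
      CliffordAlgebra.contractLeft_ι_mul (Q := (0 : QuadraticForm k (Fin n → k)))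
        (d := LinearMap.proj i) v y
    have h1 := ι_mul_even v x
    have h2 := ι_mul_even v (contract k i x)
    have h3 : even k n (ExteriorAlgebra.ι k v * x) =
      ExteriorAlgebra.ι k v * (x - even k n x) := by rw [mul_sub, h1]; abel
    change contract k i (even k n (ExteriorAlgebra.ι k v * x)) =
      contract k i (ExteriorAlgebra.ι k v * x) - even k n (contract k i (ExteriorAlgebra.ι k v * x))
    rw [h3, key, key, map_sub, hx, map_sub, map_smul, smul_sub]
    have h4 : even k n (ExteriorAlgebra.ι k v * contract k i x) =
      ExteriorAlgebra.ι k v * (contract k i x - even k n (contract k i x)) := by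
        rw [mul_sub, h2]; abel
    rw [h4]
    simp only [mul_sub]
    abel

theorem wedge_wedge (i : Fin n) (x : Ext k n) : wedge k i (wedge k i x) = 0 := by
  simp [wedge, ← mul_assoc]

theorem wedge_wedge_add (i j : Fin n) (x : Ext k n) :
    wedge k i (wedge k j x) + wedge k j (wedge k i x) = 0 := by
  simp only [wedge, LinearMap.mulLeft_apply, ← mul_assoc, ← add_mul]
  rw [ExteriorAlgebra.ι_add_mul_swap, zero_mul]

theorem contract_contract (i : Fin n) (x : Ext k n) : contract k i (contract k i x) = 0 :=
  CliffordAlgebra.contractLeft_contractLeft _ _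

theorem contract_contract_add (i j : Fin n) (x : Ext k n) :
    contract k i (contract k j x) + contract k j (contract k i x) = 0 := by
  unfold contract
  rw [CliffordAlgebra.contractLeft_comm, neg_add_cancel]

theorem contract_wedge (i j : Fin n) (x : Ext k n) :
    contract k i (wedge k j x) + wedge k j (contract k i x) = if i = j then x else 0 := by
  have := CliffordAlgebra.contractLeft_ι_mul (Q := (0 : QuadraticForm k (Fin n → k)))
    (d := LinearMap.proj i) (Pi.single j (1 : k)) x
  unfold contract wedge
  simp only [LinearMap.mulLeft_apply]
  erw [this]
  by_cases h : i = j
  · subst h; simp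
  · simp [h]

theorem aug_wedge (i : Fin n) (x : Ext k n) : aug k n (wedge k i x) = 0 := by
  simp [aug, wedge, ExteriorAlgebra.algebraMapInv]

theorem aug_even (x : Ext k n) : aug k n (even k n x) = aug k n x := by
  induction x using CliffordAlgebra.left_induction with
  | algebraMap r => erw [even_algebraMap]
  | add x y hx hy => simp only [map_add, hx, hy]
  | ι_mul x v hx =>
    have h : ∀ y : Ext k n, aug k n (ExteriorAlgebra.ι k v * y) = 0 := fun y => by
      simp [aug, ExteriorAlgebra.algebraMapInv]
    change aug k n (even k n (ExteriorAlgebra.ι k v * x)) = aug k n (ExteriorAlgebra.ι k v * x)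
    have h3 : even k n (ExteriorAlgebra.ι k v * x) =
      ExteriorAlgebra.ι k v * (x - even k n x) := by rw [mul_sub, ι_mul_even]; abel
    rw [h3, h, h]

end Ext

/-! ### Potentials and the unit matrix factorisation -/

variable {n}

/-- The Koszul differential `∑ᵢ fᵢ θᵢ*` on `⋀(⨁ R θᵢ) = R ⊗ₖ ⋀(⨁ k θᵢ)`. -/
def koszul {R : Type u} [CommRing R] [Algebra k R] (f : Fin n → R) :
    R ⊗[k] Ext k n →ₗ[R] R ⊗[k] Ext k n :=
  ∑ i, f i • (Ext.contract k i).baseChange R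

/-- The component `⋀(⨁ R θᵢ) → R` of `θ`-degree zero. -/
def koszulAug (R : Type u) [CommRing R] [Algebra k R] : R ⊗[k] Ext k n →ₗ[R] R :=
  (TensorProduct.AlgebraTensorModule.rid k R R).toLinearMap ∘ₗ
    (Ext.aug k n).toLinearMap.baseChange R

/-- A sequence `f₁, …, fₙ` is quasi-regular if every homogeneous form `F` of degree `d` over `R`
with `F(f) ∈ I^(d+1)`, where `I = (f₁, …, fₙ)`, has all its coefficients in `I`; equivalently
`(R/I)[T₁, …, Tₙ] → ⨁ I^d / I^(d+1)` is an isomorphism. -/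
def IsQuasiRegular {R : Type u} [CommRing R] (f : Fin n → R) : Prop :=
  ∀ (d : ℕ) (F : MvPolynomial (Fin n) R), F.IsHomogeneous d →
    MvPolynomial.aeval f F ∈ Ideal.span (Set.range f) ^ (d + 1) →
    ∀ m, F.coeff m ∈ Ideal.span (Set.range f)

/-- A polynomial `W ∈ k[x₁, …, xₙ]` is a potential if its partial derivatives form a quasi-regular
sequence, their quotient ring is a finitely generated free `k`-module, and their Koszul complex is
exact except in degree zero: every Koszul cycle whose component of `θ`-degree zero vanishes is a
boundary. -/
structure IsPotential (W : MvPolynomial (Fin n) k) : Prop where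
  quasiRegular : IsQuasiRegular fun i => MvPolynomial.pderiv i W
  free : Module.Free k
    (MvPolynomial (Fin n) k ⧸ Ideal.span (Set.range fun i => MvPolynomial.pderiv i W))
  finite : Module.Finite k
    (MvPolynomial (Fin n) k ⧸ Ideal.span (Set.range fun i => MvPolynomial.pderiv i W))
  exact : ∀ z : MvPolynomial (Fin n) k ⊗[k] Ext k n,
    koszul k (fun i => MvPolynomial.pderiv i W) z = 0 → koszulAug k (MvPolynomial (Fin n) k) z = 0 →
    ∃ y, koszul k (fun i => MvPolynomial.pderiv i W) y = z

variable (n)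

/-- The polynomial ring `R = k[x₁, …, xₙ]`. -/
abbrev Poly : Type u := MvPolynomial (Fin n) k

/-- The enveloping algebra `Rᵉ = R ⊗ₖ R = k[x, x']`. -/
abbrev Env : Type u := Poly k n ⊗[k] Poly k n

variable {n}

/-- `xᵢ - xᵢ'`. -/
def diffVar (i : Fin n) : Env k n :=
  MvPolynomial.X i ⊗ₜ[k] 1 - 1 ⊗ₜ[k] MvPolynomial.X i

/-- The `k`-algebra endomorphism of `k[x, x']` replacing `xᵢ` by `xᵢ'` for all `i` in `s`. -/
def subst (s : Finset (Fin n)) : Env k n →ₐ[k] Env k n :=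
  Algebra.TensorProduct.lift
    (MvPolynomial.aeval fun j => if j ∈ s then 1 ⊗ₜ[k] MvPolynomial.X j else MvPolynomial.X j ⊗ₜ[k] 1)
    Algebra.TensorProduct.includeRight fun _ _ => Commute.all _ _

variable {k}

theorem subst_left (s : Finset (Fin n)) (j : Fin n) :
    subst k s (MvPolynomial.X j ⊗ₜ[k] 1) =
      if j ∈ s then 1 ⊗ₜ[k] MvPolynomial.X j else MvPolynomial.X j ⊗ₜ[k] 1 := by
  simp [subst]

theorem subst_right (s : Finset (Fin n)) (r : Poly k n) :
    subst k s (1 ⊗ₜ[k] r) = 1 ⊗ₜ[k] r := by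
  simp [subst]

theorem env_hom_ext {B : Type u} [CommRing B] [Algebra k B] {f g : Env k n →ₐ[k] B}
    (h₁ : ∀ j, f (MvPolynomial.X j ⊗ₜ[k] 1) = g (MvPolynomial.X j ⊗ₜ[k] 1))
    (h₂ : ∀ j, f (1 ⊗ₜ[k] MvPolynomial.X j) = g (1 ⊗ₜ[k] MvPolynomial.X j)) : f = g := by
  apply Algebra.TensorProduct.ext
  · ext j; exact h₁ j
  · ext j; exact h₂ j

theorem subst_empty (f : Env k n) : subst k ∅ f = f := by
  have : subst k ∅ = AlgHom.id k (Env k n) := env_hom_ext (fun j => by simp [subst_left])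
    (fun j => by simp [subst_right])
  rw [this]; rfl

theorem subst_subst (s t : Finset (Fin n)) (f : Env k n) :
    subst k s (subst k t f) = subst k (s ∪ t) f := by
  have : (subst k s).comp (subst k t) = subst k (s ∪ t) := env_hom_ext
    (fun j => by
      simp only [AlgHom.comp_apply, subst_left]
      by_cases h : j ∈ t
      · simp [h, subst_right]
      · simp [h, subst_left])
    (fun j => by simp [subst_right])
  exact DFunLike.congr_fun this f

theorem subst_univ (W : Poly k n) : subst k Finset.univ (W ⊗ₜ[k] 1) = 1 ⊗ₜ[k] W := by
  have : (subst k Finset.univ).comp Algebra.TensorProduct.includeLeft =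
      (Algebra.TensorProduct.includeRight : Poly k n →ₐ[k] Env k n) := by
    ext j
    simp [subst_left]
  exact DFunLike.congr_fun this W

theorem isRegular_diffVar (i : Fin n) : IsRegular (diffVar k i) := by
  let φ : Env k n →+* MvPolynomial (Fin n) (Poly k n) :=
    (MvPolynomial.algebraTensorAlgEquiv k (Poly k n)).toRingEquiv.toRingHom
  let s : MvPolynomial (Fin n) (Poly k n) →ₐ[Poly k n] MvPolynomial (Fin n) (Poly k n) :=
    MvPolynomial.aeval fun j => MvPolynomial.X j + MvPolynomial.C (MvPolynomial.X j)
  let s' : MvPolynomial (Fin n) (Poly k n) →ₐ[Poly k n] MvPolynomial (Fin n) (Poly k n) :=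
    MvPolynomial.aeval fun j => MvPolynomial.X j - MvPolynomial.C (MvPolynomial.X j)
  have hs : ∀ p, s' (s p) = p := fun p => by
    have : s'.comp s = AlgHom.id _ _ := by
      ext j
      simp [s, s', ← MvPolynomial.algebraMap_eq]
    exact DFunLike.congr_fun this p
  have hφ : Function.Injective fun x => s (φ x) :=
    (Function.LeftInverse.injective hs).comp
      (MvPolynomial.algebraTensorAlgEquiv k (Poly k n)).injective
  have hu : s (φ (diffVar k i)) = -MvPolynomial.X i := by
    have h1 : φ (diffVar k i) = MvPolynomial.C (MvPolynomial.X i) - MvPolynomial.X i := by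
      change MvPolynomial.algebraTensorAlgEquiv k (Poly k n) _ = _
      simp [diffVar, MvPolynomial.smul_eq_C_mul]
    rw [h1, map_sub, ← MvPolynomial.algebraMap_eq, AlgHom.commutes]
    simp [s, ← MvPolynomial.algebraMap_eq]
  rw [← isLeftRegular_iff_isRegular]
  intro a b hab
  apply hφ
  have h2 := congrArg (fun x => s (φ x)) hab
  simp only [map_mul, hu] at h2
  have h3 : MvPolynomial.X i * s (φ a) = MvPolynomial.X i * s (φ b) := by linear_combination -h2
  exact (MvPolynomial.isRegular_X (n := i) (R := Poly k n)).left h3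

theorem diffVar_dvd (i : Fin n) (f : Env k n) : diffVar k i ∣ f - subst k {i} f := by
  rw [← Ideal.mem_span_singleton]
  refine (Ideal.Quotient.mk_eq_mk_iff_sub_mem (I := Ideal.span {diffVar k i}) _ _).1 ?_
  have : Ideal.Quotient.mkₐ k (Ideal.span {diffVar k i}) =
      (Ideal.Quotient.mkₐ k (Ideal.span {diffVar k i})).comp (subst k {i}) := by
    refine env_hom_ext (B := Env k n ⧸ Ideal.span {diffVar k i}) (fun j => ?_) (fun j => ?_)
    · rw [AlgHom.comp_apply, subst_left]
      split_ifs with h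
      · rw [Finset.mem_singleton] at h
        subst h
        exact (Ideal.Quotient.mk_eq_mk_iff_sub_mem _ _).2 (Ideal.subset_span rfl)
      · rfl
    · rw [AlgHom.comp_apply, subst_right]
  exact DFunLike.congr_fun this f

theorem diffQuot_exists (i : Fin n) (f : Env k n) :
    ∃ q, diffVar k i * q = subst k (Finset.Iio i) f - subst k (Finset.Iic i) f := by
  obtain ⟨q, hq⟩ := diffVar_dvd i (subst k (Finset.Iio i) f)
  refine ⟨q, ?_⟩
  rw [← hq, subst_subst]
  congr 3
  ext j
  simp [le_iff_lt_or_eq, or_comm]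

/-- The difference quotient operator `∂_[i]` on `k[x, x']`: the unique `q` with
`(xᵢ - xᵢ') q = f(x'₁, …, x'ᵢ₋₁, xᵢ, …, xₙ, x') - f(x'₁, …, x'ᵢ, xᵢ₊₁, …, xₙ, x')`. -/
def diffQuot (i : Fin n) (f : Env k n) : Env k n := (diffQuot_exists i f).choose

theorem diffQuot_spec (i : Fin n) (f : Env k n) :
    diffVar k i * diffQuot i f = subst k (Finset.Iio i) f - subst k (Finset.Iic i) f :=
  (diffQuot_exists i f).choose_spec

theorem sum_diffQuot (W : Poly k n) :
    ∑ i, diffQuot i (W ⊗ₜ[k] 1) * diffVar k i = W ⊗ₜ[k] 1 - 1 ⊗ₜ[k] W := by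
  let S : ℕ → Env k n := fun m => subst k (Finset.univ.filter fun j : Fin n => (j : ℕ) < m) (W ⊗ₜ[k] 1)
  have h1 : ∀ i : Fin n, diffQuot i (W ⊗ₜ[k] 1) * diffVar k i = S i - S (i + 1) := fun i => by
    rw [mul_comm, diffQuot_spec]
    have e1 : Finset.Iio i = Finset.univ.filter fun j : Fin n => (j : ℕ) < i := by ext j; simp
    have e2 : Finset.Iic i = Finset.univ.filter fun j : Fin n => (j : ℕ) < i + 1 := by
      ext j
      simp only [Finset.mem_Iic, Finset.mem_filter, Finset.mem_univ, true_and, Fin.le_def]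
      omega
    rw [e1, e2]
  rw [Finset.sum_congr rfl fun i _ => h1 i, Fin.sum_univ_eq_sum_range (fun m => S m - S (m + 1)),
    Finset.sum_range_sub']
  have e0 : S 0 = W ⊗ₜ[k] 1 := by simp [S, subst_empty]
  have en : S n = 1 ⊗ₜ[k] W := by
    have : (Finset.univ.filter fun j : Fin n => (j : ℕ) < n) = Finset.univ := by ext j; simp
    simp only [S, this, subst_univ]
  rw [e0, en]

/-- A sum of anticommuting operators. -/
theorem sum_sum_eq {M : Type u} [AddCommGroup M] (f g : Fin n → M →+ M) (c : Fin n → M →+ M)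
    (hff : ∀ i x, f i (f i x) = 0) (hff' : ∀ i j x, f i (f j x) + f j (f i x) = 0)
    (hgg : ∀ i x, g i (g i x) = 0) (hgg' : ∀ i j x, g i (g j x) + g j (g i x) = 0)
    (hfg : ∀ i j x, f i (g j x) + g j (f i x) = if i = j then c i x else 0) (x : M) :
    ∑ i, (f i + g i) (∑ j, (f j + g j) x) = ∑ i, c i x := by
  have anti : ∀ a : Fin n → M →+ M, (∀ i x, a i (a i x) = 0) →
      (∀ i j x, a i (a j x) + a j (a i x) = 0) → ∑ i, ∑ j, a i (a j x) = 0 := by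
    intro a h0 h1
    rw [← Finset.sum_product']
    refine Finset.sum_involution (fun p _ => (p.2, p.1)) (fun p _ => h1 _ _ _) (fun p _ hp h => ?_)
      (fun p _ => Finset.mem_product.2 ⟨Finset.mem_univ _, Finset.mem_univ _⟩) (fun p _ => rfl)
    obtain ⟨i, j⟩ := p
    have : j = i := (Prod.mk.inj h).1
    subst this
    exact hp (h0 _ _)
  have hc : ∑ i, ∑ j, (f i (g j x) + g i (f j x)) = ∑ i, c i x := by
    simp only [Finset.sum_add_distrib]
    rw [Finset.sum_comm (f := fun i j => g i (f j x)), ← Finset.sum_add_distrib]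
    refine Finset.sum_congr rfl fun i _ => ?_
    rw [← Finset.sum_add_distrib, Finset.sum_congr rfl fun j _ => hfg i j x]
    simp
  have h1 := anti f hff hff'
  have h2 := anti g hgg hgg'
  calc _ = ∑ i, ∑ j, (f i (f j x) + g i (g j x) + (f i (g j x) + g i (f j x))) := by
        refine Finset.sum_congr rfl fun i _ => ?_
        rw [map_sum]
        refine Finset.sum_congr rfl fun j _ => ?_
        simp only [AddMonoidHom.add_apply, map_add]
        abel
    _ = _ := by
        rw [← hc]
        simp only [Finset.sum_add_distrib] at h1 h2 ⊢
        rw [h1, h2]; abel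

end Koszul

section Unit

variable {k : Type u} [CommRing k] {n : ℕ}

open LinFact

theorem koszul_tmul {R : Type u} [CommRing R] [Algebra k R] (f : Fin n → R) (r : R) (x : Ext k n) :
    koszul k f (r ⊗ₜ[k] x) = ∑ i, (f i * r) ⊗ₜ[k] Ext.contract k i x := by
  simp [koszul, LinearMap.sum_apply, smul_tmul']

/-- The operator `∑ᵢ fᵢ θᵢ ∧ -`. -/
def cokoszul (k : Type u) [CommRing k] {R : Type u} [CommRing R] [Algebra k R] (f : Fin n → R) :
    R ⊗[k] Ext k n →ₗ[R] R ⊗[k] Ext k n :=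
  ∑ i, f i • (Ext.wedge k i).baseChange R

theorem cokoszul_tmul {R : Type u} [CommRing R] [Algebra k R] (f : Fin n → R) (r : R)
    (x : Ext k n) : cokoszul k f (r ⊗ₜ[k] x) = ∑ i, (f i * r) ⊗ₜ[k] Ext.wedge k i x := by
  simp [cokoszul, LinearMap.sum_apply, smul_tmul']

theorem baseChange_anticomm {R : Type u} [CommRing R] [Algebra k R] (a b : R)
    {S T U : Ext k n →ₗ[k] Ext k n} (h : ∀ x, S (T x) + T (S x) = U x) (z : R ⊗[k] Ext k n) :
    (a • S.baseChange R) ((b • T.baseChange R) z) + (b • T.baseChange R) ((a • S.baseChange R) z) =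
      (a * b) • U.baseChange R z := by
  have : S ∘ₗ T + T ∘ₗ S = U := LinearMap.ext h
  rw [← this, LinearMap.baseChange_add, LinearMap.baseChange_comp, LinearMap.baseChange_comp]
  simp only [LinearMap.smul_apply, map_smul, LinearMap.add_apply, LinearMap.comp_apply, smul_add,
    smul_smul, mul_comm b a]

theorem baseChange_square {R : Type u} [CommRing R] [Algebra k R] (a : R)
    {S : Ext k n →ₗ[k] Ext k n} (h : ∀ x, S (S x) = 0) (z : R ⊗[k] Ext k n) :
    (a • S.baseChange R) ((a • S.baseChange R) z) = 0 := by
  have : S ∘ₗ S = 0 := LinearMap.ext h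
  simp only [LinearMap.smul_apply, map_smul]
  rw [← LinearMap.comp_apply, ← LinearMap.baseChange_comp, this]
  simp

theorem koszul_cokoszul {R : Type u} [CommRing R] [Algebra k R] (f g : Fin n → R)
    (z : R ⊗[k] Ext k n) :
    (cokoszul k g + koszul k f) ((cokoszul k g + koszul k f) z) = (∑ i, g i * f i) • z := by
  have h := sum_sum_eq
    (fun i => (g i • (Ext.wedge k i).baseChange R).toAddMonoidHom)
    (fun i => (f i • (Ext.contract k i).baseChange R).toAddMonoidHom)
    (fun i => ((g i * f i) • (LinearMap.id : R ⊗[k] Ext k n →ₗ[R] _)).toAddMonoidHom)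
    (fun i x => baseChange_square _ (Ext.wedge_wedge i) x)
    (fun i j x => (baseChange_anticomm _ _ (U := 0) (Ext.wedge_wedge_add i j) x).trans (by simp))
    (fun i x => baseChange_square _ (Ext.contract_contract i) x)
    (fun i j x => (baseChange_anticomm _ _ (U := 0) (Ext.contract_contract_add i j) x).trans
      (by simp))
    (fun i j x => ?_) z
  · simp only [cokoszul, koszul, ← Finset.sum_add_distrib, LinearMap.sum_apply, Finset.sum_smul]
    exact h
  · refine (baseChange_anticomm _ _ (U := if i = j then LinearMap.id else 0) (fun y => ?_) x).trans ?_
    · rw [add_comm, Ext.contract_wedge]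
      by_cases h : j = i
      · simp [h]
      · simp [h, Ne.symm h]
    · by_cases h : i = j
      · subst h
        simp
      · simp [h]

/-- The unit `Δ_W`, the exterior algebra over `Rᵉ = k[x, x']` on `θ₁, …, θₙ` with differential
`∑ᵢ ∂_[i]W θᵢ + ∑ᵢ (xᵢ - xᵢ') θᵢ*`, a matrix factorisation of `W ⊗ 1 - 1 ⊗ W`. -/
def unit (W : Poly k n) : BiFact k (Poly k n) (Poly k n) W W where
  carrier := Env k n ⊗[k] Ext k n
  even := (Ext.even k n).baseChange _
  even_even z := by
    induction z with
    | zero => simp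
    | add x y hx hy => simp only [map_add, hx, hy]
    | tmul r x => simp [Ext.even_even]
  d := cokoszul k (fun i => diffQuot i (W ⊗ₜ[k] 1)) + koszul k (diffVar k)
  d_even z := by
    induction z with
    | zero => simp
    | add x y hx hy => simp only [map_add, hx, hy]; abel
    | tmul r x =>
      simp only [LinearMap.add_apply, LinearMap.baseChange_tmul, koszul_tmul, cokoszul_tmul, map_add,
        map_sum, Ext.wedge_even, Ext.contract_even, tmul_sub, Finset.sum_sub_distrib]
      abel
  d_d z := by rw [koszul_cokoszul, sum_diffQuot]

theorem unit_isFiniteMF (W : Poly k n) : (unit W).IsFiniteMF := by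
  have : Module.Free k (Ext k n) := Module.Free.of_basis (Pi.basisFun k (Fin n)).ExteriorAlgebra
  have : Module.Finite k (Ext k n) := Module.Finite.of_basis (Pi.basisFun k (Fin n)).ExteriorAlgebra
  exact ⟨inferInstanceAs (Module.Free (Env k n) (Env k n ⊗[k] Ext k n)),
    inferInstanceAs (Module.Finite (Env k n) (Env k n ⊗[k] Ext k n))⟩

/-- The composite of the projection to `θ`-degree `0` with multiplication. -/
def multProj (k : Type u) [CommRing k] (n : ℕ) : Env k n ⊗[k] Ext k n →+ Poly k n :=
  (Algebra.TensorProduct.lmul' k (S := Poly k n)).toRingHom.toAddMonoidHom.comp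
    (koszulAug k (n := n) (Env k n)).toAddMonoidHom

theorem multProj_apply (z : Env k n ⊗[k] Ext k n) : multProj k n z =
    Algebra.TensorProduct.lmul' k (S := Poly k n) (koszulAug k (n := n) (Env k n) z) := rfl

theorem multProj_tmul (e : Env k n) (x : Ext k n) :
    multProj k n (e ⊗ₜ[k] x) =
      Ext.aug k n x • Algebra.TensorProduct.lmul' k (S := Poly k n) e := by
  rw [multProj_apply, ← map_smul]
  rfl

/-- The projection `π : Δ_W → R`. -/
def unitProj (W : Poly k n) : (unit W).carrier →+ Poly k n := multProj k n

theorem unitProj_smul (W : Poly k n) (e : Env k n) (z : (unit W).carrier) :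
    unitProj W (e • z) = Algebra.TensorProduct.lmul' k (S := Poly k n) e * unitProj W z := by
  refine (multProj_apply (e • (show Env k n ⊗[k] Ext k n from z))).trans ?_
  rw [map_smul, smul_eq_mul, map_mul]
  rfl

theorem unitProj_smul_left (W : Poly k n) (r : Poly k n) (z : (unit W).carrier) :
    unitProj W ((r ⊗ₜ[k] (1 : Poly k n)) • z) = unitProj W z * r := by
  rw [unitProj_smul, Algebra.TensorProduct.lmul'_apply_tmul, mul_one, mul_comm]

theorem unitProj_smul_right (W : Poly k n) (r : Poly k n) (z : (unit W).carrier) :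
    unitProj W (((1 : Poly k n) ⊗ₜ[k] r) • z) = unitProj W z * r := by
  rw [unitProj_smul, Algebra.TensorProduct.lmul'_apply_tmul, one_mul, mul_comm]

theorem multProj_even (z : Env k n ⊗[k] Ext k n) :
    multProj k n ((Ext.even k n).baseChange _ z) = multProj k n z := by
  induction z with
  | zero => simp
  | add x y hx hy => rw [map_add, map_add, hx, hy, map_add]
  | tmul r x => rw [LinearMap.baseChange_tmul, multProj_tmul, multProj_tmul, Ext.aug_even]

theorem multProj_cokoszul (f : Fin n → Env k n) (z : Env k n ⊗[k] Ext k n) :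
    multProj k n (cokoszul k f z) = 0 := by
  induction z with
  | zero => simp
  | add x y hx hy => rw [map_add, map_add, hx, hy, add_zero]
  | tmul r x =>
    rw [cokoszul_tmul, map_sum, Finset.sum_eq_zero fun i _ => ?_]
    rw [multProj_tmul, Ext.aug_wedge, zero_smul]

theorem multProj_koszul (z : Env k n ⊗[k] Ext k n) :
    multProj k n (koszul k (diffVar k) z) = 0 := by
  induction z with
  | zero => simp
  | add x y hx hy => rw [map_add, map_add, hx, hy, add_zero]
  | tmul r x =>
    rw [koszul_tmul, map_sum, Finset.sum_eq_zero fun i _ => ?_]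
    rw [multProj_tmul, map_mul]
    simp [diffVar]

theorem unitProj_even (W : Poly k n) (z : (unit W).carrier) :
    unitProj W ((unit W).even z) = unitProj W z := multProj_even z

theorem unitProj_odd (W : Poly k n) (z : (unit W).carrier) : unitProj W ((unit W).odd z) = 0 := by
  simp only [odd, LinearMap.sub_apply, LinearMap.id_apply, map_sub, unitProj_even, sub_self]

theorem unitProj_sgn (W : Poly k n) (z : (unit W).carrier) :
    unitProj W ((unit W).sgn z) = unitProj W z := by
  simp only [sgn, LinearMap.sub_apply, map_sub, unitProj_even, unitProj_odd, sub_zero]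

theorem unitProj_d (W : Poly k n) (z : (unit W).carrier) : unitProj W ((unit W).d z) = 0 := by
  refine (map_add (multProj k n) _ _).trans ?_
  exact (congrArg₂ (· + ·) (multProj_cokoszul _ _) (multProj_koszul _)).trans (add_zero 0)

end Unit

namespace BiFact

open LinFact BiTensor

section

variable {k R₅ R₄ R₃ R₂ R₁ : Type u} [CommRing k] [CommRing R₅] [CommRing R₄] [CommRing R₃]
  [CommRing R₂] [CommRing R₁] [Algebra k R₅] [Algebra k R₄] [Algebra k R₃] [Algebra k R₂]
  [Algebra k R₁] {V₅ : R₅} {V₄ : R₄} {V₃ : R₃} {V₂ : R₂} {V₁ : R₁}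

theorem tensorHom_assoc {Z Z' : BiFact k R₄ R₃ V₄ V₃} {Y Y' : BiFact k R₃ R₂ V₃ V₂}
    {X X' : BiFact k R₂ R₁ V₂ V₁} (ζ : Z ⟶ Z') (η : Y ⟶ Y') (ξ : X ⟶ X') :
    tensorHom (tensorHom ζ η) ξ =
      (assoc Z Y X).hom ≫ tensorHom ζ (tensorHom η ξ) ≫ (assoc Z' Y' X').inv := by
  rw [← Category.assoc, ← assoc_naturality, Category.assoc, Iso.hom_inv_id, Category.comp_id]

theorem tensorHom_assoc' {Z Z' : BiFact k R₄ R₃ V₄ V₃} {Y Y' : BiFact k R₃ R₂ V₃ V₂}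
    {X X' : BiFact k R₂ R₁ V₂ V₁} (ζ : Z ⟶ Z') (η : Y ⟶ Y') (ξ : X ⟶ X') :
    tensorHom ζ (tensorHom η ξ) =
      (assoc Z Y X).inv ≫ tensorHom (tensorHom ζ η) ξ ≫ (assoc Z' Y' X').hom := by
  rw [assoc_naturality, Iso.inv_hom_id_assoc]

theorem comp_tensorHom_id {Y Y' Y'' : BiFact k R₃ R₂ V₃ V₂} (φ : Y ⟶ Y') (φ' : Y' ⟶ Y'')
    (X : BiFact k R₂ R₁ V₂ V₁) :
    tensorHom (φ ≫ φ') (𝟙 X) = tensorHom φ (𝟙 X) ≫ tensorHom φ' (𝟙 X) := by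
  rw [← tensorHom_comp, Category.comp_id]

theorem id_tensorHom_comp {X X' X'' : BiFact k R₂ R₁ V₂ V₁} (ψ : X ⟶ X') (ψ' : X' ⟶ X'')
    (Y : BiFact k R₃ R₂ V₃ V₂) :
    tensorHom (𝟙 Y) (ψ ≫ ψ') = tensorHom (𝟙 Y) ψ ≫ tensorHom (𝟙 Y) ψ' := by
  rw [← tensorHom_comp, Category.comp_id]

theorem tensorHom_exchange {Y Y' : BiFact k R₃ R₂ V₃ V₂} {X X' : BiFact k R₂ R₁ V₂ V₁}
    (ψ : X ⟶ X') (φ : Y ⟶ Y') :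
    tensorHom φ (𝟙 X) ≫ tensorHom (𝟙 Y') ψ = tensorHom (𝟙 Y) ψ ≫ tensorHom φ (𝟙 X') := by
  rw [← tensorHom_comp, ← tensorHom_comp, Category.comp_id, Category.comp_id, Category.id_comp,
    Category.id_comp]

theorem pentagon_inv (T : BiFact k R₅ R₄ V₅ V₄) (Z : BiFact k R₄ R₃ V₄ V₃)
    (Y : BiFact k R₃ R₂ V₃ V₂) (X : BiFact k R₂ R₁ V₂ V₁) :
    tensorHom (𝟙 T) (assoc Z Y X).inv ≫ (assoc T (tensor Z Y) X).inv ≫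
      tensorHom (assoc T Z Y).inv (𝟙 X) =
      (assoc T Z (tensor Y X)).inv ≫ (assoc (tensor T Z) Y X).inv := by
  have h := pentagon T Z Y X
  have h₁ : tensorHom (assoc T Z Y).hom (𝟙 X) ≫ tensorHom (assoc T Z Y).inv (𝟙 X) = 𝟙 _ := by
    rw [← comp_tensorHom_id, Iso.hom_inv_id, tensorHom_id]
  have h₂ : tensorHom (𝟙 T) (assoc Z Y X).hom ≫ tensorHom (𝟙 T) (assoc Z Y X).inv = 𝟙 _ := by
    rw [← id_tensorHom_comp, Iso.hom_inv_id, tensorHom_id]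
  rw [Iso.eq_inv_comp, ← cancel_epi (assoc (tensor T Z) Y X).hom, Iso.hom_inv_id, ← Category.assoc,
    ← h]
  simp only [Category.assoc]
  rw [← Category.assoc (tensorHom (𝟙 T) (assoc Z Y X).hom), h₂, Category.id_comp,
    Iso.hom_inv_id_assoc, h₁]

theorem eq_comp_inv_of {k R₂ R₁ : Type u} [CommRing k] [CommRing R₂] [CommRing R₁] [Algebra k R₂]
    [Algebra k R₁] {V₂ : R₂} {V₁ : R₁} {A B C D : BiFact k R₂ R₁ V₂ V₁} {η : A ⟶ B} (g : B ⟶ C)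
    [IsIso g] {f : A ⟶ D} {h : D ⟶ C} (H : η ≫ g = f ≫ h) : η = f ≫ h ≫ inv g := by
  rw [← Category.assoc, ← H, Category.assoc, IsIso.hom_inv_id, Category.comp_id]

end

end BiFact

section Unitors

variable {k : Type u} [CommRing k] {n : ℕ}

open LinFact BiFact BiTensor

variable {m : ℕ}

theorem zero_tmul_smul {M : Type u} [AddCommGroup M] [Module (Poly k m ⊗[k] Poly k n) M]
    (p : Poly k n) (x : M) : ((0 : Poly k m) ⊗ₜ[k] p) • x = 0 := by
  rw [zero_tmul]
  exact zero_smul (Poly k m ⊗[k] Poly k n) x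

theorem tmul_zero_smul {M : Type u} [AddCommGroup M] [Module (Poly k m ⊗[k] Poly k n) M]
    (p : Poly k m) (x : M) : (p ⊗ₜ[k] (0 : Poly k n)) • x = 0 := by
  rw [tmul_zero]
  exact zero_smul (Poly k m ⊗[k] Poly k n) x

/-- The map `δ ⊗ x ↦ π(δ) x`. -/
def leftUnitLin {V : Poly k m} {W : Poly k n} (X : BiFact k (Poly k m) (Poly k n) V W) :
    BiTensor k (Poly k m) (Poly k m) (Poly k n) (unit V).carrier X.carrier
      →ₗ[Poly k m ⊗[k] Poly k n] X.carrier :=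
  liftLin (fun δ x => (unitProj V δ ⊗ₜ[k] (1 : Poly k n)) • x)
    (fun δ δ' x => by rw [map_add, add_tmul, add_smul])
    (fun δ x x' => by rw [smul_add])
    (fun r δ x => by
      rw [unitProj_smul_right, smul_smul, Algebra.TensorProduct.tmul_mul_tmul, one_mul])
    (fun r s δ x => by
      rw [unitProj_smul_left, smul_smul, smul_smul, Algebra.TensorProduct.tmul_mul_tmul,
        Algebra.TensorProduct.tmul_mul_tmul, one_mul, mul_one, mul_one, mul_comm])

theorem leftUnitLin_mk {V : Poly k m} {W : Poly k n} (X : BiFact k (Poly k m) (Poly k n) V W)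
    (δ : (unit V).carrier) (x : X.carrier) :
    leftUnitLin X (BiTensor.mk k _ _ _ δ x) = (unitProj V δ ⊗ₜ[k] (1 : Poly k n)) • x := rfl

/-- The left unit action `λ_X = π ⊗ 1 : Δ_V ⊗ X → X`. -/
def leftUnitMor {V : Poly k m} {W : Poly k n} (X : BiFact k (Poly k m) (Poly k n) V W) :
    Mor (tensor (unit V) X) X where
  lin := leftUnitLin X
  isEven := tensor_ext _ _ (fun x y => by rw [map_add, map_add]) (fun x y => by rw [map_add, map_add])
    fun δ x => by
      rw [tensor_even_mk, map_add, leftUnitLin_mk, leftUnitLin_mk, leftUnitLin_mk, unitProj_even,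
        unitProj_odd, zero_tmul_smul, add_zero, map_smul]
  comm := tensor_ext _ _ (fun x y => by rw [map_add, map_add]) (fun x y => by rw [map_add, map_add])
    fun δ x => by
      rw [tensor_d_mk, map_add, leftUnitLin_mk, leftUnitLin_mk, leftUnitLin_mk, unitProj_sgn,
        unitProj_d, zero_tmul_smul, zero_add, map_smul]

/-- The map `x ⊗ δ ↦ x π(δ)`. -/
def rightUnitLin {V : Poly k m} {W : Poly k n} (X : BiFact k (Poly k m) (Poly k n) V W) :
    BiTensor k (Poly k m) (Poly k n) (Poly k n) X.carrier (unit W).carrier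
      →ₗ[Poly k m ⊗[k] Poly k n] X.carrier :=
  liftLin (fun x δ => ((1 : Poly k m) ⊗ₜ[k] unitProj W δ) • x)
    (fun x x' δ => by rw [smul_add])
    (fun x δ δ' => by rw [map_add, tmul_add, add_smul])
    (fun r x δ => by
      rw [unitProj_smul_left, smul_smul, Algebra.TensorProduct.tmul_mul_tmul, one_mul])
    (fun r s x δ => by
      rw [unitProj_smul_right, smul_smul, smul_smul, Algebra.TensorProduct.tmul_mul_tmul,
        Algebra.TensorProduct.tmul_mul_tmul, one_mul, mul_one, mul_one, mul_comm s])

theorem rightUnitLin_mk {V : Poly k m} {W : Poly k n} (X : BiFact k (Poly k m) (Poly k n) V W)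
    (x : X.carrier) (δ : (unit W).carrier) :
    rightUnitLin X (BiTensor.mk k _ _ _ x δ) = ((1 : Poly k m) ⊗ₜ[k] unitProj W δ) • x := rfl

/-- The right unit action `ρ_X = 1 ⊗ π : X ⊗ Δ_W → X`. -/
def rightUnitMor {V : Poly k m} {W : Poly k n} (X : BiFact k (Poly k m) (Poly k n) V W) :
    Mor (tensor X (unit W)) X where
  lin := rightUnitLin X
  isEven := tensor_ext _ _ (fun x y => by rw [map_add, map_add]) (fun x y => by rw [map_add, map_add])
    fun x δ => by
      rw [tensor_even_mk, map_add, rightUnitLin_mk, rightUnitLin_mk, rightUnitLin_mk, unitProj_even,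
        unitProj_odd, tmul_zero_smul, add_zero, map_smul]
  comm := tensor_ext _ _ (fun x y => by rw [map_add, map_add]) (fun x y => by rw [map_add, map_add])
    fun x δ => by
      rw [tensor_d_mk, map_add, rightUnitLin_mk, rightUnitLin_mk, rightUnitLin_mk, unitProj_d,
        tmul_zero_smul, add_zero, map_smul]

theorem leftUnit_naturality {V : Poly k m} {W : Poly k n}
    {X X' : BiFact k (Poly k m) (Poly k n) V W} (η : X ⟶ X') :
    tensorHom (𝟙 (unit V)) η ≫ (leftUnitMor X').cls = (leftUnitMor X).cls ≫ η := by
  obtain ⟨η, rfl⟩ := cls_surj η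
  refine Mor.cls_eq (tensor_ext _ _ (fun _ _ => map_add _ _ _)
    (fun _ _ => map_add _ _ _) fun δ x => ?_)
  exact (map_smul η.lin (unitProj V δ ⊗ₜ[k] (1 : Poly k n)) x).symm

theorem rightUnit_naturality {V : Poly k m} {W : Poly k n}
    {X X' : BiFact k (Poly k m) (Poly k n) V W} (η : X ⟶ X') :
    tensorHom η (𝟙 (unit W)) ≫ (rightUnitMor X').cls = (rightUnitMor X).cls ≫ η := by
  obtain ⟨η, rfl⟩ := cls_surj η
  refine Mor.cls_eq (tensor_ext _ _ (fun _ _ => map_add _ _ _)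
    (fun _ _ => map_add _ _ _) fun x δ => ?_)
  exact (map_smul η.lin ((1 : Poly k m) ⊗ₜ[k] unitProj W δ) x).symm

theorem unit_triangle {l : ℕ} {U : Poly k l} {V : Poly k m} {W : Poly k n}
    (Y : BiFact k (Poly k l) (Poly k m) U V) (X : BiFact k (Poly k m) (Poly k n) V W) :
    (assoc Y (unit V) X).hom ≫ tensorHom (𝟙 Y) (leftUnitMor X).cls =
      tensorHom (rightUnitMor Y).cls (𝟙 X) := by
  refine Mor.cls_eq (tensor_ext₃ _ _ _ (fun _ _ => map_add _ _ _)
    (fun _ _ => map_add _ _ _) fun y δ x => ?_)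
  exact (mk_balanced k _ _ _ (unitProj V δ) y x).symm

theorem unit_triangle_inv {l : ℕ} {U : Poly k l} {V : Poly k m} {W : Poly k n}
    (Y : BiFact k (Poly k l) (Poly k m) U V) (X : BiFact k (Poly k m) (Poly k n) V W) :
    (assoc Y (unit V) X).inv ≫ tensorHom (rightUnitMor Y).cls (𝟙 X) =
      tensorHom (𝟙 Y) (leftUnitMor X).cls := by
  rw [← unit_triangle, Iso.inv_hom_id_assoc]

end Unitors

/-! ### The bicategory of Landau-Ginzburg models -/

/-- An object of `LG k`: a ring `R = k[x₁, …, xₙ]` together with a potential `W ∈ R`. -/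
structure LG (k : Type u) [CommRing k] where
  n : ℕ
  W : Poly k n
  isPotential : IsPotential k W

namespace LG

open LinFact BiFact

variable {k : Type u} [CommRing k]

/-- A 1-morphism `(R, W) → (S, V)`: an object of `hmf(S ⊗ₖ R, V ⊗ 1 - 1 ⊗ W)^ω`. -/
structure Hom₁ (a b : LG k) where
  fact : BiFact k (Poly k b.n) (Poly k a.n) b.W a.W
  isSummandMF : fact.IsSummandMF

instance (a b : LG k) : Category (Hom₁ a b) where
  Hom X Y := X.fact ⟶ Y.fact
  id X := 𝟙 X.fact
  comp f g := f ≫ g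
  id_comp f := Category.id_comp f
  comp_id f := Category.comp_id f
  assoc f g h := Category.assoc f g h

/-- Isomorphisms of 1-morphisms are isomorphisms of the underlying factorisations. -/
def isoMk {a b : LG k} (X Y : Hom₁ a b) (e : X.fact ≅ Y.fact) : X ≅ Y :=
  ⟨e.hom, e.inv, e.hom_inv_id, e.inv_hom_id⟩

variable (k) in
/-- The composite `Y ⊗_R X` of 1-morphisms is again a 1-morphism. -/
def CompClosed : Prop :=
  ∀ (a b c : LG k) (X : Hom₁ a b) (Y : Hom₁ b c), (tensor Y.fact X.fact).IsSummandMF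

variable (k) in
/-- The unit actions are isomorphisms, i.e. homotopy equivalences. -/
def UnitorsInvertible : Prop :=
  ∀ (a b : LG k) (X : Hom₁ a b), IsIso (leftUnitMor X.fact).cls ∧ IsIso (rightUnitMor X.fact).cls

/-- The unit 1-morphism `Δ_W`. -/
def id₁ (a : LG k) : Hom₁ a a :=
  ⟨unit a.W, (unit_isFiniteMF a.W).1, _, unit_isFiniteMF a.W, ⟨Retract.refl _⟩⟩

/-- The composite of 1-morphisms `X : a → b` and `Y : b → c` is `Y ⊗ X`. -/
def comp₁ (hc : CompClosed k) {a b c : LG k} (X : Hom₁ a b) (Y : Hom₁ b c) : Hom₁ a c :=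
  ⟨tensor Y.fact X.fact, hc a b c X Y⟩

/-- The associator of `LG k`. -/
def associator₁ (hc : CompClosed k) {a b c d : LG k} (X : Hom₁ a b) (Y : Hom₁ b c)
    (Z : Hom₁ c d) : comp₁ hc (comp₁ hc X Y) Z ≅ comp₁ hc X (comp₁ hc Y Z) :=
  isoMk (comp₁ hc (comp₁ hc X Y) Z) (comp₁ hc X (comp₁ hc Y Z))
    (assoc Z.fact Y.fact X.fact).symm

/-- The isomorphism `ρ_X : X ⊗ Δ → X`. -/
def leftUnitor₁ (hc : CompClosed k) (hu : UnitorsInvertible k) {a b : LG k} (X : Hom₁ a b) :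
    comp₁ hc (id₁ a) X ≅ X :=
  have := (hu a b X).2
  let e : tensor X.fact (unit a.W) ≅ X.fact := asIso (rightUnitMor X.fact).cls
  isoMk (comp₁ hc (id₁ a) X) X e

/-- The isomorphism `λ_X : Δ ⊗ X → X`. -/
def rightUnitor₁ (hc : CompClosed k) (hu : UnitorsInvertible k) {a b : LG k} (X : Hom₁ a b) :
    comp₁ hc X (id₁ b) ≅ X :=
  have := (hu a b X).1
  let e : tensor (unit b.W) X.fact ≅ X.fact := asIso (leftUnitMor X.fact).cls
  isoMk (comp₁ hc X (id₁ b)) X e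

/-- The bicategory `LG k`. The composite `f ≫ g` is `g ⊗ f`. -/
@[reducible]
def bicategory (hc : CompClosed k) (hu : UnitorsInvertible k) : Bicategory (LG k) where
  Hom := Hom₁
  id := id₁
  comp f g := comp₁ hc f g
  whiskerLeft f g h η := tensorHom (Y := g.fact) (Y' := h.fact) η (𝟙 f.fact)
  whiskerRight {_ _ _ f g} η h := tensorHom (X := f.fact) (X' := g.fact) (𝟙 h.fact) η
  associator f g h := associator₁ hc f g h
  leftUnitor f := leftUnitor₁ hc hu f
  rightUnitor f := rightUnitor₁ hc hu f
  whiskerLeft_id f g := tensorHom_id g.fact f.fact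
  whiskerLeft_comp f _ _ _ η θ := comp_tensorHom_id η θ f.fact
  id_whiskerLeft {a b f g} η := by
    have := (hu a b g).2
    exact eq_comp_inv_of (rightUnitMor g.fact).cls (rightUnit_naturality η)
  comp_whiskerLeft f g h h' η := by
    have := tensorHom_assoc' η (𝟙 g.fact) (𝟙 f.fact)
    rw [tensorHom_id] at this
    exact this
  id_whiskerRight f g := tensorHom_id g.fact f.fact
  comp_whiskerRight η θ i := id_tensorHom_comp η θ i.fact
  whiskerRight_id {a b f g} η := by
    have := (hu a b g).1
    exact eq_comp_inv_of (leftUnitMor g.fact).cls (leftUnit_naturality η)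
  whiskerRight_comp η g h := by
    have := tensorHom_assoc (𝟙 h.fact) (𝟙 g.fact) η
    rw [tensorHom_id] at this
    exact this
  whisker_assoc f g g' η h := tensorHom_assoc' (𝟙 h.fact) η (𝟙 f.fact)
  whisker_exchange η θ := tensorHom_exchange η θ
  pentagon f g h i := pentagon_inv i.fact h.fact g.fact f.fact
  triangle {a b c} f g := unit_triangle_inv g.fact f.fact

end LG

/-! ### Cohomology of `ℤ/2`-graded complexes -/

namespace LinFact

variable {k : Type u} [CommRing k]

/-- The homogeneous elements of degree `i`. -/
def gr (X : LinFact k 0) (i : ZMod 2) : Submodule k X.carrier where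
  carrier := {x | X.even x = if i = 0 then x else 0}
  add_mem' {x y} hx hy := by
    simp only [Set.mem_ofPred_eq] at hx hy ⊢
    rw [map_add, hx, hy]
    split_ifs <;> simp
  zero_mem' := by simp
  smul_mem' c x hx := by
    simp only [Set.mem_ofPred_eq] at hx ⊢
    rw [map_smul, hx]
    split_ifs <;> simp

theorem mem_gr {X : LinFact k 0} {i : ZMod 2} {x : X.carrier} :
    x ∈ X.gr i ↔ X.even x = if i = 0 then x else 0 := Iff.rfl

theorem add_one_eq_zero_iff : ∀ i : ZMod 2, i + 1 = 0 ↔ i ≠ 0 := by decide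

theorem IsOdd.mem_gr {X Y : LinFact k 0} {h : X.carrier →ₗ[k] Y.carrier} (ho : IsOdd h)
    {i : ZMod 2} {x : X.carrier} (hx : x ∈ X.gr i) : h x ∈ Y.gr (i + 1) := by
  have h1 := ho x
  rw [LinFact.mem_gr] at hx ⊢
  rw [hx] at h1
  by_cases hi : i = 0
  · rw [if_pos hi] at h1
    rw [if_neg (fun h => (add_one_eq_zero_iff i).1 h hi)]
    exact sub_eq_self.1 h1.symm
  · rw [if_neg hi, map_zero] at h1
    rw [if_pos ((add_one_eq_zero_iff i).2 hi)]
    exact (sub_eq_zero.1 h1.symm).symm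

theorem IsEven.mem_gr {X Y : LinFact k 0} {f : X.carrier →ₗ[k] Y.carrier} (he : IsEven f)
    {i : ZMod 2} {x : X.carrier} (hx : x ∈ X.gr i) : f x ∈ Y.gr i := by
  have h1 := he x
  rw [LinFact.mem_gr] at hx ⊢
  rw [← h1, hx]
  split_ifs
  · rfl
  · exact map_zero f

/-- The cocycles of degree `i`. -/
def cocycles (X : LinFact k 0) (i : ZMod 2) : Submodule k X.carrier := X.gr i ⊓ LinearMap.ker X.d

/-- The coboundaries of degree `i`, inside the cocycles. -/
def coboundaries (X : LinFact k 0) (i : ZMod 2) : Submodule k (X.cocycles i) :=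
  ((X.gr (i + 1)).map X.d).submoduleOf (X.cocycles i)

/-- The map on cocycles induced by a morphism. -/
def Mor.cocyclesMap {X Y : LinFact k 0} (φ : Mor X Y) (i : ZMod 2) :
    X.cocycles i →ₗ[k] Y.cocycles i :=
  φ.lin.restrict fun x hx => ⟨φ.isEven.mem_gr hx.1, by
    have h : X.d x = 0 := hx.2
    change Y.d (φ.lin x) = 0
    rw [φ.comm, h, map_zero]⟩

theorem Mor.cocyclesMap_coe {X Y : LinFact k 0} (φ : Mor X Y) (i : ZMod 2) (x : X.cocycles i) :
    (φ.cocyclesMap i x : Y.carrier) = φ.lin x := rfl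

theorem Mor.cocyclesMap_coboundaries {X Y : LinFact k 0} (φ : Mor X Y) (i : ZMod 2) :
    X.coboundaries i ≤ (Y.coboundaries i).comap (φ.cocyclesMap i) := by
  rintro x ⟨y, hy, hxy⟩
  refine ⟨φ.lin y, φ.isEven.mem_gr hy, ?_⟩
  rw [φ.comm, hxy]
  rfl

/-- The cohomology `Hⁱ` of a `ℤ/2`-graded complex of `k`-modules. -/
abbrev cohomology (X : LinFact k 0) (i : ZMod 2) : Type u := X.cocycles i ⧸ X.coboundaries i

/-- The map on cohomology induced by a morphism. -/
def Mor.cohomologyMap {X Y : LinFact k 0} (φ : Mor X Y) (i : ZMod 2) :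
    X.cohomology i →ₗ[k] Y.cohomology i :=
  Submodule.mapQ _ _ (φ.cocyclesMap i) (φ.cocyclesMap_coboundaries i)

theorem Homotopic.cohomologyMap_eq {X Y : LinFact k 0} {φ ψ : Mor X Y} (H : Homotopic φ ψ)
    (i : ZMod 2) : φ.cohomologyMap i = ψ.cohomologyMap i := by
  obtain ⟨h, ho, he⟩ := H
  refine LinearMap.ext fun x => ?_
  obtain ⟨x, rfl⟩ := Submodule.Quotient.mk_surjective _ x
  symm
  refine (Submodule.Quotient.eq (Y.coboundaries i)).2 ⟨h x, ho.mem_gr x.2.1, ?_⟩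
  have h1 := he x
  have h2 : X.d x = 0 := x.2.2
  rw [h2, map_zero, add_zero] at h1
  exact h1

variable (k) in
/-- The cohomology functor `H^*` from `HF(k, 0)` to `ℤ/2`-graded `k`-modules. -/
def cohomologyFunctor : LinFact k 0 ⥤ GradedObject (ZMod 2) (ModuleCat.{u} k) where
  obj X := fun i => ModuleCat.of k (X.cohomology i)
  map {X Y} f := fun i => ModuleCat.ofHom (Quotient.lift (fun φ : Mor X Y => φ.cohomologyMap i)
    (fun _ _ H => Homotopic.cohomologyMap_eq H i) f)
  map_id X := by
    funext i
    refine ModuleCat.hom_ext (LinearMap.ext fun x => ?_)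
    obtain ⟨x, rfl⟩ := Submodule.Quotient.mk_surjective _ x
    rfl
  map_comp {X Y Z} f g := by
    obtain ⟨f, rfl⟩ := cls_surj f
    obtain ⟨g, rfl⟩ := cls_surj g
    funext i
    refine ModuleCat.hom_ext (LinearMap.ext fun x => ?_)
    obtain ⟨x, rfl⟩ := Submodule.Quotient.mk_surjective _ x
    rfl

end LinFact

/-! ### The functor `- ⊗_{Rᵉ} R` -/

section Trace

variable (k R : Type u) [CommRing k] [CommRing R] [Algebra k R]

/-- The ring `R` as a module over `Rᵉ = R ⊗ₖ R`, through the multiplication map. -/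
def Diag (_k R : Type u) : Type u := R

instance : AddCommGroup (Diag k R) := inferInstanceAs (AddCommGroup R)

instance : Module (R ⊗[k] R) (Diag k R) :=
  Module.compHom R (Algebra.TensorProduct.lmul' k (S := R)).toRingHom

theorem Diag.smul_def (e : R ⊗[k] R) (r : R) :
    (show Diag k R from e • (show Diag k R from r)) =
      (show Diag k R from (Algebra.TensorProduct.lmul' k (S := R) e * r : R)) := rfl

/-- The `k`-module `M ⊗_{Rᵉ} R`. -/
def TraceMod (M : Type u) [AddCommGroup M] [Module (R ⊗[k] R) M] : Type u :=
  M ⊗[R ⊗[k] R] Diag k R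

namespace TraceMod

variable (M : Type u) [AddCommGroup M] [Module (R ⊗[k] R) M]

instance : AddCommGroup (TraceMod k R M) := inferInstanceAs (AddCommGroup (M ⊗[R ⊗[k] R] Diag k R))

instance : Module k (TraceMod k R M) :=
  Module.compHom (M ⊗[R ⊗[k] R] Diag k R) (algebraMap k (R ⊗[k] R))

variable {M}

/-- The pure tensor `m ⊗ r`. -/
def mk (m : M) (r : R) : TraceMod k R M := m ⊗ₜ[R ⊗[k] R] (show Diag k R from r)

theorem add_mk (m m' : M) (r : R) : mk k R (m + m') r = mk k R m r + mk k R m' r :=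
  TensorProduct.add_tmul (R := R ⊗[k] R) m m' (show Diag k R from r)

theorem mk_add (m : M) (r r' : R) : mk k R m (r + r') = mk k R m r + mk k R m r' :=
  TensorProduct.tmul_add (R := R ⊗[k] R) m (show Diag k R from r) (show Diag k R from r')

theorem zero_mk (r : R) : mk k R (0 : M) r = 0 :=
  TensorProduct.zero_tmul (R := R ⊗[k] R) M (show Diag k R from r)

theorem sub_mk (m m' : M) (r : R) : mk k R (m - m') r = mk k R m r - mk k R m' r :=
  TensorProduct.sub_tmul (R := R ⊗[k] R) m m' (show Diag k R from r)

theorem smul_mk (c : k) (m : M) (r : R) :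
    c • mk k R m r = mk k R (algebraMap k (R ⊗[k] R) c • m) r := rfl

theorem balanced (e : R ⊗[k] R) (m : M) (r : R) :
    mk k R (e • m) r = mk k R m (Algebra.TensorProduct.lmul' k (S := R) e * r) :=
  TensorProduct.smul_tmul (R := R ⊗[k] R) e m (show Diag k R from r)

theorem mk_eq (m : M) (r : R) : mk k R m r = mk k R ((r ⊗ₜ[k] (1 : R)) • m) 1 := by
  rw [balanced, Algebra.TensorProduct.lmul'_apply_tmul, mul_one, mul_one]

variable {k R}

theorem induction {p : TraceMod k R M → Prop} (hm : ∀ m, p (mk k R m 1))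
    (ha : ∀ x y, p x → p y → p (x + y)) (x) : p x :=
  TensorProduct.induction_on (R := R ⊗[k] R) (motive := p) x
    (by
      have := hm 0
      rwa [zero_mk] at this)
    (fun m r => by
      have := hm (((show R from r) ⊗ₜ[k] (1 : R)) • m)
      exact (congrArg p (mk_eq k R m (show R from r))).mpr this) ha

theorem ext_apply {P : Type u} [AddCommGroup P] {f g : TraceMod k R M → P}
    (hf : ∀ x y, f (x + y) = f x + f y) (hg : ∀ x y, g (x + y) = g x + g y)
    (h : ∀ m, f (mk k R m 1) = g (mk k R m 1)) (x) : f x = g x := by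
  induction x using induction with
  | hm m => exact h m
  | ha x y hx hy => rw [hf, hg, hx, hy]

/-- The universal property of `M ⊗_{Rᵉ} R`: an additive map out of `M` which is invariant under
exchanging the two actions of `R` extends along `m ↦ m ⊗ 1`. -/
def lift {P : Type u} [AddCommGroup P] [Module k P] (f : M →+ P)
    (hf : ∀ (r : R) m, f ((r ⊗ₜ[k] (1 : R)) • m) = f (((1 : R) ⊗ₜ[k] r) • m))
    (hc : ∀ (c : k) m, f (algebraMap k (R ⊗[k] R) c • m) = c • f m) : TraceMod k R M →ₗ[k] P :=
  let g : TraceMod k R M →+ P := TensorProduct.liftAddHom (R := R ⊗[k] R) (M := M) (N := Diag k R)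
    (AddMonoidHom.mk' (fun m => AddMonoidHom.mk'
        (fun r : Diag k R => f (((show R from r) ⊗ₜ[k] (1 : R)) • m))
        fun r r' => by
          rw [← map_add, ← add_smul, ← add_tmul]; rfl)
      fun m m' => by ext r; simp)
    (fun e m r => by
      change f _ = f (((Algebra.TensorProduct.lmul' k (S := R) e * (show R from r)) ⊗ₜ[k] (1 : R)) • m)
      induction e with
      | zero =>
        rw [zero_smul, smul_zero, map_zero, map_zero, zero_mul, zero_tmul, zero_smul, map_zero]
      | add e e' h h' =>
        rw [add_smul, smul_add, map_add, h, h', map_add, add_mul, add_tmul, add_smul, map_add]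
      | tmul a b =>
        rw [Algebra.TensorProduct.lmul'_apply_tmul, smul_smul, Algebra.TensorProduct.tmul_mul_tmul,
          one_mul]
        have h1 : ((show R from r) * a) ⊗ₜ[k] b =
            ((1 : R) ⊗ₜ[k] b) * (((show R from r) * a) ⊗ₜ[k] (1 : R)) := by
          rw [Algebra.TensorProduct.tmul_mul_tmul, one_mul, mul_one]
        rw [h1, mul_smul, ← hf, smul_smul, Algebra.TensorProduct.tmul_mul_tmul, mul_one]
        congr 3
        ring)
  have hg : ∀ m, g (mk k R m 1) = f m := fun m => by
    change f (((1 : R) ⊗ₜ[k] (1 : R)) • m) = f m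
    rw [← Algebra.TensorProduct.one_def, one_smul]
  { g with
    map_smul' := fun c x => by
      change g (c • x) = c • g x
      induction x using induction with
      | hm m => rw [smul_mk, hg, hg, hc]
      | ha x y hx hy => rw [smul_add, map_add, map_add, hx, hy, smul_add] }

theorem lift_mk {P : Type u} [AddCommGroup P] [Module k P] (f : M →+ P) (hf) (hc) (m : M) :
    lift (k := k) (R := R) f hf hc (mk k R m 1) = f m := by
  change f (((1 : R) ⊗ₜ[k] (1 : R)) • m) = f m
  rw [← Algebra.TensorProduct.one_def, one_smul]

/-- The map `f ⊗ 1` on `M ⊗_{Rᵉ} R`. -/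
def map {N : Type u} [AddCommGroup N] [Module (R ⊗[k] R) N] (f : M →ₗ[R ⊗[k] R] N) :
    TraceMod k R M →ₗ[k] TraceMod k R N :=
  { (LinearMap.rTensor (Diag k R) f).toAddMonoidHom with
    map_smul' := fun c x => (LinearMap.rTensor (Diag k R) f).map_smul (algebraMap k (R ⊗[k] R) c) x }

theorem map_mk {N : Type u} [AddCommGroup N] [Module (R ⊗[k] R) N] (f : M →ₗ[R ⊗[k] R] N) (m : M)
    (r : R) : map f (mk k R m r) = mk k R (f m) r := rfl

end TraceMod

end Trace

/-! ### The shadow functors and the swap -/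

section Shadow

open LinFact BiFact

variable {k R S : Type u} [CommRing k] [CommRing R] [CommRing S] [Algebra k R] [Algebra k S]
  {W : R} {V : S}

/-- The `ℤ/2`-graded complex `Z ⊗_{Rᵉ} R`. -/
abbrev trace (Z : BiFact k R R W W) : LinFact k 0 where
  carrier := TraceMod k R Z.carrier
  even := TraceMod.map Z.even
  even_even := TraceMod.ext_apply (fun x y => by simp only [map_add])
    (fun x y => by simp only [map_add]) fun z => by
      simp only [TraceMod.map_mk, even_even]
  d := TraceMod.map Z.d
  d_even := TraceMod.ext_apply (fun x y => by simp only [map_add])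
    (fun x y => by simp only [map_add]; abel) fun z => by
      simp only [TraceMod.map_mk, d_even, TraceMod.sub_mk]
  d_d := TraceMod.ext_apply (fun x y => by simp only [map_add])
    (fun x y => by simp only [smul_add]) fun z => by
      rw [TraceMod.map_mk, TraceMod.map_mk, d_d, TraceMod.balanced, map_sub,
        Algebra.TensorProduct.lmul'_apply_tmul, Algebra.TensorProduct.lmul'_apply_tmul, mul_one,
        one_mul, mul_one, sub_self, zero_smul]
      exact TensorProduct.tmul_zero (R := R ⊗[k] R) (N := Diag k R) z

/-- The morphism `φ ⊗ 1`. -/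
def traceMor {Z Z' : BiFact k R R W W} (φ : Mor Z Z') : Mor (trace Z) (trace Z') where
  lin := TraceMod.map φ.lin
  isEven := TraceMod.ext_apply (fun x y => by simp only [map_add])
    (fun x y => by simp only [map_add]) fun z => congrArg (TraceMod.mk k R · 1) (φ.isEven z)
  comm := TraceMod.ext_apply (fun x y => by simp only [map_add])
    (fun x y => by simp only [map_add]) fun z => congrArg (TraceMod.mk k R · 1) (φ.comm z)

theorem traceMor_homotopic {Z Z' : BiFact k R R W W} {φ ψ : Mor Z Z'} (H : Homotopic φ ψ) :
    Homotopic (traceMor φ) (traceMor ψ) := by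
  obtain ⟨h, ho, he⟩ := H
  refine ⟨TraceMod.map h, ?_, ?_⟩
  · refine TraceMod.ext_apply (fun x y => by simp only [map_add])
      (fun x y => by simp only [map_add]; abel) fun z => ?_
    refine (congrArg (TraceMod.mk k R · 1) (ho z)).trans ?_
    exact TraceMod.sub_mk k R _ _ 1
  · refine TraceMod.ext_apply (fun x y => by simp only [map_add]; abel)
      (fun x y => by simp only [map_add]; abel) fun z => ?_
    refine (TraceMod.add_mk k R _ _ 1).symm.trans ?_
    refine (congrArg (TraceMod.mk k R · 1) (he z)).trans ?_
    exact TraceMod.sub_mk k R _ _ 1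

variable (k R W) in
/-- The functor `Z ↦ Z ⊗_{Rᵉ} R`. -/
def traceFunctor : BiFact k R R W W ⥤ LinFact k 0 where
  obj := trace
  map f := Quotient.map traceMor (fun _ _ H => traceMor_homotopic H) f
  map_id Z := Mor.cls_eq (TraceMod.ext_apply (fun x y => map_add _ _ _) (fun _ _ => rfl)
    fun _ => rfl)
  map_comp f g := by
    obtain ⟨f, rfl⟩ := cls_surj f
    obtain ⟨g, rfl⟩ := cls_surj g
    exact Mor.cls_eq (TraceMod.ext_apply (fun x y => map_add _ _ _) (fun x y => map_add _ _ _)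
      fun _ => rfl)

theorem trace_move {M N : Type u} [AddCommGroup M] [AddCommGroup N] [Module (R ⊗[k] S) M]
    [Module (S ⊗[k] R) N] (r : R) (x : M) (y : N) :
    TraceMod.mk k R (BiTensor.mk k R S R x (((1 : S) ⊗ₜ[k] r) • y)) 1 =
      TraceMod.mk k R (BiTensor.mk k R S R ((r ⊗ₜ[k] (1 : S)) • x) y) 1 := by
  have h1 : BiTensor.mk k R S R x (((1 : S) ⊗ₜ[k] r) • y) =
      ((1 : R) ⊗ₜ[k] r) • BiTensor.mk k R S R x y := by
    rw [BiTensor.smul_mk, ← Algebra.TensorProduct.one_def, one_smul]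
  have h2 : BiTensor.mk k R S R ((r ⊗ₜ[k] (1 : S)) • x) y =
      (r ⊗ₜ[k] (1 : R)) • BiTensor.mk k R S R x y := by
    rw [BiTensor.smul_mk, ← Algebra.TensorProduct.one_def, one_smul]
  rw [h1, h2, TraceMod.balanced, TraceMod.balanced, Algebra.TensorProduct.lmul'_apply_tmul,
    Algebra.TensorProduct.lmul'_apply_tmul]
  simp only [mul_one, one_mul]

/-- The map `y ⊗ x ↦ (-1)^(|x| |y|) (x ⊗ y) ⊗ 1`. -/
def swapAux (Y : BiFact k S R V W) (X : BiFact k R S W V) :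
    BiTensor k S R S Y.carrier X.carrier →+
      TraceMod k R (BiTensor k R S R X.carrier Y.carrier) :=
  BiTensor.lift k S R S
    (AddMonoidHom.mk' (fun y => AddMonoidHom.mk'
        (fun x => TraceMod.mk k R
          (BiTensor.mk k R S R x (Y.even y) + BiTensor.mk k R S R (X.sgn x) (Y.odd y)) 1)
        fun x x' => by
          rw [← TraceMod.add_mk, map_add, BiTensor.add_mk, BiTensor.add_mk]
          congr 1
          abel)
      fun y y' => by
        ext x
        simp only [AddMonoidHom.mk'_apply, AddMonoidHom.add_apply]
        rw [← TraceMod.add_mk, map_add, map_add, BiTensor.mk_add, BiTensor.mk_add]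
        congr 1
        abel)
    fun r y x => by
      simp only [AddMonoidHom.mk'_apply, map_smul, TraceMod.add_mk, trace_move]

theorem swapAux_mk (Y : BiFact k S R V W) (X : BiFact k R S W V) (y : Y.carrier)
    (x : X.carrier) : swapAux Y X (BiTensor.mk k S R S y x) = TraceMod.mk k R
      (BiTensor.mk k R S R x (Y.even y) + BiTensor.mk k R S R (X.sgn x) (Y.odd y)) 1 := rfl

theorem swapAux_smul (Y : BiFact k S R V W) (X : BiFact k R S W V) (r : S)
    (z : BiTensor k S R S Y.carrier X.carrier) :
    swapAux Y X ((r ⊗ₜ[k] (1 : S)) • z) = swapAux Y X (((1 : S) ⊗ₜ[k] r) • z) := by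
  induction z using BiTensor.induction with
  | h0 => rw [smul_zero, smul_zero]
  | hm y x =>
    rw [BiTensor.smul_mk, BiTensor.smul_mk, ← Algebra.TensorProduct.one_def,
      ← Algebra.TensorProduct.one_def, one_smul, one_smul, swapAux_mk, swapAux_mk]
    simp only [map_smul, BiTensor.mk_balanced]
  | ha a b h h' => rw [smul_add, smul_add, map_add, map_add, h, h']

theorem swapAux_algebraMap (Y : BiFact k S R V W) (X : BiFact k R S W V) (c : k)
    (z : BiTensor k S R S Y.carrier X.carrier) :
    swapAux Y X (algebraMap k (S ⊗[k] S) c • z) = c • swapAux Y X z := by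
  induction z using BiTensor.induction with
  | h0 => rw [smul_zero, map_zero, smul_zero]
  | hm y x =>
    have h1 : algebraMap k (S ⊗[k] S) c = (1 : S) ⊗ₜ[k] algebraMap k S c := by
      rw [Algebra.TensorProduct.algebraMap_apply, Algebra.algebraMap_eq_smul_one, smul_tmul]
    have h2 : (algebraMap k R c) ⊗ₜ[k] (1 : S) = (1 : R) ⊗ₜ[k] algebraMap k S c := by
      rw [Algebra.algebraMap_eq_smul_one, Algebra.algebraMap_eq_smul_one, smul_tmul]
    rw [h1, BiTensor.smul_mk, ← Algebra.TensorProduct.one_def, one_smul, swapAux_mk, swapAux_mk,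
      TraceMod.smul_mk, smul_add, Algebra.TensorProduct.algebraMap_apply,
      BiTensor.smul_mk, BiTensor.smul_mk, h2, ← Algebra.TensorProduct.one_def,
      one_smul, one_smul, map_smul]
  | ha a b h h' => rw [smul_add, map_add, map_add, h, h', smul_add]

/-- The graded swap `(y ⊗ x) ⊗ 1 ↦ (-1)^(|x| |y|) (x ⊗ y) ⊗ 1`. -/
def swap (Y : BiFact k S R V W) (X : BiFact k R S W V) :
    Mor (trace (tensor Y X)) (trace (tensor X Y)) where
  lin := TraceMod.lift (swapAux Y X) (swapAux_smul Y X) (swapAux_algebraMap Y X)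
  isEven := TraceMod.ext_apply (fun x y => by simp only [map_add])
    (fun x y => by simp only [map_add]) (tensor_ext Y X (fun x y => by
      simp only [map_add, TraceMod.add_mk]) (fun x y => by
      simp only [map_add, TraceMod.add_mk]) fun y x => by
      simp only [TraceMod.map_mk, LinearMap.add_apply, BiTensor.map_mk, TraceMod.lift_mk, map_add,
        swapAux_mk, odd, sgn, LinearMap.sub_apply, LinearMap.id_apply, map_sub, even_even,
        BiTensor.mk_sub, BiTensor.sub_mk, TraceMod.add_mk, TraceMod.sub_mk]
      abel)
  comm := TraceMod.ext_apply (fun x y => by simp only [map_add])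
    (fun x y => by simp only [map_add]) (tensor_ext Y X (fun x y => by
      simp only [map_add, TraceMod.add_mk]) (fun x y => by
      simp only [map_add, TraceMod.add_mk]) fun y x => by
      simp only [TraceMod.map_mk, LinearMap.add_apply, BiTensor.map_mk, TraceMod.lift_mk, map_add,
        swapAux_mk, odd, sgn, LinearMap.sub_apply, LinearMap.id_apply, map_sub, even_even, d_even,
        BiTensor.mk_sub, BiTensor.sub_mk, TraceMod.add_mk, TraceMod.sub_mk]
      abel)

theorem swap_mk (Y : BiFact k S R V W) (X : BiFact k R S W V) (y : Y.carrier) (x : X.carrier) :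
    (swap Y X).lin (TraceMod.mk k S (BiTensor.mk k S R S y x) 1) = TraceMod.mk k R
      (BiTensor.mk k R S R x (Y.even y) + BiTensor.mk k R S R (X.sgn x) (Y.odd y)) 1 :=
  TraceMod.lift_mk (swapAux Y X) (swapAux_smul Y X) (swapAux_algebraMap Y X) _

/-- The morphism `⟨⟨Y ⊗ X⟩⟩ → ⟨⟨X ⊗ Y⟩⟩` induced by the graded swap. -/
def swapCohomology (Y : BiFact k S R V W) (X : BiFact k R S W V) :
    (cohomologyFunctor k).obj (trace (tensor Y X)) ⟶ (cohomologyFunctor k).obj (trace (tensor X Y)) :=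
  (cohomologyFunctor k).map (swap Y X).cls

end Shadow

/-! ### Shadows on a bicategory -/

open Bicategory in
/-- A shadow on a bicategory `B` with values in a category `C`, given by functors `F a` on the
endomorphism categories and morphisms `θ f g : F (f ≫ g) ⟶ F (g ≫ f)`: these are isomorphisms,
natural in `f` and `g`, and compatible with the associators and unitors of `B`. -/
structure IsShadow {B : Type*} [Bicategory B] {C : Type*} [Category C]
    (F : ∀ a : B, (a ⟶ a) ⥤ C)
    (θ : ∀ {a b : B} (f : a ⟶ b) (g : b ⟶ a), (F a).obj (f ≫ g) ⟶ (F b).obj (g ≫ f)) : Prop where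
  isIso : ∀ {a b : B} (f : a ⟶ b) (g : b ⟶ a), IsIso (θ f g)
  naturality : ∀ {a b : B} {f f' : a ⟶ b} {g g' : b ⟶ a} (η : f ⟶ f') (μ : g ⟶ g'),
    (F a).map (η ▷ g ≫ f' ◁ μ) ≫ θ f' g' = θ f g ≫ (F b).map (μ ▷ f ≫ g' ◁ η)
  hexagon : ∀ {a b c : B} (f : a ⟶ b) (g : b ⟶ c) (h : c ⟶ a),
    θ f (g ≫ h) ≫ (F b).map (α_ g h f).hom =
      (F a).map (α_ f g h).inv ≫ θ (f ≫ g) h ≫ (F c).map (α_ h f g).inv ≫ θ (h ≫ f) g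
  unit_left : ∀ {a : B} (f : a ⟶ a), θ (𝟙 a) f ≫ (F a).map (ρ_ f).hom = (F a).map (λ_ f).hom
  unit_right : ∀ {a : B} (f : a ⟶ a), θ f (𝟙 a) ≫ (F a).map (λ_ f).hom = (F a).map (ρ_ f).hom

namespace LG

open LinFact BiFact

variable (k : Type u) [CommRing k]

/-- The functor `Z ↦ H^*(Z ⊗_{Rᵉ} R)` on the endomorphisms of an object of `LG k`. -/
def shadow (a : LG k) : Hom₁ a a ⥤ GradedObject (ZMod 2) (ModuleCat.{u} k) where
  obj Z := (cohomologyFunctor k).obj ((traceFunctor k (Poly k a.n) a.W).obj Z.fact)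
  map f := (cohomologyFunctor k).map ((traceFunctor k (Poly k a.n) a.W).map f)
  map_id Z := ((traceFunctor k (Poly k a.n) a.W) ⋙ cohomologyFunctor k).map_id Z.fact
  map_comp f g := ((traceFunctor k (Poly k a.n) a.W) ⋙ cohomologyFunctor k).map_comp f g

end LG

end LandauGinzburg

end

/-! Three things are needed: the unit actions are homotopy equivalences, tensor products of
1-morphisms are again 1-morphisms, and the graded swap satisfies the shadow axioms. The third is a
comparison of signs on pure tensors, carried through cohomology. The first two rest on homological
perturbation (`isIso_of_filtered_contraction`): if a surjection of factorisations is a contraction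
for the part `κ` of the differential that lowers a bounded degree, and the remaining parts do not
lower the degree, then a geometric series terminates and the surjection is a homotopy equivalence.

The contractions that occur are linear over `k` or over one side only. Tensoring with a free
bimodule repairs this. If `X` is free over `S ⊗ R`, then `C ⊗_S X` is a direct sum of copies of `C
⊗_k R`, so a `k`-linear map `f` of `C` extends to `f ⊗ 1`, which is automatically `R`-linear; the
same holds on the other side. `Contraction`, `tensorRight` and `tensorLeft` organise this.

Unit actions. `Δ_W → R` is the Koszul resolution of the diagonal, deformed by the terms `∂_[i]W
θ_i`, which raise the `θ`-degree. Dividing by `x_i - x_i'`, one variable at a time, contracts the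
resolution. Substituting `x'` for `x` gives a right linear contraction, substituting `x` for `x'` a
left linear one. Tensoring with a free `X` supplies the missing linearity, and `S ⊗_S X ≅ X`, `X ⊗_R
R ≅ X` identify the results with `λ_X` and `ρ_X`.

Composition over `(S, V)`. Let `K` be the Koszul complex of the partial derivatives of `V` and `J`
the Jacobi ring. Commuting the differential of `X` with a connection along `∂_i` gives a
null-homotopy of `∂_i V`. These null-homotopies define an operator carrying the differential of `K ⊗
X` to the one without its Koszul part, so `X` is a retract of `K ⊗ X`
(`KoszulData.nonempty_retract`). Exactness of the Koszul complex and freeness of `J` over `k` give a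
`k`-linear contraction of `K → J`; after tensoring on both sides, `Y ⊗ (K ⊗ X)` is equivalent to `Y
⊗ (J ⊗ X)`, which has finite rank when `Y` and `X` do, because `J` is finite free over `k`. Thus `Y
⊗ X` is a summand of a finite-rank factorisation. It is free because `S` is free over `k`. -/

noncomputable section

namespace LandauGinzburg

/-! ### Homological perturbation for linear factorisations. -/

namespace LinFact

variable {E : Type u} [CommRing E] {w : E}

theorem odd_apply (X : LinFact E w) (x : X.carrier) : X.odd x = x - X.even x := rfl

theorem sgn_apply (X : LinFact E w) (x : X.carrier) : X.sgn x = X.even x - X.odd x := rfl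

/-- The even part of a linear map. -/
def evenPart {X Y : LinFact E w} (f : X.carrier →ₗ[E] Y.carrier) : X.carrier →ₗ[E] Y.carrier :=
  Y.even ∘ₗ f ∘ₗ X.even + Y.odd ∘ₗ f ∘ₗ X.odd

/-- The odd part of a linear map. -/
def oddPart {X Y : LinFact E w} (f : X.carrier →ₗ[E] Y.carrier) : X.carrier →ₗ[E] Y.carrier :=
  Y.even ∘ₗ f ∘ₗ X.odd + Y.odd ∘ₗ f ∘ₗ X.even

theorem isEven_evenPart {X Y : LinFact E w} (f : X.carrier →ₗ[E] Y.carrier) :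
    IsEven (evenPart f) := fun x => by
  simp only [evenPart, odd_apply, LinearMap.add_apply, LinearMap.comp_apply, map_add, map_sub,
    X.even_even, Y.even_even]
  abel

theorem isOdd_oddPart {X Y : LinFact E w} (f : X.carrier →ₗ[E] Y.carrier) :
    IsOdd (oddPart f) := fun x => by
  simp only [oddPart, odd_apply, LinearMap.add_apply, LinearMap.comp_apply, map_add, map_sub,
    X.even_even, Y.even_even]
  abel

/-- If the anticommutator of `d` and `f` is even, it equals that of `d` and the odd part of `f`. -/
theorem d_oddPart {X : LinFact E w} {f c : X.carrier →ₗ[E] X.carrier}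
    (h : ∀ x, X.d (f x) + f (X.d x) = c x) (x : X.carrier) :
    X.d (oddPart f x) + oddPart f (X.d x) = evenPart c x := by
  simp only [oddPart, evenPart, LinearMap.add_apply, LinearMap.comp_apply, ← h, map_add, odd_apply,
    map_sub, X.d_even]
  abel

theorem evenPart_smul_id {X : LinFact E w} (e : E) (x : X.carrier) :
    evenPart (X := X) (Y := X) (e • LinearMap.id) x = e • x := by
  simp only [evenPart, LinearMap.add_apply, LinearMap.comp_apply, LinearMap.smul_apply,
    LinearMap.id_apply, map_smul, odd_apply, map_sub, X.even_even, sub_self, smul_zero, sub_zero,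
    smul_sub]
  abel

/-- A morphism with a linear section commuting with the differentials and a linear, not
necessarily homogeneous, homotopy is an isomorphism in the homotopy category. -/
theorem isIso_of_section_homotopy {P Q : LinFact E w} (π : Mor P Q) (σ : Q.carrier →ₗ[E] P.carrier)
    (H : P.carrier →ₗ[E] P.carrier) (hσ : ∀ y, π.lin (σ y) = y) (dσ : ∀ y, P.d (σ y) = σ (Q.d y))
    (dH : ∀ x, P.d (H x) + H (P.d x) = x - σ (π.lin x)) : IsIso π.cls := by
  have πe : ∀ x, π.lin (P.even x) = Q.even (π.lin x) := π.isEven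
  -- Because both differentials are odd, the even part of a map commuting with them still commutes
  -- with them; it remains a section because `π` is even.
  let σ' : Mor Q P :=
    { lin := evenPart σ
      isEven := isEven_evenPart σ
      comm := fun y => by
        simp only [evenPart, LinearMap.add_apply, LinearMap.comp_apply, map_add, odd_apply, map_sub,
          P.d_even, Q.d_even, dσ]
        abel }
  refine ⟨σ'.cls, ?_, ?_⟩
  · rw [Mor.cls_comp, ← Mor.cls_id, Mor.cls_eq_iff]
    -- Since `π` is even, the even part of `id - σ π` is `id - σ' π`, and the odd part of `H` bounds
    -- it.
    refine ⟨oddPart H, isOdd_oddPart H, fun x => ?_⟩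
    rw [d_oddPart (c := LinearMap.id - σ ∘ₗ π.lin) dH]
    change evenPart (LinearMap.id - σ ∘ₗ π.lin) x = x - evenPart σ (π.lin x)
    simp only [evenPart, LinearMap.add_apply, LinearMap.comp_apply, LinearMap.sub_apply,
      LinearMap.id_apply, map_sub, odd_apply, πe, P.even_even]
    abel
  · rw [Mor.cls_comp, ← Mor.cls_id]
    refine Mor.cls_eq fun y => ?_
    change π.lin (evenPart σ y) = y
    simp only [evenPart, LinearMap.add_apply, LinearMap.comp_apply, map_add, πe, hσ, odd_apply,
      map_sub, Q.even_even]
    abel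

/-- Homological perturbation: a surjection of linear factorisations whose kernel is contracted by
`h` up to terms raising a finite filtration is an isomorphism in the homotopy category. -/
theorem isIso_of_filtered_contraction {P Q : LinFact E w} (π : Mor P Q)
    (s : Q.carrier →ₗ[E] P.carrier) (h κ : P.carrier →ₗ[E] P.carrier)
    (hs : ∀ y, π.lin (s y) = y) (hh : ∀ x, π.lin (h x) = 0)
    (hκ : ∀ x, κ (h x) + h (κ x) = x - s (π.lin x)) (F : ℕ → Submodule E P.carrier) {N : ℕ}
    (F_zero : F 0 = ⊤) (F_N : F N = ⊥) (hF : ∀ p, ∀ x ∈ F p, h x ∈ F (p + 1))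
    (dF : ∀ p, ∀ x ∈ F p, P.d x - κ x ∈ F p) : IsIso π.cls := by
  -- Each application of `ν` passes once through `h` and otherwise preserves the filtration, so `ν ^
  -- N = 0` and `1 + ν` is invertible with inverse `T`.
  let ν : Module.End E P.carrier := (P.d - κ) ∘ₗ h + h ∘ₗ (P.d - κ)
  have hν : ∀ x, ν x = P.d (h x) - κ (h x) + h (P.d x - κ x) := fun x => rfl
  have ν_mem : ∀ p x, (ν ^ p) x ∈ F p := fun p => by
    induction p with
    | zero => intro x; rw [F_zero]; trivial
    | succ p ih =>
      intro x
      rw [pow_succ', Module.End.mul_apply, hν]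
      exact add_mem (dF _ _ (hF _ _ (ih x))) (hF _ _ (dF _ _ (ih x)))
  have ν_nil : IsNilpotent ν := ⟨N, LinearMap.ext fun x => by
    have := ν_mem N x
    rwa [F_N, Submodule.mem_bot] at this⟩
  obtain ⟨U, hU⟩ := ν_nil.isUnit_one_add
  have hU' : ∀ x, (U : Module.End E P.carrier) x = x + ν x := fun x => by rw [hU]; rfl
  let T : Module.End E P.carrier := ↑U⁻¹
  have UT : ∀ x, T x + ν (T x) = x := fun x => by
    rw [← hU', ← Module.End.mul_apply, Units.mul_inv, Module.End.one_apply]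
  have TU : ∀ x, T (x + ν x) = x := fun x => by
    rw [← hU', ← Module.End.mul_apply, Units.inv_mul, Module.End.one_apply]
  -- On the kernel of `π` the identity is `κ h + h κ`, so adding `ν` replaces `κ` by the full
  -- differential.
  have Uker : ∀ x, π.lin x = 0 → x + ν x = P.d (h x) + h (P.d x) := fun x hx => by
    have := hκ x
    rw [hx, map_zero, sub_zero] at this
    rw [hν, map_sub]
    nth_rewrite 1 [← this]
    abel
  -- Applying `π` to the contraction identity, with `π s = 1` and `π h = 0`, gives `π κ h = 0`.
  have πν : ∀ x, π.lin (ν x) = 0 := fun x => by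
    have h1 := congrArg π.lin (hκ x)
    rw [map_add, map_sub, hs, hh, add_zero, sub_self] at h1
    rw [hν, map_add, map_sub, ← π.comm, hh, hh, map_zero, h1, sub_zero, zero_add]
  have πT : ∀ x, π.lin (T x) = π.lin x := fun x => by
    conv_rhs => rw [← UT x]
    rw [map_add, πν, add_zero]
  have dker : ∀ x, π.lin x = 0 → π.lin (P.d x) = 0 := fun x hx => by
    rw [← π.comm, hx, map_zero]
  -- `d` commutes with `d h + h d` because `d²` is the scalar `w`; hence it commutes with the
  -- inverse `T` on the kernel of `π`.
  have dT : ∀ x, π.lin x = 0 → P.d (T x) = T (P.d x) := fun x hx => by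
    have hz : π.lin (T x) = 0 := by rw [πT, hx]
    rw [← TU (P.d (T x))]
    congr 1
    rw [Uker _ (dker _ hz)]
    conv_rhs => rw [← UT x, Uker _ hz]
    rw [map_add, P.d_d, P.d_d, map_smul, add_comm]
  -- On the kernel of `π`, `d h T + h T d = (d h + h d) T = 1`, so `h T` contracts the kernel for
  -- the full differential.
  let g : P.carrier →ₗ[E] P.carrier := h ∘ₗ T
  have hg : ∀ x, π.lin x = 0 → P.d (g x) + g (P.d x) = x := fun x hx => by
    change P.d (h (T x)) + h (T (P.d x)) = x
    rw [← dT x hx, ← Uker _ (by rw [πT, hx]), UT]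
  -- The failure of `s` to commute with the differentials takes values in the kernel of `π`, where
  -- `g` can correct it; the terms containing `d² = w` agree on both sides.
  let σ : Q.carrier →ₗ[E] P.carrier := s - g ∘ₗ (P.d ∘ₗ s - s ∘ₗ Q.d)
  have σ_apply : ∀ y, σ y = s y - g (P.d (s y) - s (Q.d y)) := fun y => rfl
  have hσ : ∀ y, π.lin (σ y) = y := fun y => by
    rw [σ_apply, map_sub, hs]
    exact sub_eq_self.2 (hh _)
  have dσ : ∀ y, P.d (σ y) = σ (Q.d y) := fun y => by
    have h1 := hg (P.d (s y) - s (Q.d y)) (by rw [map_sub, ← π.comm, hs, hs, sub_self])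
    rw [P.d.map_sub (P.d (s y)), P.d_d] at h1
    rw [σ_apply, σ_apply, Q.d_d, map_smul, map_sub, eq_sub_of_add_eq h1, ← neg_sub (P.d _), map_neg]
    abel
  -- `g` is a homotopy only on the kernel of `π`, so it is preceded by the projection `id - σ π`
  -- onto that kernel.
  refine isIso_of_section_homotopy π σ (g ∘ₗ (LinearMap.id - σ ∘ₗ π.lin)) hσ dσ fun x => ?_
  change P.d (g (x - σ (π.lin x))) + g (P.d x - σ (π.lin (P.d x))) = _
  rw [← π.comm, ← dσ, ← map_sub]
  exact hg _ (by rw [map_sub, hσ, sub_self])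

end LinFact

end LandauGinzburg

end

/-! ### Extending `k`-linear maps to tensor products along a basis. -/

noncomputable section

namespace LandauGinzburg

section Extension

open BiTensor

variable {k G S R : Type u} [CommRing k] [CommRing G] [CommRing S] [CommRing R]
  [Algebra k G] [Algebra k S] [Algebra k R]

theorem one_tmul_algebraMap (c : k) :
    (1 : G) ⊗ₜ[k] algebraMap k S c = algebraMap k (G ⊗[k] S) c := by
  rw [Algebra.TensorProduct.algebraMap_apply, Algebra.algebraMap_eq_smul_one,
    Algebra.algebraMap_eq_smul_one, smul_tmul]

theorem algebraMap_tmul_one (c : k) :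
    algebraMap k G c ⊗ₜ[k] (1 : S) = algebraMap k (G ⊗[k] S) c :=
  (Algebra.TensorProduct.algebraMap_apply c).symm

theorem tmul_smul_eq {M : Type u} [AddCommGroup M] [Module (G ⊗[k] S) M] (g : G) (s : S) (x : M) :
    (g ⊗ₜ[k] s) • x = (g ⊗ₜ[k] (1 : S)) • ((1 : G) ⊗ₜ[k] s) • x := by
  rw [smul_smul, Algebra.TensorProduct.tmul_mul_tmul, mul_one, one_mul]

theorem tmul_smul_eq' {M : Type u} [AddCommGroup M] [Module (G ⊗[k] S) M] (g : G) (s : S) (x : M) :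
    (g ⊗ₜ[k] s) • x = ((1 : G) ⊗ₜ[k] s) • (g ⊗ₜ[k] (1 : S)) • x := by
  rw [smul_smul, Algebra.TensorProduct.tmul_mul_tmul, mul_one, one_mul]

/-- Additive maps which agree on multiples of basis elements by pure tensors are equal. -/
theorem ext_basis {M P J : Type u} [AddCommGroup M] [Module (G ⊗[k] S) M] [AddCommGroup P]
    (b : Module.Basis J (G ⊗[k] S) M) {f g : M → P} (hf : ∀ x y, f (x + y) = f x + f y)
    (hg : ∀ x y, g (x + y) = g x + g y)
    (h : ∀ j (a : G) (s : S), f ((a ⊗ₜ[k] s) • b j) = g ((a ⊗ₜ[k] s) • b j)) (x : M) : f x = g x := by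
  have f0 : f 0 = 0 := by simpa using hf 0 0
  have g0 : g 0 = 0 := by simpa using hg 0 0
  rw [← b.linearCombination_repr x]
  induction b.repr x using Finsupp.induction_linear with
  | zero => rw [map_zero, f0, g0]
  | add u v hu hv => rw [map_add, hf, hg, hu, hv]
  | single j e =>
    rw [Finsupp.linearCombination_single]
    induction e with
    | zero => rw [zero_smul, f0, g0]
    | add u v hu hv => rw [add_smul, hf, hg, hu, hv]
    | tmul a s => exact h j a s

/-- Additive maps commuting with scalars from `k`. -/
def IsScalar (k : Type u) [CommRing k] {E M N : Type u} [CommRing E] [Algebra k E] [AddCommGroup M]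
    [AddCommGroup N] [Module E M] [Module E N] (f : M →+ N) : Prop :=
  ∀ (c : k) x, f (algebraMap k E c • x) = algebraMap k E c • f x

/-- Additive maps commuting with the left action. -/
def IsLeftLin (k G S : Type u) [CommRing k] [CommRing G] [CommRing S] [Algebra k G] [Algebra k S]
    {M N : Type u} [AddCommGroup M] [AddCommGroup N] [Module (G ⊗[k] S) M] [Module (G ⊗[k] S) N]
    (f : M →+ N) : Prop :=
  ∀ (g : G) x, f ((g ⊗ₜ[k] (1 : S)) • x) = (g ⊗ₜ[k] (1 : S)) • f x

/-- Additive maps commuting with the right action. -/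
def IsRightLin (k G S : Type u) [CommRing k] [CommRing G] [CommRing S] [Algebra k G] [Algebra k S]
    {M N : Type u} [AddCommGroup M] [AddCommGroup N] [Module (G ⊗[k] S) M] [Module (G ⊗[k] S) N]
    (f : M →+ N) : Prop :=
  ∀ (s : S) x, f (((1 : G) ⊗ₜ[k] s) • x) = ((1 : G) ⊗ₜ[k] s) • f x

section

variable {M N : Type u} [AddCommGroup M] [AddCommGroup N] [Module (G ⊗[k] S) M]
  [Module (G ⊗[k] S) N] {f : M →+ N}

theorem IsLeftLin.isScalar (h : IsLeftLin k G S f) : IsScalar k (E := G ⊗[k] S) f := fun c x => by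
  rw [← algebraMap_tmul_one, h]

theorem IsRightLin.isScalar (h : IsRightLin k G S f) : IsScalar k (E := G ⊗[k] S) f :=
  fun c x => by rw [← one_tmul_algebraMap, h]

theorem IsLeftLin.map_smul (h : IsLeftLin k G S f) (h' : IsRightLin k G S f) (e : G ⊗[k] S)
    (x : M) : f (e • x) = e • f x := by
  induction e with
  | zero => rw [zero_smul, zero_smul, map_zero]
  | add a b ha hb => rw [add_smul, map_add, ha, hb, add_smul]
  | tmul a b => rw [tmul_smul_eq, h, h', ← tmul_smul_eq]

end

section Left

variable {C C' X J : Type u} [AddCommGroup C] [AddCommGroup C'] [AddCommGroup X]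
  [Module (G ⊗[k] S) C] [Module (G ⊗[k] S) C'] [Module (S ⊗[k] R) X]
  (b : Module.Basis J (S ⊗[k] R) X)

/-- Balancing over `S` moves the `S`-coefficient of a basis expansion in `X` onto `c`, so only
coefficients from `R` need to be tested. -/
theorem ext_left {C X J : Type u} [AddCommGroup C] [AddCommGroup X] [Module (G ⊗[k] S) C]
    [Module (S ⊗[k] R) X] (b : Module.Basis J (S ⊗[k] R) X) {P : Type u} [AddCommGroup P] {f g : BiTensor k G S R C X → P}
    (hf : ∀ x y, f (x + y) = f x + f y) (hg : ∀ x y, g (x + y) = g x + g y)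
    (h : ∀ c (r : R) j, f (mk k G S R c (((1 : S) ⊗ₜ[k] r) • b j)) =
      g (mk k G S R c (((1 : S) ⊗ₜ[k] r) • b j))) (x) : f x = g x :=
  BiTensor.ext_apply hf hg (fun c x => ext_basis b (f := fun x => f (mk k G S R c x))
    (g := fun x => g (mk k G S R c x)) (fun x y => by rw [mk_add, hf]) (fun x y => by rw [mk_add, hg])
    (fun j s r => by rw [tmul_smul_eq, ← mk_balanced, h]) x) x

/-- For fixed `c`, the `S`-coefficient of `b j` is made to act on `c`, as balancing over `S` will
demand. The hypothesis `hφ` makes this well defined on `S ⊗[k] R`. -/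
def liftLeftAux {P : Type u} [AddCommGroup P] (φ : J → C →+ R →+ P)
    (hφ : ∀ j (a : k) c r, φ j (algebraMap k (G ⊗[k] S) a • c) r = φ j c (a • r)) (c : C) : X →+ P :=
  (Finsupp.liftAddHom fun j => TensorProduct.liftAddHom
    (AddMonoidHom.mk' (fun s : S => φ j (((1 : G) ⊗ₜ[k] s) • c)) fun s s' => by
      rw [tmul_add, add_smul, map_add])
    (fun a s r => by
      have h : (1 : G) ⊗ₜ[k] (a • s) = (algebraMap k (G ⊗[k] S) a) * ((1 : G) ⊗ₜ[k] s) := by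
        rw [← Algebra.smul_def, tmul_smul]
      rw [AddMonoidHom.mk'_apply, h, mul_smul, hφ])).comp
    b.repr.toLinearMap.toAddMonoidHom

theorem liftLeftAux_apply {P : Type u} [AddCommGroup P] (φ : J → C →+ R →+ P) (hφ) (c : C) (s : S)
    (r : R) (j : J) : liftLeftAux (G := G) b φ hφ c ((s ⊗ₜ[k] r) • b j) =
      φ j (((1 : G) ⊗ₜ[k] s) • c) r := by
  simp [liftLeftAux]

/-- The additive map on `C ⊗_S X` determined by its values on `c ⊗ r bⱼ`. -/
def liftLeft {P : Type u} [AddCommGroup P] (φ : J → C →+ R →+ P)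
    (hφ : ∀ j (a : k) c r, φ j (algebraMap k (G ⊗[k] S) a • c) r = φ j c (a • r)) :
    BiTensor k G S R C X →+ P :=
  BiTensor.lift k G S R (AddMonoidHom.mk' (liftLeftAux b φ hφ) fun c c' => by
      ext x
      refine ext_basis b (fun _ _ => map_add _ _ _) (fun _ _ => map_add _ _ _) (fun j s r => ?_) x
      rw [AddMonoidHom.add_apply, liftLeftAux_apply, liftLeftAux_apply, liftLeftAux_apply, smul_add,
        map_add, AddMonoidHom.add_apply])
    fun s c x => by
      simp only [AddMonoidHom.mk'_apply]
      refine ext_basis b (g := fun x => liftLeftAux b φ hφ c ((s ⊗ₜ[k] (1 : R)) • x))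
        (fun _ _ => map_add _ _ _) (fun _ _ => by rw [smul_add, map_add]) (fun j t r => ?_) x
      rw [liftLeftAux_apply, smul_smul, smul_smul, Algebra.TensorProduct.tmul_mul_tmul,
        Algebra.TensorProduct.tmul_mul_tmul, liftLeftAux_apply, one_mul, one_mul, mul_comm]

theorem liftLeft_mk {P : Type u} [AddCommGroup P] (φ : J → C →+ R →+ P) (hφ) (c : C) (r : R)
    (j : J) : liftLeft (G := G) b φ hφ (mk k G S R c (((1 : S) ⊗ₜ[k] r) • b j)) = φ j c r := by
  refine (liftLeftAux_apply b φ hφ c 1 r j).trans ?_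
  rw [← Algebra.TensorProduct.one_def, one_smul]

/-- The map `f ⊗ 1` on `C ⊗_S X`, for `f` which is only `k`-linear, relative to a basis of `X`. -/
def extLeft (f : C →+ C') (hf : IsScalar k (E := G ⊗[k] S) f) :
    BiTensor k G S R C X →+ BiTensor k G S R C' X :=
  liftLeft b (fun j => AddMonoidHom.mk' (fun c => AddMonoidHom.mk'
      (fun r : R => mk k G S R (f c) (((1 : S) ⊗ₜ[k] r) • b j))
      fun r r' => by rw [tmul_add, add_smul, mk_add])
    fun c c' => by
      ext r
      simp only [AddMonoidHom.mk'_apply, AddMonoidHom.add_apply, map_add, add_mk])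
    fun j a c r => by
      have h : (1 : S) ⊗ₜ[k] (a • r) = (algebraMap k (S ⊗[k] R) a) * ((1 : S) ⊗ₜ[k] r) := by
        rw [← Algebra.smul_def, tmul_smul]
      simp only [AddMonoidHom.mk'_apply]
      rw [h, mul_smul, hf, ← one_tmul_algebraMap, mk_balanced, algebraMap_tmul_one]

theorem extLeft_mk (f : C →+ C') (hf : IsScalar k (E := G ⊗[k] S) f) (c : C) (r : R) (j : J) :
    extLeft b f hf (mk k G S R c (((1 : S) ⊗ₜ[k] r) • b j)) =
      mk k G S R (f c) (((1 : S) ⊗ₜ[k] r) • b j) :=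
  liftLeft_mk b _ _ c r j

/-- In `C ⊗_S X` the right action only changes the coefficient `r` of `r b_j`, which `f` does not
touch. No linearity of `f` beyond `k` is involved, since the `S`-action on `C` is absorbed by the
tensor product. -/
theorem extLeft_isRightLin (f : C →+ C') (hf : IsScalar k (E := G ⊗[k] S) f) :
    IsRightLin k G R (extLeft (R := R) b f hf) := fun r x => by
  refine ext_left b (f := fun x => extLeft b f hf (((1 : G) ⊗ₜ[k] r) • x))
    (g := fun x => ((1 : G) ⊗ₜ[k] r) • extLeft b f hf x) (fun _ _ => by rw [smul_add, map_add])
    (fun _ _ => by rw [map_add, smul_add]) (fun c r' j => ?_) x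
  simp only [smul_mk, extLeft_mk, ← Algebra.TensorProduct.one_def, one_smul, smul_smul,
    Algebra.TensorProduct.tmul_mul_tmul, one_mul]

theorem extLeft_isLeftLin (f : C →+ C') (hf : IsScalar k (E := G ⊗[k] S) f)
    (hf' : IsLeftLin k G S f) : IsLeftLin k G R (extLeft (R := R) b f hf) := fun g x => by
  refine ext_left b (f := fun x => extLeft b f hf ((g ⊗ₜ[k] (1 : R)) • x))
    (g := fun x => (g ⊗ₜ[k] (1 : R)) • extLeft b f hf x) (fun _ _ => by rw [smul_add, map_add])
    (fun _ _ => by rw [map_add, smul_add]) (fun c r' j => ?_) x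
  simp only [smul_mk, extLeft_mk, ← Algebra.TensorProduct.one_def, one_smul, hf' g]

end Left

section Right

variable {C C' Y J : Type u} [AddCommGroup C] [AddCommGroup C'] [AddCommGroup Y]
  [Module (S ⊗[k] R) C] [Module (S ⊗[k] R) C'] [Module (G ⊗[k] S) Y]
  (b : Module.Basis J (G ⊗[k] S) Y)

theorem ext_right {C Y J : Type u} [AddCommGroup C] [AddCommGroup Y] [Module (S ⊗[k] R) C]
    [Module (G ⊗[k] S) Y] (b : Module.Basis J (G ⊗[k] S) Y) {P : Type u} [AddCommGroup P] {f g : BiTensor k G S R Y C → P}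
    (hf : ∀ x y, f (x + y) = f x + f y) (hg : ∀ x y, g (x + y) = g x + g y)
    (h : ∀ (t : G) j c, f (mk k G S R ((t ⊗ₜ[k] (1 : S)) • b j) c) =
      g (mk k G S R ((t ⊗ₜ[k] (1 : S)) • b j) c)) (x) : f x = g x :=
  BiTensor.ext_apply hf hg (fun y c => ext_basis b (f := fun y => f (mk k G S R y c))
    (g := fun y => g (mk k G S R y c)) (fun x y => by rw [add_mk, hf]) (fun x y => by rw [add_mk, hg])
    (fun j t s => by rw [tmul_smul_eq', mk_balanced, h]) y) x

/-- Mirror image of `liftLeftAux`: the `S`-coefficient of `b j` acts on `c`, and the coefficient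
from `G` is kept. -/
def liftRightAux {P : Type u} [AddCommGroup P] (φ : J → C →+ G →+ P)
    (hφ : ∀ j (a : k) c t, φ j (algebraMap k (S ⊗[k] R) a • c) t = φ j c (a • t)) (c : C) : Y →+ P :=
  (Finsupp.liftAddHom fun j => TensorProduct.liftAddHom
    (AddMonoidHom.flip (AddMonoidHom.mk' (fun s : S => φ j ((s ⊗ₜ[k] (1 : R)) • c)) fun s s' => by
      rw [add_tmul, add_smul, map_add]))
    (fun a t s => by
      have h : (a • s) ⊗ₜ[k] (1 : R) = (algebraMap k (S ⊗[k] R) a) * (s ⊗ₜ[k] (1 : R)) := by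
        rw [← Algebra.smul_def, smul_tmul']
      rw [AddMonoidHom.flip_apply, AddMonoidHom.flip_apply, AddMonoidHom.mk'_apply, h, mul_smul,
        hφ])).comp
    b.repr.toLinearMap.toAddMonoidHom

theorem liftRightAux_apply {P : Type u} [AddCommGroup P] (φ : J → C →+ G →+ P) (hφ) (c : C) (t : G)
    (s : S) (j : J) : liftRightAux (R := R) b φ hφ c ((t ⊗ₜ[k] s) • b j) =
      φ j ((s ⊗ₜ[k] (1 : R)) • c) t := by
  simp [liftRightAux]

/-- The additive map on `Y ⊗_S C` determined by its values on `t bⱼ ⊗ c`. -/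
def liftRight {P : Type u} [AddCommGroup P] (φ : J → C →+ G →+ P)
    (hφ : ∀ j (a : k) c t, φ j (algebraMap k (S ⊗[k] R) a • c) t = φ j c (a • t)) :
    BiTensor k G S R Y C →+ P :=
  BiTensor.lift k G S R (AddMonoidHom.flip (AddMonoidHom.mk' (liftRightAux b φ hφ) fun c c' => by
      ext y
      refine ext_basis b (fun _ _ => map_add _ _ _) (fun _ _ => map_add _ _ _) (fun j s r => ?_) y
      rw [AddMonoidHom.add_apply, liftRightAux_apply, liftRightAux_apply, liftRightAux_apply,
        smul_add, map_add, AddMonoidHom.add_apply]))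
    fun s y c => by
      simp only [AddMonoidHom.flip_apply, AddMonoidHom.mk'_apply]
      refine ext_basis b (f := fun y => liftRightAux b φ hφ c (((1 : G) ⊗ₜ[k] s) • y))
        (fun _ _ => by rw [smul_add, map_add]) (fun _ _ => map_add _ _ _) (fun j t r => ?_) y
      rw [liftRightAux_apply, smul_smul, smul_smul, Algebra.TensorProduct.tmul_mul_tmul,
        Algebra.TensorProduct.tmul_mul_tmul, liftRightAux_apply, one_mul, one_mul, mul_comm]

theorem liftRight_mk {P : Type u} [AddCommGroup P] (φ : J → C →+ G →+ P) (hφ) (t : G) (j : J)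
    (c : C) : liftRight (R := R) b φ hφ (mk k G S R ((t ⊗ₜ[k] (1 : S)) • b j) c) = φ j c t := by
  refine (liftRightAux_apply b φ hφ c t 1 j).trans ?_
  rw [← Algebra.TensorProduct.one_def, one_smul]

/-- The map `1 ⊗ f` on `Y ⊗_S C`, for `f` which is only `k`-linear, relative to a basis of `Y`. -/
def extRight (f : C →+ C') (hf : IsScalar k (E := S ⊗[k] R) f) :
    BiTensor k G S R Y C →+ BiTensor k G S R Y C' :=
  liftRight b (fun j => AddMonoidHom.mk' (fun c => AddMonoidHom.mk'
      (fun t : G => mk k G S R ((t ⊗ₜ[k] (1 : S)) • b j) (f c))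
      fun t t' => by rw [add_tmul, add_smul, add_mk])
    fun c c' => by
      ext t
      simp only [AddMonoidHom.mk'_apply, AddMonoidHom.add_apply, map_add, mk_add])
    fun j a c t => by
      have h : (a • t) ⊗ₜ[k] (1 : S) = (algebraMap k (G ⊗[k] S) a) * (t ⊗ₜ[k] (1 : S)) := by
        rw [← Algebra.smul_def, smul_tmul']
      simp only [AddMonoidHom.mk'_apply]
      rw [h, mul_smul, hf, ← algebraMap_tmul_one (G := S) (S := R), ← mk_balanced,
        one_tmul_algebraMap]

theorem extRight_mk (f : C →+ C') (hf : IsScalar k (E := S ⊗[k] R) f) (t : G) (j : J) (c : C) :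
    extRight b f hf (mk k G S R ((t ⊗ₜ[k] (1 : S)) • b j) c) =
      mk k G S R ((t ⊗ₜ[k] (1 : S)) • b j) (f c) :=
  liftRight_mk b _ _ t j c

/-- The left action only changes the coefficient `t` of `t b_j`, so it commutes with `1 ⊗ f` for
every `k`-linear `f`. -/
theorem extRight_isLeftLin (f : C →+ C') (hf : IsScalar k (E := S ⊗[k] R) f) :
    IsLeftLin k G R (extRight (R := R) b f hf) := fun t x => by
  refine ext_right b (f := fun x => extRight b f hf ((t ⊗ₜ[k] (1 : R)) • x))
    (g := fun x => (t ⊗ₜ[k] (1 : R)) • extRight b f hf x) (fun _ _ => by rw [smul_add, map_add])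
    (fun _ _ => by rw [map_add, smul_add]) (fun t' j c => ?_) x
  simp only [smul_mk, extRight_mk, ← Algebra.TensorProduct.one_def, one_smul, smul_smul,
    Algebra.TensorProduct.tmul_mul_tmul, one_mul]

theorem extRight_isRightLin (f : C →+ C') (hf : IsScalar k (E := S ⊗[k] R) f)
    (hf' : IsRightLin k S R f) : IsRightLin k G R (extRight (R := R) b f hf) := fun r x => by
  refine ext_right b (f := fun x => extRight b f hf (((1 : G) ⊗ₜ[k] r) • x))
    (g := fun x => ((1 : G) ⊗ₜ[k] r) • extRight b f hf x) (fun _ _ => by rw [smul_add, map_add])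
    (fun _ _ => by rw [map_add, smul_add]) (fun t' j c => ?_) x
  simp only [smul_mk, extRight_mk, ← Algebra.TensorProduct.one_def, one_smul, hf' r]

end Right

end Extension

end LandauGinzburg

end

/-! ### Contractions and their behaviour under tensor products. -/

noncomputable section

namespace LandauGinzburg

open LinFact BiFact BiTensor

section

variable {k G S R : Type u} [CommRing k] [CommRing G] [CommRing S] [CommRing R]
  [Algebra k G] [Algebra k S] [Algebra k R] {U : G} {V : S} {W : R}

theorem zero_mk {M N : Type u} [AddCommGroup M] [AddCommGroup N] [Module (G ⊗[k] S) M]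
    [Module (S ⊗[k] R) N] (n : N) : BiTensor.mk k G S R (0 : M) n = 0 :=
  DFunLike.congr_fun (map_zero (mkHom k G S R (M := M) (N := N))) n

theorem mk_zero {M N : Type u} [AddCommGroup M] [AddCommGroup N] [Module (G ⊗[k] S) M]
    [Module (S ⊗[k] R) N] (m : M) : BiTensor.mk k G S R m (0 : N) = 0 :=
  map_zero (mkHom k G S R (M := M) (N := N) m)

theorem sum_mk {ι : Type*} {M N : Type u} [AddCommGroup M] [AddCommGroup N] [Module (G ⊗[k] S) M]
    [Module (S ⊗[k] R) N] (t : Finset ι) (f : ι → M) (n : N) :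
    BiTensor.mk k G S R (∑ i ∈ t, f i) n = ∑ i ∈ t, BiTensor.mk k G S R (f i) n :=
  map_sum ((mkHom k G S R (M := M) (N := N)).flip n) f t

theorem mk_sum {ι : Type*} {M N : Type u} [AddCommGroup M] [AddCommGroup N] [Module (G ⊗[k] S) M]
    [Module (S ⊗[k] R) N] (t : Finset ι) (m : M) (f : ι → N) :
    BiTensor.mk k G S R m (∑ i ∈ t, f i) = ∑ i ∈ t, BiTensor.mk k G S R m (f i) :=
  map_sum (mkHom k G S R (M := M) (N := N) m) f t

/-- A contraction of the kernel of `π : P → Q` with respect to the part `κ` of the differential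
which lowers the degree by one. The remaining parts `δ₀` and `δ₁` have degree zero and one. The
projections onto the homogeneous components are denoted `D q`. The section `s` and the contraction
`h`, which raises the degree by one, are only `k`-linear. -/
structure Contraction {P Q : BiFact k G S U V} (π : Mor P Q) where
  h : P.carrier →+ P.carrier
  s : Q.carrier →+ P.carrier
  κ : P.carrier →ₗ[G ⊗[k] S] P.carrier
  δ₀ : P.carrier →ₗ[G ⊗[k] S] P.carrier
  δ₁ : P.carrier →ₗ[G ⊗[k] S] P.carrier
  D : ℕ → P.carrier →ₗ[G ⊗[k] S] P.carrier
  N : ℕ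
  h_scalar : IsScalar k (E := G ⊗[k] S) h
  s_scalar : IsScalar k (E := G ⊗[k] S) s
  d_eq : ∀ x, P.d x = κ x + δ₀ x + δ₁ x
  κ_odd : ∀ x, κ (P.even x) = κ x - P.even (κ x)
  D_even : ∀ q x, D q (P.even x) = P.even (D q x)
  π_s : ∀ y, π.lin (s y) = y
  π_h : ∀ x, π.lin (h x) = 0
  homotopy : ∀ x, κ (h x) + h (κ x) + s (π.lin x) = x
  D_zero_h : ∀ x, D 0 (h x) = 0
  D_succ_h : ∀ q x, D (q + 1) (h x) = h (D q x)
  D_δ₀ : ∀ q x, D q (δ₀ x) = δ₀ (D q x)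
  D_zero_δ₁ : ∀ x, D 0 (δ₁ x) = 0
  D_succ_δ₁ : ∀ q x, D (q + 1) (δ₁ x) = δ₁ (D q x)
  sum_D : ∀ x, ∑ q ∈ Finset.range N, D q x = x

namespace Contraction

variable {P Q : BiFact k G S U V} {π : Mor P Q}

/-- The contraction and the section commute with the left action. -/
def LeftLin (c : Contraction π) : Prop := IsLeftLin k G S c.h ∧ IsLeftLin k G S c.s

/-- The contraction and the section commute with the right action. -/
def RightLin (c : Contraction π) : Prop := IsRightLin k G S c.h ∧ IsRightLin k G S c.s

/-- The elements without components of degree less than `p`. -/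
def filtration (c : Contraction π) (p : ℕ) : Submodule (G ⊗[k] S) P.carrier where
  carrier := {x | ∀ q < p, c.D q x = 0}
  add_mem' {x y} hx hy q hq := by rw [map_add, hx q hq, hy q hq, add_zero]
  zero_mem' q _ := map_zero _
  smul_mem' e x hx q hq := by rw [map_smul, hx q hq, smul_zero]

/-- Filter `P` by degree: `h` raises the degree by one, and `d - κ = δ₀ + δ₁` does not lower it, so
the perturbation lemma applies. Both linearity conditions are needed because the inverse must be
linear over `G ⊗ S`. -/
theorem isIso (c : Contraction π) (hl : c.LeftLin) (hr : c.RightLin) : IsIso π.cls := by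
  refine isIso_of_filtered_contraction π
    { c.s with map_smul' := hl.2.map_smul hr.2 } { c.h with map_smul' := hl.1.map_smul hr.1 } c.κ
    c.π_s c.π_h (fun x => eq_sub_of_add_eq (c.homotopy x)) c.filtration (N := c.N) ?_ ?_ ?_ ?_
  · exact eq_top_iff.2 fun x _ q hq => absurd hq (Nat.not_lt_zero q)
  · refine eq_bot_iff.2 fun x hx => ?_
    rw [Submodule.mem_bot, ← c.sum_D x]
    exact Finset.sum_eq_zero fun q hq => hx q (Finset.mem_range.1 hq)
  · intro p x hx q hq
    change c.D q (c.h x) = 0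
    cases q with
    | zero => exact c.D_zero_h x
    | succ q => rw [c.D_succ_h, hx q (by omega), map_zero]
  · intro p x hx q hq
    rw [c.d_eq, add_assoc, add_sub_cancel_left, map_add, c.D_δ₀, hx q hq, map_zero, zero_add]
    cases q with
    | zero => exact c.D_zero_δ₁ x
    | succ q => rw [c.D_succ_δ₁, hx q (by omega), map_zero]

section tensor

variable (c : Contraction π)

theorem D_sgn (q : ℕ) (x : P.carrier) : c.D q (P.sgn x) = P.sgn (c.D q x) := by
  simp only [sgn_apply, odd_apply, map_sub, c.D_even]

end tensor

/-- The contraction of `π ⊗ 1 : P ⊗ X → Q ⊗ X`. -/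
def tensorRight (c : Contraction π) (X : BiFact k S R V W) {J : Type u}
    (b : Module.Basis J (S ⊗[k] R) X.carrier) : Contraction (tensorMor π (Mor.id X)) where
  h := extLeft b c.h c.h_scalar
  s := extLeft b c.s c.s_scalar
  κ := BiTensor.map c.κ LinearMap.id
  -- Degree is counted in the factor `P` alone, so the differential of `X` has degree zero.
  δ₀ := BiTensor.map c.δ₀ LinearMap.id + BiTensor.map P.sgn X.d
  δ₁ := BiTensor.map c.δ₁ LinearMap.id
  D q := BiTensor.map (c.D q) LinearMap.id
  N := c.N
  h_scalar := (extLeft_isRightLin b c.h c.h_scalar).isScalar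
  s_scalar := (extLeft_isRightLin b c.s c.s_scalar).isScalar
  d_eq := tensor_ext _ _ (fun _ _ => map_add _ _ _)
    (fun _ _ => by simp only [map_add]; abel) fun p x => by
      simp only [LinearMap.add_apply, map_mk, LinearMap.id_apply, c.d_eq, add_mk]
      abel
  κ_odd := tensor_ext _ _ (fun _ _ => by simp only [map_add])
    (fun _ _ => by simp only [map_add]; abel) fun p x => by
      simp only [LinearMap.add_apply, map_mk, LinearMap.id_apply, c.κ_odd, map_add, odd_apply,
        map_sub, sub_mk, mk_sub]
      abel
  D_even q := tensor_ext _ _ (fun _ _ => by simp only [map_add])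
    (fun _ _ => by simp only [map_add]) fun p x => by
      simp only [LinearMap.add_apply, map_mk, LinearMap.id_apply, map_add, odd_apply,
        map_sub, c.D_even]
  π_s := ext_left b (fun _ _ => by simp only [map_add]) (fun _ _ => rfl) fun y r j => by
    rw [extLeft_mk]
    exact congrArg (fun y => BiTensor.mk k G S R y (((1 : S) ⊗ₜ[k] r) • b j)) (c.π_s y)
  π_h := ext_left b (fun _ _ => by simp only [map_add]) (fun _ _ => (add_zero _).symm)
    fun y r j => by
      rw [extLeft_mk]
      refine (congrArg (fun y => BiTensor.mk k G S R y (((1 : S) ⊗ₜ[k] r) • b j)) (c.π_h y)).trans ?_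
      exact zero_mk _
  homotopy := ext_left b (fun _ _ => by simp only [map_add]; abel) (fun _ _ => rfl) fun y r j => by
    have h1 : (tensorMor π (Mor.id X)).lin (BiTensor.mk k G S R y (((1 : S) ⊗ₜ[k] r) • b j)) =
      BiTensor.mk k G S R (π.lin y) (((1 : S) ⊗ₜ[k] r) • b j) := rfl
    rw [h1, extLeft_mk, extLeft_mk, map_mk, map_mk, LinearMap.id_apply, extLeft_mk, ← add_mk,
      ← add_mk, c.homotopy]
  D_zero_h := ext_left b (fun _ _ => by simp only [map_add]) (fun _ _ => (add_zero _).symm)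
    fun y r j => by
      rw [extLeft_mk, map_mk, c.D_zero_h]
      exact zero_mk _
  D_succ_h q := ext_left b (fun _ _ => by simp only [map_add]) (fun _ _ => by simp only [map_add])
    fun y r j => by
      rw [extLeft_mk, map_mk, map_mk, LinearMap.id_apply, extLeft_mk, c.D_succ_h]
  D_δ₀ q := tensor_ext _ _ (fun _ _ => by simp only [map_add])
    (fun _ _ => by simp only [map_add]) fun p x => by
      simp only [LinearMap.add_apply, map_mk, LinearMap.id_apply, map_add, c.D_δ₀, c.D_sgn]
  D_zero_δ₁ := tensor_ext _ _ (fun _ _ => by simp only [map_add])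
    (fun _ _ => (add_zero _).symm) fun p x => by
      simp only [map_mk, LinearMap.id_apply, c.D_zero_δ₁]
      exact zero_mk _
  D_succ_δ₁ q := tensor_ext _ _ (fun _ _ => by simp only [map_add])
    (fun _ _ => by simp only [map_add]) fun p x => by
      simp only [map_mk, LinearMap.id_apply, c.D_succ_δ₁]
  sum_D := tensor_ext _ _ (fun _ _ => by simp only [map_add, Finset.sum_add_distrib])
    (fun _ _ => rfl) fun p x => by
      simp only [map_mk, LinearMap.id_apply]
      conv_rhs => rw [← c.sum_D p]
      exact (sum_mk _ _ _).symm

/-- Right linearity is gained by tensoring with a free `X` on the right, whatever the contraction;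
left linearity is only inherited. -/
theorem tensorRight_rightLin (c : Contraction π) (X : BiFact k S R V W) {J : Type u}
    (b : Module.Basis J (S ⊗[k] R) X.carrier) : (c.tensorRight X b).RightLin :=
  ⟨extLeft_isRightLin b c.h c.h_scalar, extLeft_isRightLin b c.s c.s_scalar⟩

theorem tensorRight_leftLin (c : Contraction π) (X : BiFact k S R V W) {J : Type u}
    (b : Module.Basis J (S ⊗[k] R) X.carrier) (hc : c.LeftLin) : (c.tensorRight X b).LeftLin :=
  ⟨extLeft_isLeftLin b c.h c.h_scalar hc.1, extLeft_isLeftLin b c.s c.s_scalar hc.2⟩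

end Contraction

/-- The involution `y ⊗ x ↦ (-1)^(|x| |y|) y ⊗ x`. -/
def koszulSign (Y : BiFact k G S U V) (P : BiFact k S R V W) :
    BiTensor k G S R Y.carrier P.carrier →ₗ[G ⊗[k] R] BiTensor k G S R Y.carrier P.carrier :=
  BiTensor.map LinearMap.id P.even + BiTensor.map Y.sgn P.odd

theorem koszulSign_mk (Y : BiFact k G S U V) (P : BiFact k S R V W) (y : Y.carrier)
    (x : P.carrier) : koszulSign Y P (BiTensor.mk k G S R y x) =
      BiTensor.mk k G S R y (P.even x) + BiTensor.mk k G S R (Y.sgn y) (P.odd x) := rfl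

theorem koszulSign_koszulSign (Y : BiFact k G S U V) (P : BiFact k S R V W) :
    ∀ x, koszulSign Y P (koszulSign Y P x) = x :=
  tensor_ext _ _ (fun _ _ => by simp only [map_add]) (fun _ _ => rfl) fun y x => by
    simp only [koszulSign_mk, map_add, even_even, odd_apply, sgn_apply, map_sub, sub_mk, mk_sub]
    abel

/-- The sign depends only on degrees, and `1 ⊗ f` preserves them for even `f`. -/
theorem koszulSign_map (Y : BiFact k G S U V) {P Q : BiFact k S R V W}
    (f : P.carrier →ₗ[S ⊗[k] R] Q.carrier) (hf : IsEven f) :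
    ∀ x, koszulSign Y Q (BiTensor.map (LinearMap.id : Y.carrier →ₗ[G ⊗[k] S] _) f x) =
      BiTensor.map (LinearMap.id : Y.carrier →ₗ[G ⊗[k] S] _) f (koszulSign Y P x) :=
  tensor_ext _ _ (fun _ _ => by simp only [map_add]) (fun _ _ => by simp only [map_add])
    fun y x => by
      have hf' : ∀ x, f (P.even x) = Q.even (f x) := hf
      simp only [koszulSign_mk, map_add, map_mk, LinearMap.id_apply, odd_apply, map_sub, hf']

/-- An odd `f` changes `|x|` by one and hence the sign by `(-1)^|y|`. Thus the Koszul-signed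
operator `sgn ⊗ f` is the conjugate of the unsigned `1 ⊗ f`. -/
theorem koszulSign_map_odd (Y : BiFact k G S U V) {P : BiFact k S R V W}
    (f : P.carrier →ₗ[S ⊗[k] R] P.carrier) (hf : IsOdd f) :
    ∀ x, BiTensor.map Y.sgn f (koszulSign Y P x) =
      koszulSign Y P (BiTensor.map (LinearMap.id : Y.carrier →ₗ[G ⊗[k] S] _) f x) :=
  tensor_ext _ _ (fun _ _ => by simp only [map_add]) (fun _ _ => by simp only [map_add])
    fun y x => by
      have hf' : ∀ x, f (P.even x) = f x - P.even (f x) := hf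
      simp only [koszulSign_mk, map_add, map_mk, LinearMap.id_apply, odd_apply, sgn_apply, map_sub,
        even_even, hf', sub_mk, mk_sub]
      abel

namespace Contraction

variable {P Q : BiFact k S R V W} {π : Mor P Q}

theorem map_D_koszulSign (c : Contraction π) (Y : BiFact k G S U V) (q : ℕ)
    (x : BiTensor k G S R Y.carrier P.carrier) :
    BiTensor.map (LinearMap.id : Y.carrier →ₗ[G ⊗[k] S] _) (c.D q) (koszulSign Y P x) =
      koszulSign Y P (BiTensor.map (LinearMap.id : Y.carrier →ₗ[G ⊗[k] S] _) (c.D q) x) :=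
  (koszulSign_map Y (c.D q) (c.D_even q) x).symm

section

variable (c : Contraction π) (Y : BiFact k G S U V) {J : Type u}
    (b : Module.Basis J (G ⊗[k] S) Y.carrier)

/-- The contraction of `1 ⊗ π : Y ⊗ P → Y ⊗ Q`. -/
def tensorLeft : Contraction (tensorMor (Mor.id Y) π) where
  -- Neither `c.h` nor the basis of `Y` is assumed homogeneous, so the signs cannot be inserted
  -- directly. Conjugation by the sign involution inserts them and reduces every identity to the
  -- unsigned map `1 ⊗ c.h`.
  h := (koszulSign Y P).toAddMonoidHom.comp
    ((extRight b c.h c.h_scalar).comp (koszulSign Y P).toAddMonoidHom)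
  s := (koszulSign Y P).toAddMonoidHom.comp
    ((extRight b c.s c.s_scalar).comp (koszulSign Y Q).toAddMonoidHom)
  κ := BiTensor.map Y.sgn c.κ
  δ₀ := BiTensor.map Y.d LinearMap.id + BiTensor.map Y.sgn c.δ₀
  δ₁ := BiTensor.map Y.sgn c.δ₁
  D q := BiTensor.map LinearMap.id (c.D q)
  N := c.N
  h_scalar a x := by
    change koszulSign Y P (extRight b c.h c.h_scalar (koszulSign Y P _)) = _
    rw [map_smul, (extRight_isLeftLin b c.h c.h_scalar).isScalar, map_smul]
    rfl
  s_scalar a x := by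
    change koszulSign Y P (extRight b c.s c.s_scalar (koszulSign Y Q _)) = _
    rw [map_smul, (extRight_isLeftLin b c.s c.s_scalar).isScalar, map_smul]
    rfl
  d_eq := tensor_ext _ _ (fun _ _ => map_add _ _ _)
    (fun _ _ => by simp only [map_add]; abel) fun p x => by
      simp only [LinearMap.add_apply, map_mk, LinearMap.id_apply, c.d_eq, mk_add]
      abel
  κ_odd := tensor_ext _ _ (fun _ _ => by simp only [map_add])
    (fun _ _ => by simp only [map_add]; abel) fun p x => by
      simp only [LinearMap.add_apply, map_mk, c.κ_odd, map_add, odd_apply, sgn_apply,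
        map_sub, sub_mk, mk_sub, even_even]
      abel
  D_even q := tensor_ext _ _ (fun _ _ => by simp only [map_add])
    (fun _ _ => by simp only [map_add]) fun p x => by
      simp only [LinearMap.add_apply, map_mk, LinearMap.id_apply, map_add, odd_apply,
        map_sub, c.D_even]
  π_s y := by
    change BiTensor.map LinearMap.id π.lin (koszulSign Y P (extRight b c.s c.s_scalar _)) = y
    rw [← koszulSign_map Y π.lin π.isEven]
    conv_rhs => rw [← koszulSign_koszulSign Y Q y]
    refine congrArg _ (ext_right b (f := fun z => BiTensor.map LinearMap.id π.lin
      (extRight b c.s c.s_scalar z)) (g := fun z => z)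
      (fun _ _ => by simp only [map_add]) (fun _ _ => rfl) (fun t j z => ?_) (koszulSign Y Q y))
    rw [extRight_mk, map_mk, c.π_s, LinearMap.id_apply]
  π_h x := by
    change BiTensor.map LinearMap.id π.lin (koszulSign Y P (extRight b c.h c.h_scalar _)) = 0
    rw [← koszulSign_map Y π.lin π.isEven]
    refine (congrArg _ (ext_right b (f := fun z => BiTensor.map LinearMap.id π.lin
      (extRight b c.h c.h_scalar z)) (g := fun z => 0)
      (fun _ _ => by simp only [map_add]) (fun _ _ => (add_zero _).symm)
      (fun t j z => ?_) (koszulSign Y P x))).trans (map_zero _)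
    rw [extRight_mk, map_mk, c.π_h]
    exact mk_zero _
  homotopy x := by
    change BiTensor.map Y.sgn c.κ (koszulSign Y P (extRight b c.h c.h_scalar (koszulSign Y P x))) +
      koszulSign Y P (extRight b c.h c.h_scalar (koszulSign Y P (BiTensor.map Y.sgn c.κ x))) +
      koszulSign Y P (extRight b c.s c.s_scalar (koszulSign Y Q
        (BiTensor.map LinearMap.id π.lin x))) = x
    rw [koszulSign_map_odd Y c.κ c.κ_odd, koszulSign_map Y π.lin π.isEven]
    -- With all terms conjugated, the remaining identity is the unsigned one, which holds in the
    -- factor `P`.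
    have h1 : koszulSign Y P (BiTensor.map Y.sgn c.κ x) =
        BiTensor.map LinearMap.id c.κ (koszulSign Y P x) := by
      conv_lhs => rw [← koszulSign_koszulSign Y P x]
      rw [koszulSign_map_odd Y c.κ c.κ_odd, koszulSign_koszulSign]
    rw [h1, ← map_add, ← map_add]
    conv_rhs => rw [← koszulSign_koszulSign Y P x]
    refine congrArg _ (ext_right b (f := fun z => BiTensor.map LinearMap.id c.κ
      (extRight b c.h c.h_scalar z) + extRight b c.h c.h_scalar (BiTensor.map LinearMap.id c.κ z) +
      extRight b c.s c.s_scalar (BiTensor.map LinearMap.id π.lin z)) (g := fun z => z)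
      (fun _ _ => by simp only [map_add]; abel) (fun _ _ => rfl) (fun t j z => ?_)
      (koszulSign Y P x))
    rw [extRight_mk, map_mk, map_mk, map_mk, LinearMap.id_apply, extRight_mk, extRight_mk, ← mk_add,
      ← mk_add, c.homotopy]
  D_zero_h x := by
    refine (c.map_D_koszulSign Y 0 (extRight b c.h c.h_scalar (koszulSign Y P x))).trans ?_
    refine (congrArg _ (ext_right b (f := fun z => BiTensor.map LinearMap.id (c.D 0)
      (extRight b c.h c.h_scalar z)) (g := fun z => 0)
      (fun _ _ => by simp only [map_add]) (fun _ _ => (add_zero _).symm)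
      (fun t j z => ?_) (koszulSign Y P x))).trans (map_zero _)
    rw [extRight_mk, map_mk, c.D_zero_h]
    exact mk_zero _
  D_succ_h q x := by
    refine (c.map_D_koszulSign Y (q + 1) (extRight b c.h c.h_scalar (koszulSign Y P x))).trans ?_
    change _ = koszulSign Y P (extRight b c.h c.h_scalar (koszulSign Y P _))
    rw [← c.map_D_koszulSign Y q x]
    refine congrArg (koszulSign Y P) (ext_right b (f := fun z => BiTensor.map LinearMap.id (c.D (q + 1))
      (extRight b c.h c.h_scalar z)) (g := fun z => extRight b c.h c.h_scalar
        (BiTensor.map LinearMap.id (c.D q) z))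
      (fun _ _ => by simp only [map_add]) (fun _ _ => by simp only [map_add])
      (fun t j z => ?_) (koszulSign Y P x))
    rw [extRight_mk, map_mk, map_mk, LinearMap.id_apply, extRight_mk, c.D_succ_h]
  D_δ₀ q := tensor_ext _ _ (fun _ _ => by simp only [map_add])
    (fun _ _ => by simp only [map_add]) fun p x => by
      simp only [LinearMap.add_apply, map_mk, LinearMap.id_apply, map_add, c.D_δ₀]
  D_zero_δ₁ := tensor_ext _ _ (fun _ _ => by simp only [map_add])
    (fun _ _ => (add_zero _).symm) fun p x => by
      simp only [map_mk, LinearMap.id_apply, c.D_zero_δ₁]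
      exact mk_zero _
  D_succ_δ₁ q := tensor_ext _ _ (fun _ _ => by simp only [map_add])
    (fun _ _ => by simp only [map_add]) fun p x => by
      simp only [map_mk, LinearMap.id_apply, c.D_succ_δ₁]
  sum_D := tensor_ext _ _ (fun _ _ => by simp only [map_add, Finset.sum_add_distrib])
    (fun _ _ => rfl) fun p x => by
      simp only [map_mk, LinearMap.id_apply]
      conv_rhs => rw [← c.sum_D x]
      exact (mk_sum _ _ _).symm

/-- The sign involution is linear on both sides, so conjugating by it does not disturb the left
linearity gained from `extRight`. -/
theorem tensorLeft_leftLin : (c.tensorLeft Y b).LeftLin := by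
  refine ⟨fun t x => ?_, fun t x => ?_⟩
  · change koszulSign Y P (extRight b c.h c.h_scalar (koszulSign Y P _)) = _
    rw [map_smul, extRight_isLeftLin b c.h c.h_scalar, map_smul]
    rfl
  · change koszulSign Y P (extRight b c.s c.s_scalar (koszulSign Y Q _)) = _
    rw [map_smul, extRight_isLeftLin b c.s c.s_scalar, map_smul]
    rfl

theorem tensorLeft_rightLin (hc : c.RightLin) : (c.tensorLeft Y b).RightLin := by
  refine ⟨fun t x => ?_, fun t x => ?_⟩
  · change koszulSign Y P (extRight b c.h c.h_scalar (koszulSign Y P _)) = _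
    rw [map_smul, extRight_isRightLin b c.h c.h_scalar hc.1, map_smul]
    rfl
  · change koszulSign Y P (extRight b c.s c.s_scalar (koszulSign Y Q _)) = _
    rw [map_smul, extRight_isRightLin b c.s c.s_scalar hc.2, map_smul]
    rfl

end

end Contraction

end

end LandauGinzburg

end

/-! ### The `θ`-degree on exterior algebras and Koszul complexes. -/

noncomputable section

namespace LandauGinzburg

namespace Ext

variable (k : Type u) [CommRing k] (n : ℕ)

/-- The projection onto the part of `θ`-degree `q`. -/
def deg (q : ℕ) : Ext k n →ₗ[k] Ext k n :=
  GradedAlgebra.proj (fun i : ℕ => ⋀[k]^i (Fin n → k)) q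

variable {k n}

theorem deg_of_mem {i : ℕ} {x : Ext k n} (hx : x ∈ ⋀[k]^i (Fin n → k)) (q : ℕ) :
    deg k n q x = if q = i then x else 0 := by
  split_ifs with h
  · subst h
    exact DirectSum.decompose_of_mem_same (fun i : ℕ => ⋀[k]^i (Fin n → k)) hx
  · exact DirectSum.decompose_of_mem_ne (fun i : ℕ => ⋀[k]^i (Fin n → k)) hx (Ne.symm h)

theorem deg_algebraMap (q : ℕ) (r : k) :
    deg k n q (algebraMap k (Ext k n) r) = if q = 0 then algebraMap k (Ext k n) r else 0 :=
  deg_of_mem (SetLike.algebraMap_mem_graded (fun i : ℕ => ⋀[k]^i (Fin n → k)) r) q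

theorem deg_ι_mul (q : ℕ) (v : Fin n → k) (x : Ext k n) :
    deg k n q (ExteriorAlgebra.ι k v * x) =
      if q = 0 then 0 else ExteriorAlgebra.ι k v * deg k n (q - 1) x := by
  induction x using DirectSum.Decomposition.inductionOn (fun i : ℕ => ⋀[k]^i (Fin n → k)) with
  | zero => simp
  | @homogeneous i m =>
    have hv : ExteriorAlgebra.ι k v * (m : Ext k n) ∈ ⋀[k]^(1 + i) (Fin n → k) :=
      SetLike.mul_mem_graded (A := fun i : ℕ => ⋀[k]^i (Fin n → k))
        (i := 1)
        ((pow_one (LinearMap.range (ExteriorAlgebra.ι k (M := Fin n → k)))).ge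
          (LinearMap.mem_range_self _ v)) m.2
    rw [deg_of_mem hv, deg_of_mem m.2]
    cases q with
    | zero => rw [if_pos rfl, if_neg (by omega)]
    | succ q =>
      by_cases h : q = i
      · simp [h, add_comm]
      · have : ¬ (q + 1 = 1 + i) := by omega
        simp [h, this]
  | add x y hx hy =>
    rw [mul_add, map_add, hx, hy, map_add, mul_add]
    split_ifs <;> simp

theorem deg_zero_ι_mul (v : Fin n → k) (x : Ext k n) :
    deg k n 0 (ExteriorAlgebra.ι k v * x) = 0 := by rw [deg_ι_mul, if_pos rfl]

theorem deg_succ_ι_mul (q : ℕ) (v : Fin n → k) (x : Ext k n) :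
    deg k n (q + 1) (ExteriorAlgebra.ι k v * x) = ExteriorAlgebra.ι k v * deg k n q x := by
  rw [deg_ι_mul, if_neg (Nat.succ_ne_zero q), Nat.add_sub_cancel]

theorem deg_zero_wedge (i : Fin n) (x : Ext k n) : deg k n 0 (wedge k i x) = 0 :=
  deg_zero_ι_mul _ x

theorem deg_succ_wedge (q : ℕ) (i : Fin n) (x : Ext k n) :
    deg k n (q + 1) (wedge k i x) = wedge k i (deg k n q x) := deg_succ_ι_mul q _ x

theorem contract_algebraMap (i : Fin n) (r : k) : contract k i (algebraMap k (Ext k n) r) = 0 :=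
  CliffordAlgebra.contractLeft_algebraMap (Q := (0 : QuadraticForm k (Fin n → k))) _ r

theorem contract_ι_mul (i : Fin n) (v : Fin n → k) (y : Ext k n) :
    contract k i (ExteriorAlgebra.ι k v * y) = v i • y - ExteriorAlgebra.ι k v * contract k i y :=
  CliffordAlgebra.contractLeft_ι_mul (Q := (0 : QuadraticForm k (Fin n → k)))
    (d := LinearMap.proj i) v y

theorem ext_induction {p : Ext k n → Prop} (h₁ : ∀ r, p (algebraMap k (Ext k n) r))
    (h₂ : ∀ x y, p x → p y → p (x + y)) (h₃ : ∀ x v, p x → p (ExteriorAlgebra.ι k v * x)) (x) :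
    p x := by
  induction x using CliffordAlgebra.left_induction with
  | algebraMap r => exact h₁ r
  | add x y hx hy => exact h₂ x y hx hy
  | ι_mul x v hx => exact h₃ x v hx

theorem contract_deg_zero (i : Fin n) (x : Ext k n) : contract k i (deg k n 0 x) = 0 := by
  induction x using ext_induction with
  | h₁ r => rw [deg_algebraMap, if_pos rfl, contract_algebraMap]
  | h₂ x y hx hy => rw [map_add, map_add, hx, hy, add_zero]
  | h₃ x v hx => rw [deg_zero_ι_mul, map_zero]

/-- Contraction lowers the degree by one; this follows by induction on left multiplication by
vectors, from the antiderivation rule. -/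
theorem contract_deg_succ (i : Fin n) (x : Ext k n) :
    ∀ q, contract k i (deg k n (q + 1) x) = deg k n q (contract k i x) := by
  induction x using ext_induction with
  | h₁ r =>
    intro q
    rw [deg_algebraMap, if_neg (Nat.succ_ne_zero q), contract_algebraMap, map_zero, map_zero]
  | h₂ x y hx hy => intro q; simp only [map_add, hx, hy]
  | h₃ x v hx =>
    intro q
    rw [deg_succ_ι_mul, contract_ι_mul, contract_ι_mul, map_sub, map_smul]
    cases q with
    | zero => rw [contract_deg_zero, mul_zero, deg_zero_ι_mul]
    | succ q => rw [hx, deg_succ_ι_mul]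

theorem even_ι_mul (v : Fin n → k) (x : Ext k n) :
    even k n (ExteriorAlgebra.ι k v * x) = ExteriorAlgebra.ι k v * (x - even k n x) := by
  rw [mul_sub, ι_mul_even]; abel

theorem deg_even (x : Ext k n) : ∀ q, deg k n q (even k n x) = even k n (deg k n q x) := by
  induction x using ext_induction with
  | h₁ r =>
    intro q
    rw [even_algebraMap, deg_algebraMap]
    split_ifs
    · rw [even_algebraMap]
    · rw [map_zero]
  | h₂ x y hx hy => intro q; simp only [map_add, hx, hy]
  | h₃ x v hx =>
    intro q
    rw [even_ι_mul]
    cases q with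
    | zero => rw [deg_zero_ι_mul, deg_zero_ι_mul, map_zero]
    | succ q => rw [deg_succ_ι_mul, deg_succ_ι_mul, even_ι_mul, map_sub, hx]

theorem aug_algebraMap (r : k) : aug k n (algebraMap k (Ext k n) r) = r := (aug k n).commutes r

theorem aug_ι_mul (v : Fin n → k) (x : Ext k n) : aug k n (ExteriorAlgebra.ι k v * x) = 0 := by
  simp [aug, ExteriorAlgebra.algebraMapInv]

theorem deg_zero_eq (x : Ext k n) : deg k n 0 x = algebraMap k (Ext k n) (aug k n x) := by
  induction x using ext_induction with
  | h₁ r => rw [deg_algebraMap, if_pos rfl, aug_algebraMap]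
  | h₂ x y hx hy => simp only [map_add, hx, hy]
  | h₃ x v hx => rw [deg_zero_ι_mul, aug_ι_mul, map_zero]

theorem deg_deg (p q : ℕ) (x : Ext k n) :
    deg k n p (deg k n q x) = if p = q then deg k n q x else 0 :=
  deg_of_mem (SetLike.coe_mem (DirectSum.decompose (fun i : ℕ => ⋀[k]^i (Fin n → k)) x q)) p

instance : Module.Free k (Ext k n) := Module.Free.of_basis (Pi.basisFun k (Fin n)).ExteriorAlgebra

instance : Module.Finite k (Ext k n) :=
  Module.Finite.of_basis (Pi.basisFun k (Fin n)).ExteriorAlgebra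

variable (k n) in
-- Each element has finitely many components. The exterior algebra is finitely generated over `k`,
-- so a bound for the generators serves all elements at once.
theorem exists_sum_deg : ∃ N, ∀ x, ∑ q ∈ Finset.range N, deg k n q x = x := by
  classical
  have h1 : ∀ x : Ext k n, ∃ N, ∀ q, N ≤ q → deg k n q x = 0 := fun x => by
    obtain ⟨N, hN⟩ := (DirectSum.decompose (fun i : ℕ => ⋀[k]^i (Fin n → k)) x).support.exists_nat_subset_range
    refine ⟨N, fun q hq => ?_⟩
    by_contra h
    have : q ∈ (DirectSum.decompose (fun i : ℕ => ⋀[k]^i (Fin n → k)) x).support := by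
      rw [DFinsupp.mem_support_toFun]
      intro h'
      exact h (congrArg Subtype.val h')
    have := Finset.mem_range.1 (hN this)
    omega
  choose N hN using h1
  obtain ⟨t, ht⟩ := (Module.Finite.fg_top : (⊤ : Submodule k (Ext k n)).FG)
  refine ⟨t.sup N, fun x => ?_⟩
  have hz : ∀ q, t.sup N ≤ q → deg k n q x = 0 := fun q hq => by
    have : x ∈ Submodule.span k (t : Set (Ext k n)) := by rw [ht]; trivial
    induction this using Submodule.span_induction with
    | mem y hy => exact hN y q ((Finset.le_sup hy).trans hq)
    | zero => exact map_zero _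
    | add y z _ _ hy hz => rw [map_add, hy, hz, add_zero]
    | smul a y _ hy => rw [map_smul, hy, smul_zero]
  conv_rhs => rw [← DirectSum.sum_support_decompose (fun i : ℕ => ⋀[k]^i (Fin n → k)) x]
  symm
  refine Finset.sum_subset (fun q hq => Finset.mem_range.2 ?_) fun q _ hq => ?_
  · by_contra h
    rw [DFinsupp.mem_support_toFun] at hq
    exact hq (Subtype.ext (hz q (not_lt.1 h)))
  · rw [DFinsupp.mem_support_toFun, not_not] at hq
    exact congrArg Subtype.val hq

/-- The composite of all `θᵢ* θᵢ` for `i` in a list. -/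
def vacuum (l : List (Fin n)) : Module.End k (Ext k n) :=
  (l.map fun i => contract k i ∘ₗ wedge k i).prod

theorem vacuum_cons (i : Fin n) (l : List (Fin n)) (x : Ext k n) :
    vacuum (i :: l) x = contract k i (wedge k i (vacuum l x)) := by
  rw [vacuum, List.map_cons, List.prod_cons]
  rfl

theorem contract_wedge_wedge_self (i : Fin n) (x : Ext k n) :
    contract k i (wedge k i (wedge k i x)) = 0 := by rw [wedge_wedge, map_zero]

/-- `θ_i` anticommutes with both `θ_j` and `θ_j*` when `i ≠ j`, and the two signs cancel. -/
theorem contract_wedge_wedge {i j : Fin n} (h : j ≠ i) (x : Ext k n) :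
    contract k j (wedge k j (wedge k i x)) = wedge k i (contract k j (wedge k j x)) := by
  rw [eq_neg_of_add_eq_zero_left (wedge_wedge_add j i x), map_neg, neg_eq_iff_add_eq_zero]
  have := contract_wedge j i (wedge k j x)
  rwa [if_neg h] at this

theorem vacuum_wedge_of_notMem (l : List (Fin n)) {i : Fin n} (hi : i ∉ l) (x : Ext k n) :
    vacuum l (wedge k i x) = wedge k i (vacuum l x) := by
  induction l with
  | nil => rfl
  | cons j l ih =>
    rw [List.mem_cons, not_or] at hi
    rw [vacuum_cons, vacuum_cons, ih hi.2, contract_wedge_wedge (Ne.symm hi.1)]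

theorem vacuum_wedge (l : List (Fin n)) {i : Fin n} (hi : i ∈ l) (x : Ext k n) :
    vacuum l (wedge k i x) = 0 := by
  induction l with
  | nil => exact absurd hi List.not_mem_nil
  | cons j l ih =>
    rw [vacuum_cons]
    by_cases h : i ∈ l
    · rw [ih h, map_zero, map_zero]
    · obtain rfl : i = j := (List.mem_cons.1 hi).resolve_right h
      rw [vacuum_wedge_of_notMem l h, contract_wedge_wedge_self]

theorem contract_wedge_algebraMap (i : Fin n) (r : k) :
    contract k i (wedge k i (algebraMap k (Ext k n) r)) = algebraMap k (Ext k n) r := by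
  have := contract_wedge i i (algebraMap k (Ext k n) r)
  rwa [contract_algebraMap, map_zero, add_zero, if_pos rfl] at this

/-- Each `θ_i* θ_i` fixes scalars and kills multiples of `θ_i`. In a product over all `i`, a factor
`θ_i` commutes past the others until it meets its own, so only degree zero survives. -/
theorem vacuum_finRange (x : Ext k n) :
    vacuum (List.finRange n) x = algebraMap k (Ext k n) (aug k n x) := by
  induction x using ext_induction with
  | h₁ r =>
    rw [aug_algebraMap]
    generalize List.finRange n = l
    induction l with
    | nil => rfl
    | cons i l ih => rw [vacuum_cons, ih, contract_wedge_algebraMap]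
  | h₂ x y hx hy => simp only [map_add, hx, hy]
  | h₃ x v hx =>
    rw [aug_ι_mul, map_zero]
    have hv : ExteriorAlgebra.ι k v * x = ∑ i, v i • wedge k i x := by
      conv_lhs => rw [pi_eq_sum_univ' v, map_sum, Finset.sum_mul]
      refine Finset.sum_congr rfl fun i _ => ?_
      rw [map_smul, smul_mul_assoc]
      rfl
    rw [hv, map_sum]
    exact Finset.sum_eq_zero fun i _ => by
      rw [map_smul, vacuum_wedge _ (List.mem_finRange i), smul_zero]

end Ext

section

variable {k : Type u} [CommRing k] {n : ℕ} {R : Type u} [CommRing R] [Algebra k R]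

/-- The projection onto `θ`-degree `q` in `⋀(⨁ R θᵢ)`. -/
def koszulDeg (k : Type u) [CommRing k] (n : ℕ) (R : Type u) [CommRing R] [Algebra k R] (q : ℕ) :
    R ⊗[k] Ext k n →ₗ[R] R ⊗[k] Ext k n := (Ext.deg k n q).baseChange R

theorem koszulDeg_tmul (q : ℕ) (r : R) (x : Ext k n) :
    koszulDeg k n R q (r ⊗ₜ[k] x) = r ⊗ₜ[k] Ext.deg k n q x := rfl

theorem koszul_koszulDeg_zero (f : Fin n → R) (z : R ⊗[k] Ext k n) :
    koszul k f (koszulDeg k n R 0 z) = 0 := by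
  induction z with
  | zero => simp
  | add x y hx hy => rw [map_add, map_add, hx, hy, add_zero]
  | tmul r x => simp [koszulDeg_tmul, koszul_tmul, Ext.contract_deg_zero]

theorem koszul_koszulDeg_succ (f : Fin n → R) (q : ℕ) (z : R ⊗[k] Ext k n) :
    koszul k f (koszulDeg k n R (q + 1) z) = koszulDeg k n R q (koszul k f z) := by
  induction z with
  | zero => simp
  | add x y hx hy => simp only [map_add, hx, hy]
  | tmul r x => simp [koszulDeg_tmul, koszul_tmul, Ext.contract_deg_succ]

theorem koszulDeg_zero_cokoszul (f : Fin n → R) (z : R ⊗[k] Ext k n) :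
    koszulDeg k n R 0 (cokoszul k f z) = 0 := by
  induction z with
  | zero => simp
  | add x y hx hy => rw [map_add, map_add, hx, hy, add_zero]
  | tmul r x => simp [koszulDeg_tmul, cokoszul_tmul, Ext.deg_zero_wedge]

theorem koszulDeg_succ_cokoszul (f : Fin n → R) (q : ℕ) (z : R ⊗[k] Ext k n) :
    koszulDeg k n R (q + 1) (cokoszul k f z) = cokoszul k f (koszulDeg k n R q z) := by
  induction z with
  | zero => simp
  | add x y hx hy => simp only [map_add, hx, hy]
  | tmul r x => simp [koszulDeg_tmul, cokoszul_tmul, Ext.deg_succ_wedge]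

theorem koszulDeg_koszulDeg (p q : ℕ) (z : R ⊗[k] Ext k n) :
    koszulDeg k n R p (koszulDeg k n R q z) = if p = q then koszulDeg k n R q z else 0 := by
  induction z with
  | zero => simp
  | add x y hx hy => rw [map_add, map_add, hx, hy]; split_ifs <;> simp
  | tmul r x => rw [koszulDeg_tmul, koszulDeg_tmul, Ext.deg_deg]; split_ifs <;> simp

theorem koszulDeg_even (q : ℕ) (z : R ⊗[k] Ext k n) :
    koszulDeg k n R q ((Ext.even k n).baseChange R z) =
      (Ext.even k n).baseChange R (koszulDeg k n R q z) := by
  induction z with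
  | zero => simp
  | add x y hx hy => simp only [map_add, hx, hy]
  | tmul r x => simp [koszulDeg_tmul, Ext.deg_even]

theorem koszul_even (f : Fin n → R) (z : R ⊗[k] Ext k n) :
    koszul k f ((Ext.even k n).baseChange R z) =
      koszul k f z - (Ext.even k n).baseChange R (koszul k f z) := by
  induction z with
  | zero => simp
  | add x y hx hy => simp only [map_add, hx, hy]; abel
  | tmul r x =>
    simp [koszul_tmul, Ext.contract_even, tmul_sub, Finset.sum_sub_distrib]

theorem sum_koszulDeg {N : ℕ} (hN : ∀ x, ∑ q ∈ Finset.range N, Ext.deg k n q x = x)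
    (z : R ⊗[k] Ext k n) : ∑ q ∈ Finset.range N, koszulDeg k n R q z = z := by
  induction z with
  | zero => simp
  | add x y hx hy =>
    simp only [map_add, Finset.sum_add_distrib] at hx hy ⊢
    rw [hx, hy]
  | tmul r x => simp only [koszulDeg_tmul, ← tmul_sum, hN]

theorem koszulAug_tmul (r : R) (x : Ext k n) : koszulAug k R (r ⊗ₜ[k] x) = Ext.aug k n x • r := by
  simp [koszulAug]

theorem koszulDeg_zero_eq (z : R ⊗[k] Ext k n) :
    koszulDeg k n R 0 z = koszulAug k R z ⊗ₜ[k] (1 : Ext k n) := by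
  induction z with
  | zero => simp
  | add x y hx hy => rw [map_add, map_add, hx, hy, add_tmul]
  | tmul r x =>
    rw [koszulDeg_tmul, koszulAug_tmul, Ext.deg_zero_eq, Algebra.algebraMap_eq_smul_one, smul_tmul]

theorem koszul_square (f : Fin n → R) (z : R ⊗[k] Ext k n) : koszul k f (koszul k f z) = 0 := by
  -- Taking the wedge coefficients to be zero makes the scalar `∑ g_i f_i` vanish.
  have h := koszul_cokoszul f (0 : Fin n → R) z
  simpa [cokoszul] using h

end

end LandauGinzburg

end

/-! ### Diagonal bimodules, and contracting the Koszul complex by divided differences. -/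

noncomputable section

namespace LandauGinzburg

open LinFact BiFact BiTensor

section Diagonal

variable {k S : Type u} [CommRing k] [CommRing S] [Algebra k S]

/-- An `S`-module `M`, regarded as an `S ⊗ S`-module through the multiplication of `S`. -/
def DiagMod (_k _S M : Type u) : Type u := M

instance (M : Type u) [AddCommGroup M] : AddCommGroup (DiagMod k S M) :=
  inferInstanceAs (AddCommGroup M)

instance (M : Type u) [AddCommGroup M] [Module S M] : Module (S ⊗[k] S) (DiagMod k S M) :=
  Module.compHom M (Algebra.TensorProduct.lmul' k (S := S)).toRingHom

namespace DiagMod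

variable {M N : Type u} [AddCommGroup M] [Module S M] [AddCommGroup N] [Module S N]

variable (k S) in
/-- The identity `M → DiagMod k S M`. -/
def of : M ≃+ DiagMod k S M := AddEquiv.refl M

theorem smul_of (e : S ⊗[k] S) (x : M) :
    e • of k S x = of k S (Algebra.TensorProduct.lmul' k (S := S) e • x) := rfl

theorem tmul_smul_of (a b : S) (x : M) : (a ⊗ₜ[k] b) • of k S x = of k S ((a * b) • x) := by
  rw [smul_of, Algebra.TensorProduct.lmul'_apply_tmul]

variable (k) in
/-- The map of diagonal bimodules given by an `S`-linear map. -/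
def map (f : M →ₗ[S] N) : DiagMod k S M →ₗ[S ⊗[k] S] DiagMod k S N :=
  { f.toAddMonoidHom with
    map_smul' := fun e x => f.map_smul (Algebra.TensorProduct.lmul' k (S := S) e) x }

end DiagMod

/-- A `ℤ/2`-graded complex of `S`-modules as a linear factorisation of `W ⊗ 1 - 1 ⊗ W`. -/
abbrev diagFact (k : Type u) [CommRing k] {S : Type u} [CommRing S] [Algebra k S] (W : S) {M : Type u}
    [AddCommGroup M] [Module S M] (even d : M →ₗ[S] M) (h₁ : ∀ x, even (even x) = even x)
    (h₂ : ∀ x, d (even x) = d x - even (d x)) (h₃ : ∀ x, d (d x) = 0) : BiFact k S S W W where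
  carrier := DiagMod k S M
  even := DiagMod.map k even
  even_even := h₁
  d := DiagMod.map k d
  d_even := h₂
  d_d x := by
    have : Algebra.TensorProduct.lmul' k (S := S) (W ⊗ₜ[k] (1 : S) - (1 : S) ⊗ₜ[k] W) = 0 := by
      rw [map_sub, Algebra.TensorProduct.lmul'_apply_tmul, Algebra.TensorProduct.lmul'_apply_tmul,
        mul_one, one_mul, sub_self]
    refine (h₃ x).trans ?_
    change (0 : M) = Algebra.TensorProduct.lmul' k (S := S) _ • (show M from x)
    rw [this, zero_smul]

/-- The diagonal bimodule `S`, in even degree. -/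
abbrev diag (k : Type u) [CommRing k] {S : Type u} [CommRing S] [Algebra k S] (W : S) :
    BiFact k S S W W :=
  diagFact k W (M := S) LinearMap.id 0 (fun _ => rfl) (fun _ => by simp) fun _ => rfl

end Diagonal

section KoszulContraction

variable {k : Type u} [CommRing k] {n : ℕ} {A : Type u} [CommRing A] [Algebra k A]

/-- Algebra endomorphisms `sub i` which set the regular element `y i` to zero. -/
structure Substitution (k : Type u) [CommRing k] {n : ℕ} {A : Type u} [CommRing A] [Algebra k A]
    (y : Fin n → A) where
  sub : Fin n → A →ₐ[k] A
  regular : ∀ i, IsRegular (y i)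
  dvd : ∀ i f, y i ∣ f - sub i f
  sub_y : ∀ i j, sub i (y j) = if j = i then 0 else y j

namespace Substitution

variable {y : Fin n → A} (σ : Substitution k y)

/-- The difference quotient `(f - f|_{yᵢ = 0}) / yᵢ`. -/
def divDiff (i : Fin n) (f : A) : A := (σ.dvd i f).choose

theorem mul_divDiff (i : Fin n) (f : A) : y i * σ.divDiff i f = f - σ.sub i f :=
  (σ.dvd i f).choose_spec.symm

theorem divDiff_eq {i : Fin n} {f q : A} (h : y i * q = f - σ.sub i f) : σ.divDiff i f = q :=
  (σ.regular i).left ((σ.mul_divDiff i f).trans h.symm)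

/-- An element fixed by the substitution is a constant for the difference quotient. This yields the
one-sided linearity of the contraction. -/
theorem divDiff_mul (i : Fin n) (e f : A) (he : σ.sub i e = e) :
    σ.divDiff i (e * f) = e * σ.divDiff i f := σ.divDiff_eq (by
  rw [mul_left_comm, mul_divDiff, map_mul, he, mul_sub])

theorem divDiff_y_mul (i : Fin n) (f : A) : σ.divDiff i (y i * f) = f :=
  σ.divDiff_eq (by rw [map_mul, sub_y, if_pos rfl, zero_mul, sub_zero])

/-- `divDiff` as a `k`-linear map. -/
def divDiffLin (i : Fin n) : A →ₗ[k] A where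
  toFun := σ.divDiff i
  map_add' f g := σ.divDiff_eq (by
    rw [mul_add, mul_divDiff, mul_divDiff, map_add]; abel)
  map_smul' c f := σ.divDiff_eq (by
    rw [mul_smul_comm, mul_divDiff, map_smul, smul_sub, RingHom.id_apply])

/-- The contraction of the Koszul complex of `y` in the direction `i`. -/
def homotopy₁ (i : Fin n) : A ⊗[k] Ext k n →ₗ[k] A ⊗[k] Ext k n :=
  TensorProduct.map (σ.divDiffLin i) (Ext.wedge k i)

theorem homotopy₁_tmul (i : Fin n) (f : A) (x : Ext k n) :
    σ.homotopy₁ i (f ⊗ₜ[k] x) = σ.divDiff i f ⊗ₜ[k] Ext.wedge k i x := rfl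

/-- The projection of the Koszul complex which sets `yᵢ` and `θᵢ` to zero. -/
def vacuum₁ (i : Fin n) : A ⊗[k] Ext k n →ₗ[k] A ⊗[k] Ext k n :=
  TensorProduct.map (σ.sub i).toLinearMap (Ext.contract k i ∘ₗ Ext.wedge k i)

theorem vacuum₁_tmul (i : Fin n) (f : A) (x : Ext k n) :
    σ.vacuum₁ i (f ⊗ₜ[k] x) = σ.sub i f ⊗ₜ[k] Ext.contract k i (Ext.wedge k i x) := rfl

/-- For `j ≠ i` the terms cancel, since `y_j` passes through the `i`-th difference quotient while
`θ_j*` and `θ_i` anticommute. For `j = i`, the product rule for `θ_i*` and `y_i · divDiff f = f -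
sub f` leave the identity minus `sub_i ⊗ θ_i* θ_i`. -/
theorem koszul_homotopy₁ (i : Fin n) (z : A ⊗[k] Ext k n) :
    koszul k y (σ.homotopy₁ i z) + σ.homotopy₁ i (koszul k y z) + σ.vacuum₁ i z = z := by
  induction z with
  | zero => simp
  | add u v hu hv =>
    simp only [map_add]
    conv_rhs => rw [← hu, ← hv]
    abel
  | tmul f x =>
    have h : ∀ j, (y j * σ.divDiff i f) ⊗ₜ[k] Ext.contract k j (Ext.wedge k i x) +
        σ.divDiff i (y j * f) ⊗ₜ[k] Ext.wedge k i (Ext.contract k j x) =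
        if j = i then f ⊗ₜ[k] x - σ.vacuum₁ i (f ⊗ₜ[k] x) else 0 := fun j => by
      have hcw := Ext.contract_wedge j i x
      split_ifs at hcw ⊢ with hj
      · subst hj
        rw [divDiff_y_mul, mul_divDiff, vacuum₁_tmul, sub_tmul, eq_sub_of_add_eq' hcw, tmul_sub]
        abel
      · rw [divDiff_mul σ i _ _ (by rw [sub_y, if_neg hj]), ← tmul_add, hcw, tmul_zero]
    rw [homotopy₁_tmul, koszul_tmul, koszul_tmul, map_sum]
    simp only [homotopy₁_tmul]
    rw [← Finset.sum_add_distrib, Finset.sum_congr rfl fun j _ => h j, Finset.sum_ite_eq',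
      if_pos (Finset.mem_univ i), sub_add_cancel]

/-- The `i`-th term of the Koszul differential dies on both sides, by `θ_i* θ_i* = 0` and by `y_i ↦
0`; for `j ≠ i`, `θ_j*` commutes with `θ_i* θ_i`. -/
theorem koszul_vacuum₁ (i : Fin n) (z : A ⊗[k] Ext k n) :
    koszul k y (σ.vacuum₁ i z) = σ.vacuum₁ i (koszul k y z) := by
  induction z with
  | zero => simp
  | add u v hu hv => simp only [map_add, hu, hv]
  | tmul f x =>
    rw [vacuum₁_tmul, koszul_tmul, koszul_tmul, map_sum]
    refine Finset.sum_congr rfl fun j _ => ?_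
    rw [vacuum₁_tmul, map_mul, sub_y]
    split_ifs with hj
    · subst hj
      rw [Ext.contract_contract, tmul_zero, zero_mul, zero_tmul]
    · congr 1
      have h1 := Ext.contract_contract_add j i (Ext.wedge k i x)
      have h2 := Ext.contract_wedge j i x
      rw [if_neg hj] at h2
      rw [eq_neg_of_add_eq_zero_left h1, eq_neg_of_add_eq_zero_left h2, map_neg, neg_neg]

theorem koszulDeg_vacuum₁ (i : Fin n) (q : ℕ) (z : A ⊗[k] Ext k n) :
    koszulDeg k n A q (σ.vacuum₁ i z) = σ.vacuum₁ i (koszulDeg k n A q z) := by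
  induction z with
  | zero => simp
  | add u v hu hv => simp only [map_add, hu, hv]
  | tmul f x =>
    rw [vacuum₁_tmul, koszulDeg_tmul, koszulDeg_tmul, vacuum₁_tmul, ← Ext.contract_deg_succ,
      Ext.deg_succ_wedge]

theorem koszulDeg_zero_homotopy₁ (i : Fin n) (z : A ⊗[k] Ext k n) :
    koszulDeg k n A 0 (σ.homotopy₁ i z) = 0 := by
  induction z with
  | zero => simp
  | add u v hu hv => simp only [map_add, hu, hv, add_zero]
  | tmul f x => rw [homotopy₁_tmul, koszulDeg_tmul, Ext.deg_zero_wedge, tmul_zero]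

theorem koszulDeg_succ_homotopy₁ (i : Fin n) (q : ℕ) (z : A ⊗[k] Ext k n) :
    koszulDeg k n A (q + 1) (σ.homotopy₁ i z) = σ.homotopy₁ i (koszulDeg k n A q z) := by
  induction z with
  | zero => simp
  | add u v hu hv => simp only [map_add, hu, hv]
  | tmul f x =>
    rw [homotopy₁_tmul, koszulDeg_tmul, koszulDeg_tmul, homotopy₁_tmul, Ext.deg_succ_wedge]

theorem homotopy₁_smul {i : Fin n} {a : A} (ha : σ.sub i a = a) (z : A ⊗[k] Ext k n) :
    σ.homotopy₁ i (a • z) = a • σ.homotopy₁ i z := by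
  induction z with
  | zero => simp
  | add u v hu hv => simp only [smul_add, map_add, hu, hv]
  | tmul f x =>
    rw [smul_tmul', homotopy₁_tmul, homotopy₁_tmul, smul_tmul', smul_eq_mul, smul_eq_mul,
      divDiff_mul σ i _ _ ha]

theorem vacuum₁_smul {i : Fin n} {a : A} (ha : σ.sub i a = a) (z : A ⊗[k] Ext k n) :
    σ.vacuum₁ i (a • z) = a • σ.vacuum₁ i z := by
  induction z with
  | zero => simp
  | add u v hu hv => simp only [smul_add, map_add, hu, hv]
  | tmul f x =>
    rw [smul_tmul', vacuum₁_tmul, vacuum₁_tmul, smul_tmul', smul_eq_mul, smul_eq_mul, map_mul, ha]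

/-- The composite of the substitutions in a list. -/
def subList : List (Fin n) → (A →ₐ[k] A)
  | [] => AlgHom.id k A
  | i :: l => (σ.sub i).comp (subList l)

/-- The projection of the Koszul complex which sets `yᵢ` and `θᵢ` to zero for all `i` in a list. -/
def vacuum (l : List (Fin n)) : A ⊗[k] Ext k n →ₗ[k] A ⊗[k] Ext k n :=
  TensorProduct.map (σ.subList l).toLinearMap (Ext.vacuum l)

theorem vacuum_tmul (l : List (Fin n)) (f : A) (x : Ext k n) :
    σ.vacuum l (f ⊗ₜ[k] x) = σ.subList l f ⊗ₜ[k] Ext.vacuum l x := rfl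

theorem vacuum_nil (z : A ⊗[k] Ext k n) : σ.vacuum [] z = z := by
  induction z with
  | zero => simp
  | add u v hu hv => rw [map_add, hu, hv]
  | tmul f x => rfl

theorem vacuum_cons (i : Fin n) (l : List (Fin n)) (z : A ⊗[k] Ext k n) :
    σ.vacuum (i :: l) z = σ.vacuum₁ i (σ.vacuum l z) := by
  induction z with
  | zero => simp
  | add u v hu hv => simp only [map_add, hu, hv]
  | tmul f x => rw [vacuum_tmul, vacuum_tmul, vacuum₁_tmul, Ext.vacuum_cons]; rfl

/-- The contraction of the Koszul complex of `y` in the directions of a list. -/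
def homotopy : List (Fin n) → (A ⊗[k] Ext k n →ₗ[k] A ⊗[k] Ext k n)
  | [] => 0
  | i :: l => σ.homotopy₁ i + σ.vacuum₁ i ∘ₗ homotopy l

theorem homotopy_nil (z : A ⊗[k] Ext k n) : σ.homotopy [] z = 0 := rfl

theorem homotopy_cons (i : Fin n) (l : List (Fin n)) (z : A ⊗[k] Ext k n) :
    σ.homotopy (i :: l) z = σ.homotopy₁ i z + σ.vacuum₁ i (σ.homotopy l z) := rfl

/-- Substitute the contraction identity for `l` into the vacuum term of the one for `i`: as `vacuum₁
i` commutes with the Koszul differential, the remainder is the vacuum projection of `i :: l`. -/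
theorem koszul_homotopy (l : List (Fin n)) (z : A ⊗[k] Ext k n) :
    koszul k y (σ.homotopy l z) + σ.homotopy l (koszul k y z) + σ.vacuum l z = z := by
  induction l with
  | nil => rw [homotopy_nil, homotopy_nil, map_zero, zero_add, zero_add, vacuum_nil]
  | cons i l ih =>
    rw [homotopy_cons, homotopy_cons, vacuum_cons, map_add, koszul_vacuum₁]
    conv_rhs => rw [← σ.koszul_homotopy₁ i z]
    have := congrArg (σ.vacuum₁ i) ih
    rw [map_add, map_add] at this
    rw [← this]
    abel

theorem koszulDeg_zero_homotopy (l : List (Fin n)) (z : A ⊗[k] Ext k n) :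
    koszulDeg k n A 0 (σ.homotopy l z) = 0 := by
  induction l with
  | nil => exact map_zero _
  | cons i l ih =>
    rw [homotopy_cons, map_add, koszulDeg_zero_homotopy₁, koszulDeg_vacuum₁, ih, map_zero, add_zero]

theorem koszulDeg_succ_homotopy (l : List (Fin n)) (q : ℕ) (z : A ⊗[k] Ext k n) :
    koszulDeg k n A (q + 1) (σ.homotopy l z) = σ.homotopy l (koszulDeg k n A q z) := by
  induction l with
  | nil => exact map_zero _
  | cons i l ih =>
    rw [homotopy_cons, homotopy_cons, map_add, koszulDeg_succ_homotopy₁, koszulDeg_vacuum₁, ih]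

/-- The contraction is linear over everything that the substitutions fix: over `1 ⊗ R` when `x'`
replaces `x`, and over `R ⊗ 1` when `x` replaces `x'`. -/
theorem homotopy_smul (l : List (Fin n)) {a : A} (ha : ∀ i, σ.sub i a = a) (z : A ⊗[k] Ext k n) :
    σ.homotopy l (a • z) = a • σ.homotopy l z := by
  induction l with
  | nil => exact (smul_zero _).symm
  | cons i l ih =>
    rw [homotopy_cons, homotopy_cons, homotopy₁_smul σ (ha i), ih, vacuum₁_smul σ (ha i), smul_add]

/-- On the exterior factor the full vacuum projection leaves only degree zero, and on coefficients
it performs all substitutions. -/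
theorem vacuum_finRange (z : A ⊗[k] Ext k n) : σ.vacuum (List.finRange n) z =
    σ.subList (List.finRange n) (koszulAug k A z) ⊗ₜ[k] (1 : Ext k n) := by
  induction z with
  | zero => simp
  | add u v hu hv => rw [map_add, hu, hv, map_add, map_add, add_tmul]
  | tmul f x =>
    rw [vacuum_tmul, Ext.vacuum_finRange, koszulAug_tmul, Algebra.algebraMap_eq_smul_one,
      ← smul_tmul, map_smul]

end Substitution

theorem koszulAug_eq_zero {z : A ⊗[k] Ext k n} (h : koszulDeg k n A 0 z = 0) :
    koszulAug k A z = 0 := by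
  have := congrArg (koszulAug k A) (koszulDeg_zero_eq z)
  rwa [h, map_zero, koszulAug_tmul, map_one, one_smul, eq_comm] at this

end KoszulContraction

section Unit

variable {k : Type u} [CommRing k] {n : ℕ}

/-- The augmentation `π : Δ_W → R`. -/
def unitDiag (W : Poly k n) : Mor (unit W) (diag k W) where
  lin :=
    { toFun := fun z => DiagMod.of k (Poly k n) (unitProj W z)
      map_add' := fun x y => map_add (unitProj W) x y
      map_smul' := fun e x => unitProj_smul W e x }
  isEven z := unitProj_even W z
  comm z := (unitProj_d W z).symm

theorem subst_diffVar (i j : Fin n) :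
    subst k {i} (diffVar k j) = if j = i then 0 else diffVar k j := by
  rw [diffVar, map_sub, subst_left, subst_right]
  simp only [Finset.mem_singleton]
  split_ifs <;> simp

/-- The substitution of `x'` for `x`. -/
def substRight (k : Type u) [CommRing k] (n : ℕ) : Substitution k (diffVar k (n := n)) where
  sub i := subst k {i}
  regular := isRegular_diffVar
  dvd := diffVar_dvd
  sub_y := subst_diffVar

theorem comm_diffVar (i : Fin n) :
    Algebra.TensorProduct.comm k (Poly k n) (Poly k n) (diffVar k i) = -diffVar k i := by
  rw [diffVar, map_sub, Algebra.TensorProduct.comm_tmul, Algebra.TensorProduct.comm_tmul, neg_sub]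

theorem comm_comm (f : Env k n) : Algebra.TensorProduct.comm k (Poly k n) (Poly k n)
    (Algebra.TensorProduct.comm k (Poly k n) (Poly k n) f) = f :=
  (Algebra.TensorProduct.comm k (Poly k n) (Poly k n)).symm_apply_apply f

theorem lmul'_comm (f : Env k n) : Algebra.TensorProduct.lmul' k (S := Poly k n)
    (Algebra.TensorProduct.comm k (Poly k n) (Poly k n) f) =
      Algebra.TensorProduct.lmul' k (S := Poly k n) f := by
  induction f using TensorProduct.induction_on with
  | zero => simp
  | add x y hx hy => rw [map_add, map_add, hx, hy, map_add]
  | tmul a b => simp [mul_comm]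

theorem dvd_of_eq_neg {A : Type*} [CommRing A] {a b c : A} (h : a = -b) (h' : a ∣ c) : b ∣ c := by
  rwa [h, neg_dvd] at h'

/-- The substitution of `x` for `x'`. -/
def substLeft (k : Type u) [CommRing k] (n : ℕ) : Substitution k (diffVar k (n := n)) where
  sub i := ((Algebra.TensorProduct.comm k (Poly k n) (Poly k n)).toAlgHom.comp (subst k {i})).comp
    (Algebra.TensorProduct.comm k (Poly k n) (Poly k n)).toAlgHom
  regular := isRegular_diffVar
  -- Exchanging `x` and `x'` sends `x_i - x_i'` to its negative, so divisibility is transported from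
  -- the opposite substitution.
  dvd i f := by
    have h := map_dvd (Algebra.TensorProduct.comm k (Poly k n) (Poly k n))
      (diffVar_dvd i (Algebra.TensorProduct.comm k (Poly k n) (Poly k n) f))
    rw [map_sub, comm_comm] at h
    exact dvd_of_eq_neg (comm_diffVar i) h
  sub_y i j := by
    change Algebra.TensorProduct.comm k (Poly k n) (Poly k n) (subst k {i}
      (Algebra.TensorProduct.comm k (Poly k n) (Poly k n) (diffVar k j))) = _
    rw [comm_diffVar, map_neg, subst_diffVar]
    split_ifs
    · rw [neg_zero, map_zero]
    · rw [map_neg, comm_diffVar, neg_neg]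

/-- After `x'` has replaced every `x`, both tensor factors are written in the same variables, so
they multiply together in the right-hand factor. -/
theorem subst_univ_apply (f : Env k n) :
    subst k Finset.univ f = 1 ⊗ₜ[k] Algebra.TensorProduct.lmul' k (S := Poly k n) f := by
  induction f using TensorProduct.induction_on with
  | zero => simp
  | add x y hx hy => rw [map_add, hx, hy, map_add, tmul_add]
  | tmul a b =>
    have : a ⊗ₜ[k] b = (a ⊗ₜ[k] (1 : Poly k n)) * ((1 : Poly k n) ⊗ₜ[k] b) := by
      rw [Algebra.TensorProduct.tmul_mul_tmul, mul_one, one_mul]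
    rw [Algebra.TensorProduct.lmul'_apply_tmul, this, map_mul, subst_univ, subst_right,
      Algebra.TensorProduct.tmul_mul_tmul, one_mul]

theorem substRight_subList (l : List (Fin n)) (f : Env k n) :
    (substRight k n).subList l f = subst k l.toFinset f := by
  induction l with
  | nil => exact (subst_empty f).symm
  | cons i l ih =>
    refine (congrArg (subst k {i}) ih).trans ?_
    rw [subst_subst, List.toFinset_cons]
    rfl

theorem substRight_subList_finRange (f : Env k n) : (substRight k n).subList (List.finRange n) f =
    1 ⊗ₜ[k] Algebra.TensorProduct.lmul' k (S := Poly k n) f := by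
  have : (List.finRange n).toFinset = Finset.univ := by ext; simp
  rw [substRight_subList, this, subst_univ_apply]

theorem substLeft_subList (l : List (Fin n)) (f : Env k n) : (substLeft k n).subList l f =
    Algebra.TensorProduct.comm k (Poly k n) (Poly k n) ((substRight k n).subList l
      (Algebra.TensorProduct.comm k (Poly k n) (Poly k n) f)) := by
  induction l with
  | nil => exact (comm_comm f).symm
  | cons i l ih =>
    refine (congrArg ((substLeft k n).sub i) ih).trans ?_
    exact congrArg (fun g => Algebra.TensorProduct.comm k (Poly k n) (Poly k n) (subst k {i} g))
      (comm_comm _)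

theorem substLeft_subList_finRange (f : Env k n) : (substLeft k n).subList (List.finRange n) f =
    Algebra.TensorProduct.lmul' k (S := Poly k n) f ⊗ₜ[k] 1 := by
  rw [substLeft_subList, substRight_subList_finRange, lmul'_comm, Algebra.TensorProduct.comm_tmul]

end Unit

end LandauGinzburg

end

/-! ### The unit actions are homotopy equivalences. -/

noncomputable section

namespace LandauGinzburg

open LinFact BiFact BiTensor

section Unit

variable {k : Type u} [CommRing k] {n : ℕ}

theorem algHom_lmul'_smul_tmul_one (ι : Poly k n →ₐ[k] Env k n) (c : k) (r : Poly k n) :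
    ι (Algebra.TensorProduct.lmul' k (S := Poly k n) (algebraMap k (Env k n) c) * r) ⊗ₜ[k]
      (1 : Ext k n) = algebraMap k (Env k n) c • (ι r ⊗ₜ[k] (1 : Ext k n)) := by
  rw [AlgHom.commutes, map_mul, AlgHom.commutes]
  rfl

theorem multProj_tmul_one (e : Env k n) : multProj k n (e ⊗ₜ[k] (1 : Ext k n)) =
    Algebra.TensorProduct.lmul' k (S := Poly k n) e := by
  rw [multProj_tmul, map_one, one_smul]

theorem multProj_eq_zero {z : Env k n ⊗[k] Ext k n} (h : koszulDeg k n (Env k n) 0 z = 0) :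
    multProj k n z = 0 := by
  rw [multProj_apply, koszulAug_eq_zero h, map_zero]

theorem koszul_homotopy_finRange (σ : Substitution k (diffVar k (n := n)))
    (ι : Poly k n →ₐ[k] Env k n) (hσ : ∀ f, σ.subList (List.finRange n) f =
      ι (Algebra.TensorProduct.lmul' k (S := Poly k n) f)) (z : Env k n ⊗[k] Ext k n) :
    koszul k (diffVar k) (σ.homotopy (List.finRange n) z) +
      σ.homotopy (List.finRange n) (koszul k (diffVar k) z) +
      ι (multProj k n z) ⊗ₜ[k] (1 : Ext k n) = z := by
  rw [multProj_apply, ← hσ, ← σ.vacuum_finRange, σ.koszul_homotopy]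

/-- The contraction of `Δ_W → R` determined by a substitution, where `ι` is the section of the
multiplication `Rᵉ → R` given by its composite. -/
def unitContraction (W : Poly k n) (σ : Substitution k (diffVar k (n := n)))
    (ι : Poly k n →ₐ[k] Env k n)
    (hι : ∀ r, Algebra.TensorProduct.lmul' k (S := Poly k n) (ι r) = r)
    (hσ : ∀ f, σ.subList (List.finRange n) f =
      ι (Algebra.TensorProduct.lmul' k (S := Poly k n) f)) : Contraction (unitDiag W) where
  h := (σ.homotopy (List.finRange n)).toAddMonoidHom
  s := AddMonoidHom.mk' (fun r : Poly k n => ι r ⊗ₜ[k] (1 : Ext k n)) fun r s =>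
    (congrArg (· ⊗ₜ[k] (1 : Ext k n)) (map_add ι r s)).trans (add_tmul _ _ _)
  κ := koszul k (diffVar k)
  δ₀ := 0
  -- The terms `∂_[i]W θ_i`, by which `Δ_W` differs from the Koszul resolution of the diagonal, all
  -- raise the degree by one.
  δ₁ := cokoszul k (fun i => diffQuot i (W ⊗ₜ[k] 1))
  D := koszulDeg k n (Env k n)
  N := (Ext.exists_sum_deg k n).choose
  h_scalar c x := σ.homotopy_smul _ (a := algebraMap k (Env k n) c) (fun i => (σ.sub i).commutes c) x
  s_scalar := algHom_lmul'_smul_tmul_one ι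
  d_eq _ := (add_comm (cokoszul k (fun i => diffQuot i (W ⊗ₜ[k] 1)) _)
    (koszul k (diffVar k) _)).trans (congrArg (· + _) (add_zero _).symm)
  κ_odd := koszul_even _
  D_even := koszulDeg_even
  π_s y := (multProj_tmul_one _).trans (hι y)
  π_h _ := multProj_eq_zero (σ.koszulDeg_zero_homotopy _ _)
  homotopy := koszul_homotopy_finRange σ ι hσ
  D_zero_h := σ.koszulDeg_zero_homotopy _
  D_succ_h := σ.koszulDeg_succ_homotopy _
  D_δ₀ _ _ := map_zero _
  D_zero_δ₁ := koszulDeg_zero_cokoszul _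
  D_succ_δ₁ := koszulDeg_succ_cokoszul _
  sum_D := sum_koszulDeg (Ext.exists_sum_deg k n).choose_spec

theorem algHom_mul_tmul_one (ι : Poly k n →ₐ[k] Env k n) {e : Env k n}
    (he : ι (Algebra.TensorProduct.lmul' k (S := Poly k n) e) = e) (r : Poly k n) :
    ι (Algebra.TensorProduct.lmul' k (S := Poly k n) e * r) ⊗ₜ[k]
      (1 : Ext k n) = e • (ι r ⊗ₜ[k] (1 : Ext k n)) := by
  rw [map_mul, he]
  rfl

theorem unitContraction_s_smul (W : Poly k n) (σ : Substitution k (diffVar k (n := n)))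
    (ι : Poly k n →ₐ[k] Env k n) (hι hσ) {e : Env k n}
    (he : ι (Algebra.TensorProduct.lmul' k (S := Poly k n) e) = e) (x : (diag k W).carrier) :
    (unitContraction W σ ι hι hσ).s (e • x) = e • (unitContraction W σ ι hι hσ).s x :=
  algHom_mul_tmul_one ι he x

/-- A right linear contraction of `Δ_W → R`. -/
def unitContractionRight (W : Poly k n) : Contraction (unitDiag W) :=
  unitContraction W (substRight k n) Algebra.TensorProduct.includeRight
    (fun r => by rw [Algebra.TensorProduct.includeRight_apply,
      Algebra.TensorProduct.lmul'_apply_tmul, one_mul])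
    substRight_subList_finRange

/-- Elements `1 ⊗ r` involve only `x'`, hence are fixed by the substitutions of `x'` for `x` and by
the section `r ↦ 1 ⊗ r` after multiplication. -/
theorem unitContractionRight_rightLin (W : Poly k n) : (unitContractionRight W).RightLin :=
  ⟨fun r x => (substRight k n).homotopy_smul _ (a := (1 : Poly k n) ⊗ₜ[k] r)
      (fun i => subst_right {i} r) x,
    fun r => unitContraction_s_smul W _ _ _ _ (e := (1 : Poly k n) ⊗ₜ[k] r) (by
        rw [Algebra.TensorProduct.lmul'_apply_tmul, one_mul,
          Algebra.TensorProduct.includeRight_apply])⟩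

/-- A left linear contraction of `Δ_W → R`. -/
def unitContractionLeft (W : Poly k n) : Contraction (unitDiag W) :=
  unitContraction W (substLeft k n) Algebra.TensorProduct.includeLeft
    (fun r => by rw [Algebra.TensorProduct.includeLeft_apply,
      Algebra.TensorProduct.lmul'_apply_tmul, mul_one])
    substLeft_subList_finRange

theorem substLeft_left (i : Fin n) (r : Poly k n) :
    (substLeft k n).sub i (r ⊗ₜ[k] 1) = r ⊗ₜ[k] 1 := by
  change Algebra.TensorProduct.comm k (Poly k n) (Poly k n) (subst k {i}
    (Algebra.TensorProduct.comm k (Poly k n) (Poly k n) (r ⊗ₜ[k] 1))) = _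
  rw [Algebra.TensorProduct.comm_tmul, subst_right, Algebra.TensorProduct.comm_tmul]

/-- Elements `r ⊗ 1` involve only `x` and are fixed by the substitutions of `x` for `x'`. -/
theorem unitContractionLeft_leftLin (W : Poly k n) : (unitContractionLeft W).LeftLin :=
  ⟨fun r x => (substLeft k n).homotopy_smul _ (a := r ⊗ₜ[k] (1 : Poly k n))
      (fun i => substLeft_left i r) x,
    fun r => unitContraction_s_smul W _ _ _ _ (e := r ⊗ₜ[k] (1 : Poly k n)) (by
        rw [Algebra.TensorProduct.lmul'_apply_tmul, mul_one,
          Algebra.TensorProduct.includeLeft_apply])⟩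

end Unit

section DiagTensor

variable {k S R : Type u} [CommRing k] [CommRing S] [CommRing R] [Algebra k S] [Algebra k R]
  {V : S} {W : R}

/-- The map `r ⊗ x ↦ r x` on `S ⊗_S X`. -/
def diagTensorLin (X : Type u) [AddCommGroup X] [Module (S ⊗[k] R) X] :
    BiTensor k S S R (DiagMod k S S) X →ₗ[S ⊗[k] R] X :=
  liftLin (fun r x => ((DiagMod.of k S).symm r ⊗ₜ[k] (1 : R)) • x)
    (fun r r' x => by rw [map_add, add_tmul, add_smul])
    (fun r x x' => smul_add _ _ _)
    (fun s r x => by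
      obtain ⟨r, rfl⟩ := (DiagMod.of k S).surjective r
      rw [DiagMod.tmul_smul_of, AddEquiv.symm_apply_apply, AddEquiv.symm_apply_apply, smul_smul,
        Algebra.TensorProduct.tmul_mul_tmul, one_mul, one_mul, smul_eq_mul, mul_comm])
    (fun s t r x => by
      obtain ⟨r, rfl⟩ := (DiagMod.of k S).surjective r
      rw [DiagMod.tmul_smul_of, AddEquiv.symm_apply_apply, AddEquiv.symm_apply_apply, smul_smul,
        smul_smul, Algebra.TensorProduct.tmul_mul_tmul, Algebra.TensorProduct.tmul_mul_tmul, mul_one,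
        mul_one, one_mul, mul_one, smul_eq_mul])

theorem diagTensorLin_mk {X : Type u} [AddCommGroup X] [Module (S ⊗[k] R) X] (r : S) (x : X) :
    diagTensorLin X (BiTensor.mk k S S R (DiagMod.of k S r) x) = (r ⊗ₜ[k] (1 : R)) • x := rfl

theorem mk_one_diagTensorLin {X : Type u} [AddCommGroup X] [Module (S ⊗[k] R) X] :
    ∀ z, BiTensor.mk k S S R (DiagMod.of k S (1 : S)) (diagTensorLin X z) = z :=
  BiTensor.ext_apply (fun x y => by rw [map_add, mk_add]) (fun _ _ => rfl) fun r x => by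
    obtain ⟨r, rfl⟩ := (DiagMod.of k S).surjective r
    rw [diagTensorLin_mk, ← mk_balanced, DiagMod.tmul_smul_of, one_mul, smul_eq_mul, mul_one]

theorem diagTensorLin_mk_one {X : Type u} [AddCommGroup X] [Module (S ⊗[k] R) X] (x : X) :
    diagTensorLin X (BiTensor.mk k S S R (DiagMod.of k S (1 : S)) x) = x := by
  rw [diagTensorLin_mk, ← Algebra.TensorProduct.one_def, one_smul]

/-- The map `x ⊗ r ↦ x r` on `X ⊗_R R`. -/
def tensorDiagLin (X : Type u) [AddCommGroup X] [Module (S ⊗[k] R) X] :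
    BiTensor k S R R X (DiagMod k R R) →ₗ[S ⊗[k] R] X :=
  liftLin (fun x r => ((1 : S) ⊗ₜ[k] (DiagMod.of k R).symm r) • x)
    (fun r x x' => smul_add _ _ _)
    (fun r r' x => by rw [map_add, tmul_add, add_smul])
    (fun s x r => by
      obtain ⟨r, rfl⟩ := (DiagMod.of k R).surjective r
      rw [DiagMod.tmul_smul_of, AddEquiv.symm_apply_apply, AddEquiv.symm_apply_apply, smul_smul,
        Algebra.TensorProduct.tmul_mul_tmul, one_mul, mul_one, smul_eq_mul, mul_comm])
    (fun s t x r => by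
      obtain ⟨r, rfl⟩ := (DiagMod.of k R).surjective r
      rw [DiagMod.tmul_smul_of, AddEquiv.symm_apply_apply, AddEquiv.symm_apply_apply, smul_smul,
        smul_smul, Algebra.TensorProduct.tmul_mul_tmul, Algebra.TensorProduct.tmul_mul_tmul, mul_one,
        mul_one, one_mul, one_mul, smul_eq_mul])

theorem tensorDiagLin_mk {X : Type u} [AddCommGroup X] [Module (S ⊗[k] R) X] (r : R) (x : X) :
    tensorDiagLin X (BiTensor.mk k S R R x (DiagMod.of k R r)) = ((1 : S) ⊗ₜ[k] r) • x := rfl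

theorem mk_tensorDiagLin_one {X : Type u} [AddCommGroup X] [Module (S ⊗[k] R) X] :
    ∀ z, BiTensor.mk k S R R (tensorDiagLin X z) (DiagMod.of k R (1 : R)) = z :=
  BiTensor.ext_apply (fun x y => by rw [map_add, add_mk]) (fun _ _ => rfl) fun x r => by
    obtain ⟨r, rfl⟩ := (DiagMod.of k R).surjective r
    rw [tensorDiagLin_mk, mk_balanced, DiagMod.tmul_smul_of, mul_one, smul_eq_mul, mul_one]

theorem tensorDiagLin_mk_one {X : Type u} [AddCommGroup X] [Module (S ⊗[k] R) X] (x : X) :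
    tensorDiagLin X (BiTensor.mk k S R R x (DiagMod.of k R (1 : R))) = x := by
  rw [tensorDiagLin_mk, ← Algebra.TensorProduct.one_def, one_smul]

variable (V) in
theorem diag_odd (x : (diag k V).carrier) : (diag k V).odd x = 0 := sub_self _

variable (V) in
theorem diag_sgn (x : (diag k V).carrier) : (diag k V).sgn x = x := by
  rw [sgn_apply, diag_odd]
  exact sub_zero _

/-- The isomorphism `S ⊗_S X → X`. -/
def diagTensor (X : BiFact k S R V W) : tensor (diag k V) X ≅ X :=
  isoOfEquiv
    { lin := diagTensorLin X.carrier
      isEven := tensor_ext _ _ (fun x y => by rw [map_add, map_add])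
        (fun x y => by rw [map_add, map_add]) fun r x => by
          rw [tensor_even_mk, diag_odd, zero_mk, add_zero]
          exact (X.even.map_smul _ _).symm
      comm := tensor_ext _ _ (fun x y => by rw [map_add, map_add])
        (fun x y => by rw [map_add, map_add]) fun r x => by
          rw [tensor_d_mk, diag_sgn]
          refine (X.d.map_smul _ _).trans ?_
          refine Eq.symm ((map_add (diagTensorLin X.carrier) _ _).trans ?_)
          refine (congrArg (· + _) ?_).trans (zero_add _)
          exact (congrArg (diagTensorLin X.carrier) (zero_mk _)).trans (map_zero _) }
    (fun x => BiTensor.mk k S S R (DiagMod.of k S (1 : S)) x) mk_one_diagTensorLin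
    diagTensorLin_mk_one

/-- The isomorphism `X ⊗_R R → X`. -/
def tensorDiag (X : BiFact k S R V W) : tensor X (diag k W) ≅ X :=
  isoOfEquiv
    { lin := tensorDiagLin X.carrier
      isEven := tensor_ext _ _ (fun x y => by rw [map_add, map_add])
        (fun x y => by rw [map_add, map_add]) fun x r => by
          rw [tensor_even_mk, diag_odd, mk_zero, add_zero]
          exact (X.even.map_smul _ _).symm
      comm := tensor_ext _ _ (fun x y => by rw [map_add, map_add])
        (fun x y => by rw [map_add, map_add]) fun x r => by
          rw [tensor_d_mk]
          refine (X.d.map_smul _ _).trans ?_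
          refine Eq.symm ((map_add (tensorDiagLin X.carrier) _ _).trans ?_)
          refine (congrArg (_ + ·) ?_).trans (add_zero _)
          exact (congrArg (tensorDiagLin X.carrier) (mk_zero _)).trans (map_zero _) }
    (fun x => BiTensor.mk k S R R x (DiagMod.of k R (1 : R))) mk_tensorDiagLin_one
    tensorDiagLin_mk_one

end DiagTensor

section Unitors

variable {k : Type u} [CommRing k] {m n : ℕ} {V : Poly k m} {W : Poly k n}

/-- `λ_X` factors as `π ⊗ 1 : Δ ⊗ X → S ⊗_S X` followed by the isomorphism with `X`. The left linear
contraction of `π` becomes right linear as well on tensoring with the free `X`. -/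
theorem leftUnitMor_isIso (X : BiFact k (Poly k m) (Poly k n) V W) (hX : X.IsMF) :
    IsIso (leftUnitMor X).cls := by
  have : Module.Free _ X.carrier := hX
  let b := Module.Free.chooseBasis (Poly k m ⊗[k] Poly k n) X.carrier
  have h := ((unitContractionLeft V).tensorRight X b).isIso
    ((unitContractionLeft V).tensorRight_leftLin X b (unitContractionLeft_leftLin V))
    ((unitContractionLeft V).tensorRight_rightLin X b)
  have e : (leftUnitMor X).cls = (tensorMor (unitDiag V) (Mor.id X)).cls ≫ (diagTensor X).hom :=
    Mor.cls_eq (tensor_ext _ _ (fun _ _ => map_add _ _ _) (fun _ _ => map_add _ _ _) fun _ _ => rfl)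
  rw [e]
  infer_instance

/-- Here `X` stands on the left and supplies left linearity, so the right linear contraction of `π`
is the one to use. -/
theorem rightUnitMor_isIso (X : BiFact k (Poly k m) (Poly k n) V W) (hX : X.IsMF) :
    IsIso (rightUnitMor X).cls := by
  have : Module.Free _ X.carrier := hX
  let b := Module.Free.chooseBasis (Poly k m ⊗[k] Poly k n) X.carrier
  have h := ((unitContractionRight W).tensorLeft X b).isIso
    ((unitContractionRight W).tensorLeft_leftLin X b)
    ((unitContractionRight W).tensorLeft_rightLin X b (unitContractionRight_rightLin W))
  have e : (rightUnitMor X).cls = (tensorMor (Mor.id X) (unitDiag W)).cls ≫ (tensorDiag X).hom :=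
    Mor.cls_eq (tensor_ext _ _ (fun _ _ => map_add _ _ _) (fun _ _ => map_add _ _ _) fun _ _ => rfl)
  rw [e]
  infer_instance

theorem LG.unitorsInvertible (k : Type u) [CommRing k] : LG.UnitorsInvertible k := fun _ _ X =>
  ⟨leftUnitMor_isIso X.fact X.isSummandMF.1, rightUnitMor_isIso X.fact X.isSummandMF.1⟩

end Unitors

end LandauGinzburg

end

/-! ### The shadow axioms for the graded swap. -/

noncomputable section

namespace LandauGinzburg

open LinFact BiFact BiTensor

section Shadow

variable {k R S T : Type u} [CommRing k] [CommRing R] [CommRing S] [CommRing T] [Algebra k R]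
  [Algebra k S] [Algebra k T] {W : R} {V : S} {U : T}

theorem trace_ext {P : Type u} [AddCommGroup P] (Y : BiFact k S R V W) (X : BiFact k R S W V)
    {f g : (trace (tensor Y X)).carrier → P} (hf : ∀ x y, f (x + y) = f x + f y)
    (hg : ∀ x y, g (x + y) = g x + g y)
    (h : ∀ y x, f (TraceMod.mk k S (BiTensor.mk k S R S y x) 1) =
      g (TraceMod.mk k S (BiTensor.mk k S R S y x) 1)) (t) : f t = g t :=
  TraceMod.ext_apply hf hg (tensor_ext Y X (fun x y => by rw [TraceMod.add_mk, hf])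
    (fun x y => by rw [TraceMod.add_mk, hg]) h) t

theorem swap_swap (Y : BiFact k S R V W) (X : BiFact k R S W V) :
    (swap Y X).cls ≫ (swap X Y).cls = 𝟙 (trace (tensor Y X)) :=
  Mor.cls_eq (trace_ext _ _ (fun _ _ => map_add _ _ _) (fun _ _ => map_add _ _ _) fun y x => by
    change (swap X Y).lin ((swap Y X).lin (TraceMod.mk k S (BiTensor.mk k S R S y x) 1)) =
      TraceMod.mk k S (BiTensor.mk k S R S y x) 1
    rw [swap_mk, TraceMod.add_mk, map_add, swap_mk, swap_mk]
    simp only [odd_apply, sgn_apply, map_sub, even_even, sub_mk, mk_sub, TraceMod.add_mk,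
      TraceMod.sub_mk]
    abel)

/-- The graded swap as an isomorphism. -/
def swapIso (Y : BiFact k S R V W) (X : BiFact k R S W V) :
    trace (tensor Y X) ≅ trace (tensor X Y) where
  hom := (swap Y X).cls
  inv := (swap X Y).cls
  hom_inv_id := swap_swap Y X
  inv_hom_id := swap_swap X Y

theorem swapCohomology_isIso (Y : BiFact k S R V W) (X : BiFact k R S W V) :
    IsIso (swapCohomology Y X) :=
  ((cohomologyFunctor k).mapIso (swapIso Y X)).isIso_hom

theorem swap_naturality {Y Y' : BiFact k S R V W} {X X' : BiFact k R S W V} (μ : Y ⟶ Y')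
    (η : X ⟶ X') : (traceFunctor k S V).map (tensorHom μ η) ≫ (swap Y' X').cls =
      (swap Y X).cls ≫ (traceFunctor k R W).map (tensorHom η μ) := by
  obtain ⟨μ, rfl⟩ := cls_surj μ
  obtain ⟨η, rfl⟩ := cls_surj η
  refine Mor.cls_eq (trace_ext _ _ (fun _ _ => map_add _ _ _) (fun _ _ => map_add _ _ _)
    fun y x => ?_)
  change (swap Y' X').lin (TraceMod.mk k S (BiTensor.mk k S R S (μ.lin y) (η.lin x)) 1) =
    TraceMod.map (BiTensor.map η.lin μ.lin) ((swap Y X).lin _)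
  rw [swap_mk, swap_mk, TraceMod.map_mk, map_add, map_mk, map_mk]
  simp only [odd_apply, sgn_apply, map_sub, μ.isEven y, η.isEven x]

/-- On homogeneous elements, moving `z` past `y ⊗ x` and then `y` past `x ⊗ z` produces the sign
`|z||y|` twice. What remains is `|x|(|y| + |z|)`, the sign of moving `x` past `z ⊗ y` in one step.
-/
theorem swap_hexagon (Z : BiFact k R T W U) (Y : BiFact k T S U V) (X : BiFact k S R V W) :
    (swap (tensor Z Y) X).cls ≫ (traceFunctor k S V).map (assoc X Z Y).inv =
      (traceFunctor k R W).map (assoc Z Y X).hom ≫ (swap Z (tensor Y X)).cls ≫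
        (traceFunctor k T U).map (assoc Y X Z).hom ≫ (swap Y (tensor X Z)).cls := by
  refine Mor.cls_eq (TraceMod.ext_apply (fun _ _ => map_add _ _ _) (fun _ _ => map_add _ _ _)
    (tensor_ext₃ Z Y X (fun _ _ => by rw [TraceMod.add_mk, map_add])
      (fun _ _ => by rw [TraceMod.add_mk, map_add]) fun z y x => ?_))
  change TraceMod.map (assocInvLin (k := k)) ((swap (tensor Z Y) X).lin _) =
    (swap Y (tensor X Z)).lin (TraceMod.map assocLin ((swap Z (tensor Y X)).lin
      (TraceMod.mk k R (BiTensor.mk k R T R z (BiTensor.mk k T S R y x)) 1)))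
  have hs : ∀ y x z, (swap Y (tensor X Z)).lin
      (TraceMod.mk k T (BiTensor.mk k T S T y (BiTensor.mk k S R T x z)) 1) =
      TraceMod.mk k S (BiTensor.mk k S T S (BiTensor.mk k S R T x z) (Y.even y) +
        BiTensor.mk k S T S ((tensor X Z).sgn (BiTensor.mk k S R T x z)) (Y.odd y)) 1 :=
    fun y x z => swap_mk Y (tensor X Z) y _
  rw [swap_mk, swap_mk]
  simp only [odd, sgn, LinearMap.sub_apply, LinearMap.add_apply, LinearMap.id_apply,
    TraceMod.map_mk, map_add, map_sub, map_mk, even_even, sub_mk, mk_sub, add_mk, mk_add,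
    TraceMod.add_mk, TraceMod.sub_mk, assocLin_mk, assocInvLin_mk, hs]
  abel

end Shadow

section Unit

variable {k : Type u} [CommRing k] {n : ℕ} {W : Poly k n}

/-- Tensoring with `R` over its enveloping algebra identifies the two actions of `R`. -/
theorem trace_smul (Z : Type u) [AddCommGroup Z] [Module (Poly k n ⊗[k] Poly k n) Z] (r : Poly k n)
    (z : Z) : TraceMod.mk k (Poly k n) ((r ⊗ₜ[k] (1 : Poly k n)) • z) 1 =
      TraceMod.mk k (Poly k n) (((1 : Poly k n) ⊗ₜ[k] r) • z) 1 := by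
  rw [TraceMod.balanced, TraceMod.balanced, Algebra.TensorProduct.lmul'_apply_tmul,
    Algebra.TensorProduct.lmul'_apply_tmul, one_mul, mul_one]

/-- The sign can be `-1` only for odd `δ`, where `π` vanishes. So `x ⊗ δ` goes to `π(δ)` acting on
`x` from the left, which the trace identifies with the action from the right. -/
theorem swap_leftUnit (X : BiFact k (Poly k n) (Poly k n) W W) :
    (swap X (unit W)).cls ≫ (traceFunctor k (Poly k n) W).map (leftUnitMor X).cls =
      (traceFunctor k (Poly k n) W).map (rightUnitMor X).cls := by
  refine Mor.cls_eq (trace_ext _ _ (fun _ _ => map_add _ _ _) (fun _ _ => map_add _ _ _)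
    fun x δ => ?_)
  change TraceMod.map (leftUnitLin X) ((swap X (unit W)).lin _) =
    TraceMod.mk k (Poly k n) (((1 : Poly k n) ⊗ₜ[k] unitProj W δ) • x) 1
  rw [swap_mk, TraceMod.map_mk, map_add, leftUnitLin_mk, leftUnitLin_mk, unitProj_sgn, ← smul_add,
    odd_apply, add_sub_cancel, trace_smul]

/-- The signed term of the swap contains the odd part of `δ`, which `π` kills; the two actions of
`R` then agree in the trace. -/
theorem swap_rightUnit (X : BiFact k (Poly k n) (Poly k n) W W) :
    (swap (unit W) X).cls ≫ (traceFunctor k (Poly k n) W).map (rightUnitMor X).cls =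
      (traceFunctor k (Poly k n) W).map (leftUnitMor X).cls := by
  refine Mor.cls_eq (trace_ext _ _ (fun _ _ => map_add _ _ _) (fun _ _ => map_add _ _ _)
    fun δ x => ?_)
  change TraceMod.map (rightUnitLin X) ((swap (unit W) X).lin _) =
    TraceMod.mk k (Poly k n) ((unitProj W δ ⊗ₜ[k] (1 : Poly k n)) • x) 1
  rw [swap_mk, TraceMod.map_mk, map_add, rightUnitLin_mk, rightUnitLin_mk, unitProj_even,
    unitProj_odd, tmul_zero_smul, add_zero, trace_smul]

end Unit

section Cohomology

variable {k R S T : Type u} [CommRing k] [CommRing R] [CommRing S] [CommRing T] [Algebra k R]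
  [Algebra k S] [Algebra k T] {W : R} {V : S} {U : T}

/-- The two whiskerings on either side combine into `μ ⊗ η` and `η ⊗ μ`, so this is the image of
`swap_naturality` under cohomology. -/
theorem swapCohomology_naturality {Y Y' : BiFact k S R V W} {X X' : BiFact k R S W V} (μ : Y ⟶ Y')
    (η : X ⟶ X') : ((cohomologyFunctor k).map ((traceFunctor k S V).map (tensorHom (𝟙 Y) η)) ≫
        (cohomologyFunctor k).map ((traceFunctor k S V).map (tensorHom μ (𝟙 X')))) ≫
          swapCohomology Y' X' =
      CategoryStruct.comp (X := (cohomologyFunctor k).obj ((traceFunctor k S V).obj (tensor Y X)))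
        (Y := (cohomologyFunctor k).obj ((traceFunctor k R W).obj (tensor X Y))) (swapCohomology Y X)
        ((cohomologyFunctor k).map ((traceFunctor k R W).map (tensorHom (𝟙 X) μ)) ≫
          (cohomologyFunctor k).map ((traceFunctor k R W).map (tensorHom η (𝟙 Y')))) := by
  have h1 : tensorHom (𝟙 Y) η ≫ tensorHom μ (𝟙 X') = tensorHom μ η := by
    rw [← tensorHom_comp, Category.id_comp, Category.comp_id]
  have h2 : tensorHom (𝟙 X) μ ≫ tensorHom η (𝟙 Y') = tensorHom η μ := by
    rw [← tensorHom_comp, Category.id_comp, Category.comp_id]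
  have e1 := (traceFunctor k S V ⋙ cohomologyFunctor k).map_comp (tensorHom (𝟙 Y) η)
    (tensorHom μ (𝟙 X'))
  have e2 := (traceFunctor k R W ⋙ cohomologyFunctor k).map_comp (tensorHom (𝟙 X) μ)
    (tensorHom η (𝟙 Y'))
  rw [h1] at e1
  rw [h2] at e2
  refine (congrArg (· ≫ swapCohomology Y' X') e1.symm).trans ?_
  refine Eq.trans ?_ (congrArg (swapCohomology Y X ≫ ·) e2)
  exact ((cohomologyFunctor k).map_comp _ _).symm.trans
    ((congrArg (cohomologyFunctor k).map (swap_naturality μ η)).trans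
      ((cohomologyFunctor k).map_comp _ _))

theorem swapCohomology_hexagon (Z : BiFact k R T W U) (Y : BiFact k T S U V)
    (X : BiFact k S R V W) : swapCohomology (tensor Z Y) X ≫
        (cohomologyFunctor k).map ((traceFunctor k S V).map (assoc X Z Y).inv) =
      (cohomologyFunctor k).map ((traceFunctor k R W).map (assoc Z Y X).hom) ≫
        swapCohomology Z (tensor Y X) ≫
        (cohomologyFunctor k).map ((traceFunctor k T U).map (assoc Y X Z).hom) ≫
        swapCohomology Y (tensor X Z) := by
  refine ((cohomologyFunctor k).map_comp _ _).symm.trans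
    ((congrArg (cohomologyFunctor k).map (swap_hexagon Z Y X)).trans
      (((cohomologyFunctor k).map_comp _ _).trans (congrArg (_ ≫ ·) ?_)))
  exact ((cohomologyFunctor k).map_comp _ _).trans
    (congrArg (_ ≫ ·) ((cohomologyFunctor k).map_comp _ _))

theorem swapCohomology_leftUnit {n : ℕ} {W : Poly k n} (X : BiFact k (Poly k n) (Poly k n) W W) :
    swapCohomology X (unit W) ≫
        (cohomologyFunctor k).map ((traceFunctor k (Poly k n) W).map (leftUnitMor X).cls) =
      (cohomologyFunctor k).map ((traceFunctor k (Poly k n) W).map (rightUnitMor X).cls) :=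
  ((cohomologyFunctor k).map_comp _ _).symm.trans
    (congrArg (cohomologyFunctor k).map (swap_leftUnit X))

theorem swapCohomology_rightUnit {n : ℕ} {W : Poly k n} (X : BiFact k (Poly k n) (Poly k n) W W) :
    swapCohomology (unit W) X ≫
        (cohomologyFunctor k).map ((traceFunctor k (Poly k n) W).map (rightUnitMor X).cls) =
      (cohomologyFunctor k).map ((traceFunctor k (Poly k n) W).map (leftUnitMor X).cls) :=
  ((cohomologyFunctor k).map_comp _ _).symm.trans
    (congrArg (cohomologyFunctor k).map (swap_rightUnit X))

end Cohomology

open Bicategory in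
set_option maxHeartbeats 1000000 in
-- The axioms unfold to identities between swaps already established. Composition is reversed, `f ≫
-- g` being `g ⊗ f`, so the associator of the bicategory is the inverse of `assoc`, and its left
-- unitor is `ρ`, its right unitor `λ`.
theorem LG.isShadow (k : Type u) [CommRing k] (hc : LG.CompClosed k) (hu : LG.UnitorsInvertible k) :
    letI : Bicategory (LG k) := LG.bicategory hc hu
    IsShadow (B := LG k) (C := GradedObject (ZMod 2) (ModuleCat.{u} k)) (LG.shadow k)
      (fun f g => swapCohomology g.fact f.fact) := by
  let : Bicategory (LG k) := LG.bicategory hc hu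
  refine ⟨fun f g => swapCohomology_isIso g.fact f.fact, ?_, ?_, ?_, ?_⟩
  · intro a b f f' g g' η μ
    rw [Functor.map_comp, Functor.map_comp]
    -- Owing to the reversed composition, whiskering `η` on the right by `g` is `1 ⊗ η`, and
    -- whiskering `μ` on the left by `f'` is `μ ⊗ 1`.
    have e₁ : (LG.shadow k a).map (η ▷ g) ≫ (LG.shadow k a).map (f' ◁ μ) =
      (cohomologyFunctor k).map ((traceFunctor k (Poly k a.n) a.W).map (tensorHom (𝟙 g.fact) η)) ≫
        (cohomologyFunctor k).map
          ((traceFunctor k (Poly k a.n) a.W).map (tensorHom μ (𝟙 f'.fact))) := rfl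
    have e₂ : (LG.shadow k b).map (μ ▷ f) ≫ (LG.shadow k b).map (g' ◁ η) =
      (cohomologyFunctor k).map ((traceFunctor k (Poly k b.n) b.W).map (tensorHom (𝟙 f.fact) μ)) ≫
        (cohomologyFunctor k).map
          ((traceFunctor k (Poly k b.n) b.W).map (tensorHom η (𝟙 g'.fact))) := rfl
    rw [e₁, e₂]
    refine Eq.trans ?_ (Eq.trans (swapCohomology_naturality (Y := g.fact) (Y' := g'.fact)
      (X := f.fact) (X' := f'.fact) μ η) ?_)
    · rfl
    · rfl
  · intro a b c f g h
    exact swapCohomology_hexagon h.fact g.fact f.fact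
  · intro a f
    exact swapCohomology_leftUnit f.fact
  · intro a f
    exact swapCohomology_rightUnit f.fact

end LandauGinzburg

end

/-! ### Contracting the Koszul complex of the partial derivatives onto the Jacobi ring. -/

noncomputable section

namespace LandauGinzburg

open LinFact BiFact BiTensor

section LinearContraction

variable {k K Q : Type*} [CommRing k] [AddCommGroup K] [Module k K] [AddCommGroup Q] [Module k Q]

/-- `κ` is surjective onto its range, so projectivity of the source of `g` provides the lift. -/
theorem exists_lift_of_mem_range [Module.Projective k K] (κ g : K →ₗ[k] K)
    (h : ∀ x, ∃ y, κ y = g x) : ∃ l : K →ₗ[k] K, ∀ x, κ (l x) = g x := by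
  obtain ⟨l, hl⟩ := Module.projective_lifting_property κ.rangeRestrict
    (g.codRestrict (LinearMap.range κ) fun x => h x) κ.surjective_rangeRestrict
  exact ⟨l, fun x => congrArg Subtype.val (LinearMap.congr_fun hl x)⟩

/-- A bounded complex of projective modules which resolves a projective module is contractible
onto it. -/
theorem exists_contraction [Module.Projective k K] [Module.Projective k Q] (κ : K →ₗ[k] K)
    (D : ℕ → K →ₗ[k] K) (π : K →ₗ[k] Q) {N : ℕ} (sum_D : ∀ x, ∑ q ∈ Finset.range N, D q x = x)
    (D_D : ∀ p q x, D p (D q x) = if p = q then D q x else 0) (κ_D_zero : ∀ x, κ (D 0 x) = 0)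
    (κ_D_succ : ∀ q x, κ (D (q + 1) x) = D q (κ x)) (κ_κ : ∀ x, κ (κ x) = 0)
    (π_κ : ∀ x, π (κ x) = 0) (π_D_zero : ∀ x, π (D 0 x) = π x) (π_surj : Function.Surjective π)
    (exact : ∀ z, κ z = 0 → π z = 0 → ∃ y, κ y = z) :
    ∃ (h : K →ₗ[k] K) (s : Q →ₗ[k] K), (∀ y, π (s y) = y) ∧
      (∀ x, κ (h x) + h (κ x) + s (π x) = x) ∧ (∀ x, D 0 (h x) = 0) ∧
      ∀ q x, D (q + 1) (h x) = h (D q x) := by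
  obtain ⟨s₀, hs₀⟩ := Module.projective_lifting_property π LinearMap.id π_surj
  -- Replacing a section by its degree-zero component keeps it a section, as `π` sees only degree
  -- zero, and makes `κ s = 0`.
  obtain ⟨s, hs⟩ : ∃ s : Q →ₗ[k] K, s = D 0 ∘ₗ s₀ := ⟨_, rfl⟩
  have π_D_succ : ∀ q x, π (D (q + 1) x) = 0 := fun q x => by
    rw [← π_D_zero, D_D, if_neg (Nat.succ_ne_zero q).symm, map_zero]
  have π_s : ∀ y, π (s y) = y := fun y => by
    rw [hs, LinearMap.comp_apply, π_D_zero]; exact LinearMap.congr_fun hs₀ y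
  have κ_s : ∀ y, κ (s y) = 0 := fun y => by rw [hs, LinearMap.comp_apply, κ_D_zero]
  have D_s : ∀ p x, D p (s (π (D p x))) = s (π (D p x)) := fun p x => by
    cases p with
    | zero => rw [hs, LinearMap.comp_apply, D_D, if_pos rfl]
    | succ p => rw [π_D_succ, map_zero, map_zero]
  have D_self : ∀ p x, D p (D p x) = D p x := fun p x => by rw [D_D, if_pos rfl]
  -- The contraction is built degree by degree: the homotopy identity is required only in degrees
  -- below `p`.
  have key : ∀ p, ∃ h : K →ₗ[k] K, (∀ x, D 0 (h x) = 0) ∧ (∀ q x, D (q + 1) (h x) = h (D q x)) ∧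
      ∀ q < p, ∀ x, κ (h (D q x)) + h (κ (D q x)) + s (π (D q x)) = D q x := by
    intro p
    induction p with
    | zero => exact ⟨0, fun _ => map_zero _, fun _ _ => map_zero _, fun q hq => absurd hq q.not_lt_zero⟩
    | succ p ih =>
      obtain ⟨h, h0, h1, h2⟩ := ih
      have π_h : ∀ x, π (h x) = 0 := fun x => by rw [← π_D_zero, h0, map_zero]
      -- `g` is the defect of the homotopy identity in degree `p`.
      obtain ⟨g, hg⟩ : ∃ g : K →ₗ[k] K, ∀ x, g x =
          D p x - s (π (D p x)) - h (κ (D p x)) - κ (h (D p x)) :=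
        ⟨(LinearMap.id - s ∘ₗ π - h ∘ₗ κ - κ ∘ₗ h) ∘ₗ D p, fun _ => rfl⟩
      -- For positive `p`, the identity one degree lower, applied to `κ x`, shows that `h` lifts
      -- boundaries coming from degree `p`.
      have κhκ : ∀ x, κ (h (κ (D p x))) = κ (D p x) := fun x => by
        cases p with
        | zero => rw [κ_D_zero, map_zero, map_zero]
        | succ p =>
          have := h2 p (Nat.lt_succ_self p) (κ x)
          rwa [← κ_D_succ, κ_κ, π_κ, map_zero, map_zero, add_zero, add_zero] at this
      -- The defect consists of cycles annihilated by `π`, hence of boundaries by exactness;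
      -- projectivity then gives a linear choice of preimages.
      obtain ⟨l, hl⟩ := exists_lift_of_mem_range κ g fun x => by
        refine exact _ ?_ ?_
        · rw [hg, map_sub, map_sub, map_sub, κ_s, κ_κ, κhκ]; abel
        · rw [hg, map_sub, map_sub, map_sub, π_s, π_h, π_κ]; abel
      have D_g : ∀ x, D p (g x) = g x := fun x => by
        rw [hg, map_sub, map_sub, map_sub, D_self, D_s, ← κ_D_succ, h1, D_self]
        congr 2
        cases p with
        | zero => rw [κ_D_zero, map_zero, map_zero]
        | succ p => rw [h1, ← κ_D_succ, D_self]
      have g_D : ∀ x, g (D p x) = g x := fun x => by rw [hg, hg, D_self]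
      -- The correction sees only degree `p` and lands in degree `p + 1`, so the identities in lower
      -- degrees are unchanged. Truncating `l` is harmless because the defect itself has degree `p`.
      refine ⟨h + D (p + 1) ∘ₗ l ∘ₗ D p, fun x => ?_, fun q x => ?_, fun q hq x => ?_⟩
      · rw [LinearMap.add_apply, map_add, h0, LinearMap.comp_apply, D_D,
          if_neg (Nat.succ_ne_zero p).symm, add_zero]
      · simp only [LinearMap.add_apply, LinearMap.comp_apply, map_add, h1, D_D,
          Nat.add_right_cancel_iff]
        split_ifs with e e' e'
        · rw [e]
        · exact absurd e.symm e'
        · exact absurd e'.symm e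
        · rw [map_zero, map_zero]
      · have e1 : D p (κ (D q x)) = 0 := by
          rw [← κ_D_succ, D_D, if_neg (by omega), map_zero]
        simp only [LinearMap.add_apply, LinearMap.comp_apply, map_add, e1, map_zero, add_zero]
        rcases Nat.lt_succ_iff_lt_or_eq.1 hq with hq | rfl
        · rw [D_D, if_neg (by omega), map_zero, map_zero, map_zero, add_zero, h2 q hq]
        · rw [D_self, κ_D_succ, hl, g_D, D_g, hg]
          abel
  obtain ⟨h, h0, h1, h2⟩ := key N
  refine ⟨h, s, π_s, fun x => ?_, h0, h1⟩
  rw [← sum_D x]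
  simp only [map_sum]
  rw [← Finset.sum_add_distrib, ← Finset.sum_add_distrib]
  exact Finset.sum_congr rfl fun q hq => h2 q (Finset.mem_range.1 hq) x

end LinearContraction

section Jacobi

variable {k : Type u} [CommRing k] {n : ℕ}

/-- The ideal of the partial derivatives. -/
abbrev jacobiIdeal (W : Poly k n) : Ideal (Poly k n) :=
  Ideal.span (Set.range fun i => MvPolynomial.pderiv i W)

/-- The Koszul complex of the partial derivatives, as a diagonal bimodule. -/
abbrev koszulFact (W : Poly k n) : BiFact k (Poly k n) (Poly k n) W W :=
  diagFact k W (M := Poly k n ⊗[k] Ext k n) ((Ext.even k n).baseChange _)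
    (koszul k fun i => MvPolynomial.pderiv i W)
    (fun z => by
      induction z with
      | zero => simp
      | add x y hx hy => simp only [map_add, hx, hy]
      | tmul r x => simp [Ext.even_even])
    (koszul_even _) (koszul_square _)

/-- The Jacobi ring, as a diagonal bimodule. -/
abbrev jacobiFact (W : Poly k n) : BiFact k (Poly k n) (Poly k n) W W :=
  diagFact k W (M := Poly k n ⧸ jacobiIdeal W) LinearMap.id 0 (fun _ => rfl) (fun _ => by simp)
    fun _ => rfl

/-- The projection of the Koszul complex to the Jacobi ring. -/
def jacobiAug (W : Poly k n) : Poly k n ⊗[k] Ext k n →ₗ[Poly k n] Poly k n ⧸ jacobiIdeal W :=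
  (jacobiIdeal W).mkQ ∘ₗ koszulAug k (Poly k n)

theorem koszulAug_even {R : Type u} [CommRing R] [Algebra k R] (z : R ⊗[k] Ext k n) :
    koszulAug k R ((Ext.even k n).baseChange R z) = koszulAug k R z := by
  induction z with
  | zero => simp
  | add x y hx hy => simp only [map_add, hx, hy]
  | tmul r x => rw [LinearMap.baseChange_tmul, koszulAug_tmul, koszulAug_tmul, Ext.aug_even]

theorem jacobiAug_even (W : Poly k n) (z : Poly k n ⊗[k] Ext k n) :
    jacobiAug W ((Ext.even k n).baseChange _ z) = jacobiAug W z :=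
  congrArg (jacobiIdeal W).mkQ (koszulAug_even z)

theorem koszulAug_koszul_mem {R : Type u} [CommRing R] [Algebra k R] (f : Fin n → R)
    (z : R ⊗[k] Ext k n) : koszulAug k R (koszul k f z) ∈ Ideal.span (Set.range f) := by
  induction z with
  | zero => simp
  | add x y hx hy => rw [map_add, map_add]; exact add_mem hx hy
  | tmul r x =>
    rw [koszul_tmul, map_sum]
    refine sum_mem fun i _ => ?_
    rw [koszulAug_tmul, Algebra.smul_def, mul_left_comm]
    exact Ideal.mul_mem_right _ _ (Ideal.subset_span ⟨i, rfl⟩)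

/-- If `r = ∑ c_i f_i`, then `r` is the boundary of `∑ c_i θ_i`. -/
theorem exists_koszulAug_koszul_eq {R : Type u} [CommRing R] [Algebra k R] (f : Fin n → R) {r : R}
    (hr : r ∈ Ideal.span (Set.range f)) : ∃ z : R ⊗[k] Ext k n, koszul k f z = r ⊗ₜ[k] 1 := by
  obtain ⟨c, rfl⟩ := (Ideal.mem_span_range_iff_exists_fun).1 hr
  have h : ∀ i j, Ext.contract k i (Ext.wedge k j (1 : Ext k n)) = if i = j then 1 else 0 :=
    fun i j => by
      have h1 := Ext.contract_wedge i j (1 : Ext k n)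
      have h2 := Ext.contract_algebraMap (n := n) i (1 : k)
      rw [map_one] at h2
      rwa [h2, map_zero, add_zero] at h1
  refine ⟨∑ i, c i ⊗ₜ[k] Ext.wedge k i (1 : Ext k n), ?_⟩
  rw [map_sum, sum_tmul]
  refine Finset.sum_congr rfl fun i _ => ?_
  rw [koszul_tmul, Finset.sum_eq_single i]
  · rw [h, if_pos rfl, mul_comm]
  · intro j _ hj
    rw [h, if_neg hj, tmul_zero]
  · intro hi
    exact absurd (Finset.mem_univ i) hi

theorem jacobiAug_koszul (W : Poly k n) (z : Poly k n ⊗[k] Ext k n) :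
    jacobiAug W (koszul k (fun i => MvPolynomial.pderiv i W) z) = 0 :=
  (Submodule.Quotient.mk_eq_zero _).2 (koszulAug_koszul_mem _ z)

/-- The projection of the Koszul complex to the Jacobi ring, as a morphism. -/
def jacobiMor (W : Poly k n) : Mor (koszulFact W) (jacobiFact W) where
  lin := DiagMod.map (M := Poly k n ⊗[k] Ext k n) (N := Poly k n ⧸ jacobiIdeal W) k (jacobiAug W)
  isEven := jacobiAug_even W
  comm z := Eq.symm (jacobiAug_koszul W z)

theorem koszulAug_koszulDeg_zero {R : Type u} [CommRing R] [Algebra k R] (z : R ⊗[k] Ext k n) :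
    koszulAug k R (koszulDeg k n R 0 z) = koszulAug k R z := by
  rw [koszulDeg_zero_eq, koszulAug_tmul, map_one, one_smul]

theorem jacobiAug_koszulDeg_zero (W : Poly k n) (z : Poly k n ⊗[k] Ext k n) :
    jacobiAug W (koszulDeg k n (Poly k n) 0 z) = jacobiAug W z :=
  congrArg (jacobiIdeal W).mkQ (koszulAug_koszulDeg_zero z)

/-- The exactness condition for potentials requires the degree-zero component to vanish. Here it
only lies in the Jacobi ideal, so it is itself a boundary and can be subtracted first. -/
theorem IsPotential.exists_koszul_eq {W : Poly k n} (hW : IsPotential k W)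
    (z : Poly k n ⊗[k] Ext k n) (h : koszul k (fun i => MvPolynomial.pderiv i W) z = 0)
    (h' : jacobiAug W z = 0) : ∃ y, koszul k (fun i => MvPolynomial.pderiv i W) y = z := by
  obtain ⟨y, hy⟩ := exists_koszulAug_koszul_eq (k := k) _ ((Submodule.Quotient.mk_eq_zero _).1 h')
  obtain ⟨y', hy'⟩ := hW.exact (z - koszulAug k (Poly k n) z ⊗ₜ[k] 1)
    (by rw [← hy, map_sub, h, koszul_square, sub_zero])
    (by rw [map_sub, koszulAug_tmul, map_one, one_smul, sub_self])
  exact ⟨y' + y, by rw [map_add, hy', hy, sub_add_cancel]⟩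

theorem diagMod_algebraMap_smul {S M : Type u} [CommRing S] [Algebra k S] [AddCommGroup M]
    [Module k M] [Module S M] [IsScalarTower k S M] (c : k) (x : M) :
    algebraMap k (S ⊗[k] S) c • DiagMod.of k S x = DiagMod.of k S (c • x) := by
  rw [DiagMod.smul_of, AlgHom.commutes, algebraMap_smul]

theorem isScalar_diagMod {S M N : Type u} [CommRing S] [Algebra k S] [AddCommGroup M] [Module k M]
    [Module S M] [IsScalarTower k S M] [AddCommGroup N] [Module k N] [Module S N]
    [IsScalarTower k S N] (f : M →ₗ[k] N) :
    IsScalar k (E := S ⊗[k] S) (M := DiagMod k S M) (N := DiagMod k S N)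
      (AddMonoidHom.mk' (fun x => DiagMod.of k S (f ((DiagMod.of k S).symm x)))
        fun x y => by rw [map_add, map_add, map_add]) := fun c x => by
  obtain ⟨x, rfl⟩ := (DiagMod.of k S).surjective x
  simp only [AddMonoidHom.mk'_apply, diagMod_algebraMap_smul, AddEquiv.symm_apply_apply, map_smul]

/-- A contraction of the Koszul complex onto the Jacobi ring. -/
theorem exists_jacobiContraction {W : Poly k n} (hW : IsPotential k W) :
    Nonempty (Contraction (jacobiMor W)) := by
  -- Freeness of the Jacobi ring over `k` makes the target of the augmentation projective; the
  -- Koszul complex is free over `k` as well.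
  have := hW.free
  obtain ⟨N, hN⟩ := Ext.exists_sum_deg k n
  obtain ⟨h, s, π_s, homotopy, D_zero_h, D_succ_h⟩ := exists_contraction
    ((koszul k fun i => MvPolynomial.pderiv i W).restrictScalars k)
    (fun q => (koszulDeg k n (Poly k n) q).restrictScalars k)
    ((jacobiAug W).restrictScalars k) (N := N) (sum_koszulDeg hN) koszulDeg_koszulDeg
    (koszul_koszulDeg_zero _) (koszul_koszulDeg_succ _) (koszul_square _) (jacobiAug_koszul W)
    (jacobiAug_koszulDeg_zero W)
    (fun y => by
      obtain ⟨r, rfl⟩ := Submodule.Quotient.mk_surjective _ y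
      refine ⟨r ⊗ₜ[k] 1, congrArg (Submodule.Quotient.mk (p := jacobiIdeal W)) ?_⟩
      rw [koszulAug_tmul, map_one, one_smul])
    hW.exists_koszul_eq
  exact ⟨{
    h := AddMonoidHom.mk' (fun x : Poly k n ⊗[k] Ext k n => h x) h.map_add
    s := AddMonoidHom.mk' (fun x : Poly k n ⧸ jacobiIdeal W => s x) s.map_add
    κ := DiagMod.map (M := Poly k n ⊗[k] Ext k n) (N := Poly k n ⊗[k] Ext k n) k (koszul k fun i => MvPolynomial.pderiv i W)
    -- The differential of the Koszul complex lowers degree and is all of `κ`.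
    δ₀ := 0
    δ₁ := 0
    D := fun q => DiagMod.map (M := Poly k n ⊗[k] Ext k n) (N := Poly k n ⊗[k] Ext k n) k
      (koszulDeg k n (Poly k n) q)
    N := N
    h_scalar := isScalar_diagMod h
    s_scalar := isScalar_diagMod s
    d_eq := fun x => ((add_zero _).trans (add_zero _)).symm
    κ_odd := koszul_even _
    D_even := koszulDeg_even
    π_s := π_s
    π_h := fun x => (jacobiAug_koszulDeg_zero W (h x)).symm.trans
      ((congrArg (jacobiAug W) (D_zero_h x)).trans (map_zero _))
    homotopy := homotopy
    D_zero_h := D_zero_h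
    D_succ_h := D_succ_h
    D_δ₀ := fun _ _ => map_zero _
    D_zero_δ₁ := fun _ => map_zero _
    D_succ_δ₁ := fun _ _ => map_zero _
    sum_D := sum_koszulDeg hN }⟩

end Jacobi

end LandauGinzburg

end

/-! ### Freeness and finiteness of tensor products. -/

noncomputable section

namespace LandauGinzburg

open LinFact BiFact BiTensor

section Freeness

variable {k G S R : Type u} [CommRing k] [CommRing G] [CommRing S] [CommRing R]
  [Algebra k G] [Algebra k S] [Algebra k R]

/-- Coordinates on a bimodule which are linear for the right action. -/
def IsRightCoord (k S : Type u) {R : Type u} [CommRing k] [CommRing S] [CommRing R] [Algebra k S]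
    [Algebra k R] {C L : Type u} [AddCommGroup C] [Module (S ⊗[k] R) C] (ρ : C ≃+ (L →₀ R)) : Prop :=
  ∀ (r : R) x, ρ (((1 : S) ⊗ₜ[k] r) • x) = r • ρ x

theorem IsRightCoord.symm_single {C L : Type u} [AddCommGroup C] [Module (S ⊗[k] R) C]
    {ρ : C ≃+ (L →₀ R)} (hρ : IsRightCoord k S ρ) (l : L) (r : R) :
    ρ.symm (Finsupp.single l r) = ((1 : S) ⊗ₜ[k] r) • ρ.symm (Finsupp.single l 1) := by
  apply ρ.injective
  rw [hρ, AddEquiv.apply_symm_apply, AddEquiv.apply_symm_apply, Finsupp.smul_single, smul_eq_mul,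
    mul_one]

section Right

variable {Y C I L : Type u} [AddCommGroup Y] [Module (G ⊗[k] S) Y] [AddCommGroup C]
  [Module (S ⊗[k] R) C]

/-- The map `(r eₗ, t) ↦ t ⊗ r e₍ᵢ,ₗ₎`. -/
def coordPair (k G R : Type u) [CommRing k] [CommRing G] [CommRing R] [Algebra k G] [Algebra k R]
    {I L : Type u} (i : I) : (L →₀ R) →+ G →+ (I × L →₀ G ⊗[k] R) :=
  Finsupp.liftAddHom fun l => AddMonoidHom.mk' (fun r : R => AddMonoidHom.mk'
      (fun t : G => Finsupp.single (i, l) (t ⊗ₜ[k] r))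
      fun t t' => by rw [add_tmul, Finsupp.single_add])
    fun r r' => by
      ext1 t
      simp only [AddMonoidHom.mk'_apply, AddMonoidHom.add_apply, tmul_add, Finsupp.single_add]

theorem coordPair_single (i : I) (l : L) (r : R) (t : G) :
    coordPair k G R i (Finsupp.single l r) t = Finsupp.single (i, l) (t ⊗ₜ[k] r) := by
  rw [coordPair, Finsupp.liftAddHom_apply_single]
  rfl

/-- Coordinates on `Y ⊗_S C` for a basis of `Y` and coordinates on the right module `C`. -/
def tensorCoord (b : Module.Basis I (G ⊗[k] S) Y) {ρ : C ≃+ (L →₀ R)} (hρ : IsRightCoord k S ρ) :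
    BiTensor k G S R Y C →+ (I × L →₀ G ⊗[k] R) :=
  liftRight b (fun i => (coordPair k G R i).comp ρ.toAddMonoidHom) fun i a c t => by
    change coordPair k G R i (ρ _) t = coordPair k G R i (ρ c) (a • t)
    rw [← one_tmul_algebraMap, hρ]
    induction ρ c using Finsupp.induction_linear with
    | zero => simp
    | add u v hu hv =>
      rw [smul_add, map_add, map_add, AddMonoidHom.add_apply, AddMonoidHom.add_apply, hu, hv]
    | single l r =>
      rw [Finsupp.smul_single, coordPair_single, coordPair_single, smul_eq_mul, ← Algebra.smul_def,
        smul_tmul]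

theorem tensorCoord_mk (b : Module.Basis I (G ⊗[k] S) Y) {ρ : C ≃+ (L →₀ R)}
    (hρ : IsRightCoord k S ρ) (t : G) (i : I) (l : L) (r : R) :
    tensorCoord b hρ (BiTensor.mk k G S R ((t ⊗ₜ[k] (1 : S)) • b i)
      (ρ.symm (Finsupp.single l r))) = Finsupp.single (i, l) (t ⊗ₜ[k] r) := by
  refine (liftRight_mk b _ _ t i _).trans ?_
  change coordPair k G R i (ρ (ρ.symm _)) t = _
  rw [AddEquiv.apply_symm_apply, coordPair_single]

theorem ext_coord (b : Module.Basis I (G ⊗[k] S) Y) (ρ : C ≃+ (L →₀ R)) {P : Type u}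
    [AddCommGroup P] {f g : BiTensor k G S R Y C → P}
    (hf : ∀ x y, f (x + y) = f x + f y) (hg : ∀ x y, g (x + y) = g x + g y)
    (h : ∀ (t : G) i l r,
      f (BiTensor.mk k G S R ((t ⊗ₜ[k] (1 : S)) • b i) (ρ.symm (Finsupp.single l r))) =
      g (BiTensor.mk k G S R ((t ⊗ₜ[k] (1 : S)) • b i) (ρ.symm (Finsupp.single l r)))) (x) :
    f x = g x := by
  have f0 : f 0 = 0 := by simpa using hf 0 0
  have g0 : g 0 = 0 := by simpa using hg 0 0
  refine ext_right b hf hg (fun t i c => ?_) x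
  obtain ⟨v, rfl⟩ := ρ.symm.surjective c
  induction v using Finsupp.induction_linear with
  | zero => rw [map_zero, mk_zero, f0, g0]
  | add u v hu hv => rw [map_add, mk_add, hf, hg, hu, hv]
  | single l r => exact h t i l r

/-- `Y ⊗_S C` is free if `Y` is free and `C` is free as a right module. -/
def tensorBasis (b : Module.Basis I (G ⊗[k] S) Y) {ρ : C ≃+ (L →₀ R)} (hρ : IsRightCoord k S ρ) :
    Module.Basis (I × L) (G ⊗[k] R) (BiTensor k G S R Y C) :=
  -- `F` is linear by construction, so the merely additive `tensorCoord` suffices as an inverse.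
  let F : (I × L →₀ G ⊗[k] R) →ₗ[G ⊗[k] R] BiTensor k G S R Y C :=
    Finsupp.linearCombination _ fun p => BiTensor.mk k G S R (b p.1) (ρ.symm (Finsupp.single p.2 1))
  have hF : ∀ t i l r, F (Finsupp.single (i, l) (t ⊗ₜ[k] r)) =
      BiTensor.mk k G S R ((t ⊗ₜ[k] (1 : S)) • b i) (ρ.symm (Finsupp.single l r)) :=
    fun t i l r => by
      rw [Finsupp.linearCombination_single, smul_mk, ← hρ.symm_single]
  Module.Basis.ofRepr (LinearEquiv.symm
    { F with
      invFun := tensorCoord b hρ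
      left_inv := fun v => by
        change tensorCoord b hρ (F v) = v
        induction v using Finsupp.induction_linear with
        | zero => rw [map_zero, map_zero]
        | add u v hu hv => rw [map_add, map_add, hu, hv]
        | single p e =>
          induction e with
          | zero => rw [Finsupp.single_zero, map_zero, map_zero]
          | add u v hu hv => rw [Finsupp.single_add, map_add, map_add, hu, hv]
          | tmul t r => rw [hF, tensorCoord_mk]
      right_inv := ext_coord b ρ (fun x y => by
        change F (tensorCoord b hρ (x + y)) = F (tensorCoord b hρ x) + F (tensorCoord b hρ y)
        rw [map_add, map_add]) (fun _ _ => rfl) fun t i l r => by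
          change F (tensorCoord b hρ _) = _
          rw [tensorCoord_mk, hF] })

end Right

section Left

variable {C X J L : Type u} [AddCommGroup X] [Module (S ⊗[k] R) X] [AddCommGroup C]
  [Module k C] [Module S C]

/-- The map `(a eₗ, r) ↦ a r e₍ⱼ,ₗ₎`. -/
def scalarPair (k R : Type u) [CommRing k] [CommRing R] [Algebra k R]
    {J L : Type u} (j : J) : (L →₀ k) →+ R →+ (J × L →₀ R) :=
  Finsupp.liftAddHom fun l => AddMonoidHom.mk' (fun a : k => AddMonoidHom.mk'
      (fun r : R => Finsupp.single (j, l) (a • r))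
      fun t t' => by rw [smul_add, Finsupp.single_add])
    fun a a' => by
      ext1 t
      simp only [AddMonoidHom.mk'_apply, AddMonoidHom.add_apply, add_smul, Finsupp.single_add]

theorem scalarPair_single (j : J) (l : L) (a : k) (r : R) :
    scalarPair k R j (Finsupp.single l a) r = Finsupp.single (j, l) (a • r) := by
  rw [scalarPair, Finsupp.liftAddHom_apply_single]
  rfl

theorem scalarPair_smul (j : J) (v : L →₀ k) (a : k) (r : R) :
    scalarPair k R j (a • v) r = scalarPair k R j v (a • r) := by
  induction v using Finsupp.induction_linear with
  | zero => simp
  | add u v hu hv =>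
    rw [smul_add, map_add, map_add, AddMonoidHom.add_apply, AddMonoidHom.add_apply, hu, hv]
  | single l c =>
    rw [Finsupp.smul_single, scalarPair_single, scalarPair_single, smul_eq_mul, mul_smul, smul_comm]

variable (b : Module.Basis J (S ⊗[k] R) X) (c : Module.Basis L k C)

/-- The map `r e₍ⱼ,ₗ₎ ↦ cₗ ⊗ r bⱼ`. -/
def diagCoordInv : (J × L →₀ R) →+ BiTensor k S S R (DiagMod k S C) X :=
  Finsupp.liftAddHom fun p => AddMonoidHom.mk' (fun r =>
    BiTensor.mk k S S R (DiagMod.of k S (c p.2)) (((1 : S) ⊗ₜ[k] r) • b p.1))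
      fun r r' => by rw [tmul_add, add_smul, mk_add]

theorem diagCoordInv_single (j : J) (l : L) (r : R) :
    diagCoordInv b c (Finsupp.single (j, l) r) =
      BiTensor.mk k S S R (DiagMod.of k S (c l)) (((1 : S) ⊗ₜ[k] r) • b j) := by
  rw [diagCoordInv, Finsupp.liftAddHom_apply_single]
  rfl

variable [IsScalarTower k S C]

/-- Coordinates on `C ⊗_S X`, for a `k`-basis of `C` and a basis of `X`. -/
def diagCoordHom : BiTensor k S S R (DiagMod k S C) X →+ (J × L →₀ R) :=
  liftLeft b (fun j => (scalarPair k R j).comp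
    (c.repr.toAddEquiv.toAddMonoidHom.comp (DiagMod.of k S (M := C)).symm.toAddMonoidHom))
    fun j a y r => by
      obtain ⟨y, rfl⟩ := (DiagMod.of k S).surjective y
      rw [diagMod_algebraMap_smul]
      change scalarPair k R j (c.repr (a • y)) r = scalarPair k R j (c.repr y) (a • r)
      rw [map_smul, scalarPair_smul]

theorem diagCoordHom_mk (y : C) (r : R) (j : J) :
    diagCoordHom b c (BiTensor.mk k S S R (DiagMod.of k S y) (((1 : S) ⊗ₜ[k] r) • b j)) =
      scalarPair k R j (c.repr y) r := liftLeft_mk b _ _ _ r j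

theorem diagCoordInv_scalarPair (j : J) (v : L →₀ k) (r : R) :
    diagCoordInv b c (scalarPair k R j v r) =
      BiTensor.mk k S S R (DiagMod.of k S (c.repr.symm v)) (((1 : S) ⊗ₜ[k] r) • b j) := by
  induction v using Finsupp.induction_linear with
  | zero => rw [map_zero, AddMonoidHom.zero_apply, map_zero, map_zero, map_zero, zero_mk]
  | add u v hu hv =>
    rw [map_add, AddMonoidHom.add_apply, map_add, map_add, map_add, hu, hv, add_mk]
  | single l a =>
    have h : (1 : S) ⊗ₜ[k] (a • r) = (algebraMap k (S ⊗[k] R) a) * ((1 : S) ⊗ₜ[k] r) := by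
      rw [← Algebra.smul_def, tmul_smul]
    rw [scalarPair_single, diagCoordInv_single, Module.Basis.repr_symm_single,
      ← diagMod_algebraMap_smul, ← one_tmul_algebraMap, mk_balanced, algebraMap_tmul_one, h, mul_smul]

/-- Coordinates on `C ⊗_S X`, for a `k`-basis of `C` and a basis of `X`. -/
def diagCoord : BiTensor k S S R (DiagMod k S C) X ≃+ (J × L →₀ R) where
  toFun := diagCoordHom b c
  invFun := diagCoordInv b c
  map_add' := map_add _
  left_inv := ext_left b (fun _ _ => by rw [map_add, map_add]) (fun _ _ => rfl) fun y r j => by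
    obtain ⟨y, rfl⟩ := (DiagMod.of k S).surjective y
    rw [diagCoordHom_mk, diagCoordInv_scalarPair, LinearEquiv.symm_apply_apply]
  right_inv v := by
    induction v using Finsupp.induction_linear with
    | zero => rw [map_zero, map_zero]
    | add u v hu hv => rw [map_add, map_add, hu, hv]
    | single p r =>
      rw [diagCoordInv_single, diagCoordHom_mk, Module.Basis.repr_self, scalarPair_single, one_smul]

theorem scalarPair_mul (j : J) (v : L →₀ k) (r s : R) :
    scalarPair k R j v (r * s) = r • scalarPair k R j v s := by
  induction v using Finsupp.induction_linear with
  | zero => simp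
  | add u v hu hv => rw [map_add, AddMonoidHom.add_apply, AddMonoidHom.add_apply, hu, hv, smul_add]
  | single l a =>
    rw [scalarPair_single, scalarPair_single, Finsupp.smul_single, smul_eq_mul, mul_smul_comm]

theorem diagCoord_isRightCoord : IsRightCoord k S (diagCoord b c) := fun r =>
  ext_left b (f := fun x => diagCoordHom b c (((1 : S) ⊗ₜ[k] r) • x))
    (g := fun x => r • diagCoordHom b c x) (fun _ _ => by rw [smul_add, map_add])
    (fun _ _ => by rw [map_add, smul_add]) fun y s j => by
      obtain ⟨y, rfl⟩ := (DiagMod.of k S).surjective y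
      rw [smul_mk, ← Algebra.TensorProduct.one_def, one_smul, smul_smul,
        Algebra.TensorProduct.tmul_mul_tmul, one_mul, diagCoordHom_mk, diagCoordHom_mk,
        scalarPair_mul]

end Left

section Basis

variable {X J L : Type u} [AddCommGroup X] [Module (S ⊗[k] R) X]

/-- Coordinates on a free module over `S ⊗ R`, for a `k`-basis of `S`. -/
def freeCoord (b : Module.Basis J (S ⊗[k] R) X) (c : Module.Basis L k S) : X ≃+ (J × L →₀ R) :=
  AddEquiv.trans
    -- Identifying `X` with `S ⊗_S X` reduces to `diagCoord` with `C = S`.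
    { toFun := fun x => BiTensor.mk k S S R (DiagMod.of k S (1 : S)) x
      invFun := diagTensorLin X
      left_inv := diagTensorLin_mk_one
      right_inv := mk_one_diagTensorLin
      map_add' := mk_add _ _ _ _ _ } (diagCoord b c)

theorem freeCoord_isRightCoord (b : Module.Basis J (S ⊗[k] R) X) (c : Module.Basis L k S) :
    IsRightCoord k S (freeCoord b c) := fun r x => by
  change diagCoord b c (BiTensor.mk k S S R (DiagMod.of k S (1 : S)) (((1 : S) ⊗ₜ[k] r) • x)) =
    r • diagCoord b c (BiTensor.mk k S S R (DiagMod.of k S (1 : S)) x)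
  rw [← diagCoord_isRightCoord b c]
  congr 1
  rw [smul_mk, ← Algebra.TensorProduct.one_def, one_smul]

end Basis

variable {U : G} {V : S} {W : R}

/-- A `k`-basis of `S` turns `X` into a free right `R`-module, and `Y ⊗_S X` is then a direct sum of
copies of `G ⊗ R`. -/
theorem tensor_isMF [Module.Free k S] {Y : BiFact k G S U V} {X : BiFact k S R V W} (hY : Y.IsMF)
    (hX : X.IsMF) : (tensor Y X).IsMF := by
  have : Module.Free _ Y.carrier := hY
  have : Module.Free _ X.carrier := hX
  exact Module.Free.of_basis (tensorBasis (Module.Free.chooseBasis (G ⊗[k] S) Y.carrier)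
    (freeCoord_isRightCoord (Module.Free.chooseBasis (S ⊗[k] R) X.carrier)
      (Module.Free.chooseBasis k S)))

end Freeness

section Jacobi

variable {k G R : Type u} [CommRing k] [CommRing G] [CommRing R] [Algebra k G] [Algebra k R]
  {U : G} {W : R} {n : ℕ} {V : Poly k n}

/-- With the Jacobi ring `J` in the middle, `J ⊗_S X` is finite free over `R`, because `J` is finite
free over `k`; this replaces the polynomial ring, whose `k`-basis is infinite in general. -/
theorem tensor_jacobi_isFiniteMF (hV : IsPotential k V) {Y : BiFact k G (Poly k n) U V}
    {X : BiFact k (Poly k n) R V W} (hY : Y.IsFiniteMF) (hX : X.IsFiniteMF) :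
    (tensor Y (tensor (jacobiFact V) X)).IsFiniteMF := by
  have : Module.Free _ Y.carrier := hY.1
  have : Module.Free _ X.carrier := hX.1
  have : Module.Finite _ Y.carrier := hY.2
  have : Module.Finite _ X.carrier := hX.2
  have := hV.free
  have := hV.finite
  let b := tensorBasis (Module.Free.chooseBasis (G ⊗[k] Poly k n) Y.carrier)
    (diagCoord_isRightCoord (Module.Free.chooseBasis (Poly k n ⊗[k] R) X.carrier)
      (Module.Free.chooseBasis k (Poly k n ⧸ jacobiIdeal V)))
  exact ⟨Module.Free.of_basis b, Module.Finite.of_basis b⟩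

end Jacobi

end LandauGinzburg

end

/-! ### Null-homotopies from derivations, and factorisations as retracts of Koszul complexes. -/

noncomputable section

namespace LandauGinzburg

open LinFact BiFact BiTensor

section Conjugation

/-- Each factor `1 - a_i` moved past `D` strips off `E_i`, since `[D, a_i] = -E_i` and `E_i a_i =
0`. It commutes with the other `E_j`, so the factors act one after another. -/
theorem List.prod_one_sub_mul {A ι : Type*} [Ring A] (D : A) (a E : ι → A)
    (commutator : ∀ i, D * a i - a i * D = -E i) (E_a : ∀ i, E i * a i = 0)
    (comm : ∀ i j, i ≠ j → E i * a j = a j * E i) (l : List ι) (hl : l.Nodup) :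
    (l.map fun i => 1 - a i).prod * D = (D - (l.map E).sum) * (l.map fun i => 1 - a i).prod := by
  -- This lets `1 - a_i` pass the sum of the `E_j` already removed; distinctness of the indices
  -- enters here.
  have aux : ∀ (l : List ι) (i : ι), i ∉ l →
      (1 - a i) * (l.map E).sum = (l.map E).sum * (1 - a i) := by
    intro l i hi
    induction l with
    | nil => simp
    | cons j l ih =>
      rw [List.mem_cons, not_or] at hi
      have h : (1 - a i) * E j = E j * (1 - a i) := by
        rw [sub_mul, mul_sub, one_mul, mul_one, comm j i (Ne.symm hi.1)]
      rw [List.map_cons, List.sum_cons, mul_add, add_mul, ih hi.2, h]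
  induction l with
  | nil => simp
  | cons i l ih =>
    rw [List.nodup_cons] at hl
    have h1 : (1 - a i) * D = (D - E i) * (1 - a i) := by
      have h2 : a i * D = D * a i + E i := by
        rw [← neg_eq_iff_eq_neg.2 (commutator i)]; abel
      rw [sub_mul, one_mul, h2, sub_mul, mul_sub, mul_sub, E_a, mul_one, mul_one]
      abel
    rw [List.map_cons, List.prod_cons, mul_assoc, ih hl.2, ← mul_assoc, mul_sub, h1, aux l i hl.1,
      ← sub_mul, mul_assoc, List.map_cons, List.sum_cons, sub_sub]

end Conjugation

section Connection

variable {k S R : Type u} [CommRing k] [CommRing S] [CommRing R] [Algebra k S] [Algebra k R]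
  {V : S} {W : R}

theorem rTensor_derivation_mul (δ : Derivation k S S) (e f : S ⊗[k] R) :
    (δ : S →ₗ[k] S).rTensor R (e * f) =
      (δ : S →ₗ[k] S).rTensor R e * f + e * (δ : S →ₗ[k] S).rTensor R f := by
  induction e with
  | zero => simp
  | add e e' h h' => rw [add_mul, map_add, h, h', map_add, add_mul, add_mul]; abel
  | tmul a b =>
    induction f with
    | zero => simp
    | add e e' h h' => rw [mul_add, map_add, h, h', map_add, mul_add, mul_add]; abel
    | tmul c d =>
      simp only [Algebra.TensorProduct.tmul_mul_tmul, LinearMap.rTensor_tmul, Derivation.coeFn_coe,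
        Derivation.leibniz, smul_eq_mul, add_tmul]
      rw [add_comm, mul_comm c]

/-- Applying `δ` to the coordinates with respect to a basis satisfies the Leibniz rule. -/
theorem exists_connection {E : Type u} [CommRing E] {M : Type u} [AddCommGroup M] [Module E M]
    [Module.Free E M] (δ : E →+ E) (hδ : ∀ e f, δ (e * f) = δ e * f + e * δ f) :
    ∃ D : M →+ M, ∀ (e : E) x, D (e • x) = δ e • x + e • D x := by
  let b := Module.Free.chooseBasis E M
  refine ⟨b.repr.symm.toAddEquiv.toAddMonoidHom.comp
    ((Finsupp.mapRange.addMonoidHom δ).comp b.repr.toAddEquiv.toAddMonoidHom), fun e x => ?_⟩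
  change b.repr.symm (Finsupp.mapRange δ δ.map_zero (b.repr (e • x))) =
    δ e • x + e • b.repr.symm (Finsupp.mapRange δ δ.map_zero (b.repr x))
  apply b.repr.injective
  simp only [map_add, map_smul, LinearEquiv.apply_symm_apply]
  ext j
  simp [hδ]

/-- The action of a derivative of `w` on a matrix factorisation of `w` is null-homotopic. -/
theorem LinFact.exists_nullHomotopy {E : Type u} [CommRing E] {w : E} (X : LinFact E w)
    (hX : X.IsMF) (δ : E →+ E) (hδ : ∀ e f, δ (e * f) = δ e * f + e * δ f) :
    ∃ l : X.carrier →ₗ[E] X.carrier, IsOdd (X := X) (Y := X) l ∧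
      ∀ x, X.d (l x) + l (X.d x) = δ w • x := by
  have : Module.Free E X.carrier := hX
  obtain ⟨D, hD⟩ := exists_connection (M := X.carrier) δ hδ
  -- The commutator of `D` with the linear map `d` is linear: the two terms `δ e • d x` cancel.
  let l : X.carrier →ₗ[E] X.carrier :=
    { toFun := fun x => D (X.d x) - X.d (D x)
      map_add' := fun x y => by simp only [map_add]; abel
      map_smul' := fun e x => by
        rw [map_smul, hD, hD, map_add, map_smul, map_smul, RingHom.id_apply, smul_sub]
        abel }
  refine ⟨oddPart (X := X) (Y := X) l, isOdd_oddPart (X := X) (Y := X) l, fun x => ?_⟩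
  -- The anticommutator of `d` with `[D, d]` is `D d² - d² D`, which is multiplication by `δ w`
  -- because `d² = w`. This scalar is even, so passing to the odd part of `l` preserves the
  -- identity.
  rw [d_oddPart (X := X) (c := δ w • LinearMap.id), evenPart_smul_id]
  intro x
  change X.d (D (X.d x) - X.d (D x)) + (D (X.d (X.d x)) - X.d (D (X.d x))) = δ w • x
  rw [map_sub, X.d_d, X.d_d, hD]
  abel

/-- The derivation `δ ⊗ 1` kills `1 ⊗ W`, so the derivative of `V ⊗ 1 - 1 ⊗ W` is `δ V ⊗ 1`. -/
theorem exists_nullHomotopy (X : BiFact k S R V W) (hX : X.IsMF) (δ : Derivation k S S) :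
    ∃ l : X.carrier →ₗ[S ⊗[k] R] X.carrier, IsOdd (X := X) (Y := X) l ∧
      ∀ x, X.d (l x) + l (X.d x) = (δ V ⊗ₜ[k] (1 : R)) • x := by
  obtain ⟨l, h, h'⟩ := X.exists_nullHomotopy hX ((δ : S →ₗ[k] S).rTensor R).toAddMonoidHom
    (rTensor_derivation_mul δ)
  refine ⟨l, h, fun x => (h' x).trans (congrArg (· • x) ?_)⟩
  change (δ : S →ₗ[k] S).rTensor R (V ⊗ₜ[k] (1 : R) - (1 : S) ⊗ₜ[k] W) = _
  rw [map_sub, LinearMap.rTensor_tmul, LinearMap.rTensor_tmul, Derivation.coeFn_coe,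
    Derivation.map_one_eq_zero, zero_tmul, sub_zero]

end Connection

section Retract

variable {k S R : Type u} [CommRing k] [CommRing S] [CommRing R] [Algebra k S] [Algebra k R]
  {V : S} {W : R} {n : ℕ}

/-- Operators `C i` which present a factorisation `P` as a Koszul complex of `f` with augmentation
`π` and vacuum `e`. -/
structure KoszulData (P : BiFact k S S V V) (f : Fin n → S) where
  π : P.carrier →ₗ[S ⊗[k] S] DiagMod k S S
  e : P.carrier
  C : Fin n → P.carrier →ₗ[S ⊗[k] S] P.carrier
  C_odd : ∀ i x, C i (P.even x) = C i x - P.even (C i x)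
  C_C : ∀ i x, C i (C i x) = 0
  C_anticomm : ∀ i j x, C i (C j x) = -C j (C i x)
  d_eq : ∀ x, P.d x = ∑ i, ((1 : S) ⊗ₜ[k] f i) • C i x
  π_even : ∀ x, π (P.even x) = π x
  even_e : P.even e = e
  C_e : ∀ i, C i e = 0
  π_e : π e = DiagMod.of k S (1 : S)
  smul_e : ∀ s : S, (s ⊗ₜ[k] (1 : S)) • e = ((1 : S) ⊗ₜ[k] s) • e

namespace KoszulData

variable {P : BiFact k S S V V} {f : Fin n → S} (K : KoszulData P f)

theorem C_sgn (i : Fin n) (x : P.carrier) : K.C i (P.sgn x) = -P.sgn (K.C i x) := by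
  simp only [sgn_apply, odd_apply, map_sub, K.C_odd]
  abel

theorem sgn_sgn (X : BiFact k S R V W) (x : X.carrier) : X.sgn (X.sgn x) = x := by
  simp only [sgn_apply, odd_apply, map_sub, X.even_even]
  abel

theorem d_sgn (X : BiFact k S R V W) (x : X.carrier) : X.d (X.sgn x) = -X.sgn (X.d x) := by
  simp only [sgn_apply, odd_apply, map_sub, X.d_even]
  abel

theorem d_C (i : Fin n) (x : P.carrier) : P.d (K.C i x) = -K.C i (P.d x) := by
  rw [K.d_eq, K.d_eq, map_sum, ← Finset.sum_neg_distrib]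
  refine Finset.sum_congr rfl fun j _ => ?_
  rw [map_smul, K.C_anticomm, smul_neg]

variable (X : BiFact k S R V W) (l : Fin n → X.carrier →ₗ[S ⊗[k] R] X.carrier)

/-- The operator `p ⊗ x ↦ (-1)^|p| C p ⊗ l x`. -/
def twist (i : Fin n) : Module.End (S ⊗[k] R) (tensor P X).carrier :=
  BiTensor.map (K.C i ∘ₗ P.sgn) (l i)

theorem twist_mk (i : Fin n) (p : P.carrier) (x : X.carrier) :
    K.twist X l i (BiTensor.mk k S S R p x) = BiTensor.mk k S S R (K.C i (P.sgn p)) (l i x) := rfl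

/-- The summand `fᵢ Cᵢ` of the differential. -/
def part (i : Fin n) : Module.End (S ⊗[k] R) (tensor P X).carrier :=
  BiTensor.map (((1 : S) ⊗ₜ[k] f i) • K.C i) LinearMap.id

theorem part_mk (i : Fin n) (p : P.carrier) (x : X.carrier) : K.part X i (BiTensor.mk k S S R p x) =
    BiTensor.mk k S S R (((1 : S) ⊗ₜ[k] f i) • K.C i p) x := rfl

theorem end_ext {a b : Module.End (S ⊗[k] R) (tensor P X).carrier}
    (h : ∀ p x, a (BiTensor.mk k S S R p x) = b (BiTensor.mk k S S R p x)) : a = b :=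
  LinearMap.ext (tensor_ext _ _ (fun _ _ => map_add _ _ _) (fun _ _ => map_add _ _ _) h)

theorem neg_mk (p : P.carrier) (x : X.carrier) :
    BiTensor.mk k S S R (-p) x = -BiTensor.mk k S S R p x := by
  rw [← zero_sub, BiTensor.sub_mk, zero_mk, zero_sub]

/-- `C_i` anticommutes with the Koszul differential, so only the differential of `X` contributes.
Together with `l_i` it yields multiplication by `f_i`, which balancing over `S` carries to the
factor `C_i`. -/
theorem commutator (hd : ∀ i x, X.d (l i x) + l i (X.d x) = (f i ⊗ₜ[k] (1 : R)) • x) (i : Fin n) :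
    ((tensor P X).d : Module.End (S ⊗[k] R) _) * K.twist X l i -
      K.twist X l i * ((tensor P X).d : Module.End (S ⊗[k] R) _) = -K.part X i :=
  end_ext X fun p x => by
    have h : BiTensor.mk k S S R (((1 : S) ⊗ₜ[k] f i) • K.C i p) x =
        BiTensor.mk k S S R (K.C i p) (X.d (l i x)) +
          BiTensor.mk k S S R (K.C i p) (l i (X.d x)) := by
      rw [mk_balanced, ← hd, mk_add]
    change (tensor P X).d (K.twist X l i (BiTensor.mk k S S R p x)) -
      K.twist X l i ((tensor P X).d (BiTensor.mk k S S R p x)) = -K.part X i (BiTensor.mk k S S R p x)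
    rw [part_mk, h, tensor_d_mk, map_add, twist_mk, twist_mk, twist_mk, tensor_d_mk, K.d_C, d_sgn,
      sgn_sgn, K.C_sgn, map_neg, neg_neg, map_neg, sgn_sgn, neg_mk]
    abel

theorem part_twist (i : Fin n) : K.part X i * K.twist X l i = 0 := end_ext X fun p x => by
  change K.part X i (K.twist X l i (BiTensor.mk k S S R p x)) = 0
  rw [twist_mk, part_mk, K.C_C, smul_zero, zero_mk]

/-- Exchanging `C_i` with `C_j` and with the sign operator gives two signs, which cancel. -/
theorem part_comm (i j : Fin n) : K.part X i * K.twist X l j = K.twist X l j * K.part X i :=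
  end_ext X fun p x => by
    change K.part X i (K.twist X l j (BiTensor.mk k S S R p x)) =
      K.twist X l j (K.part X i (BiTensor.mk k S S R p x))
    have h : P.sgn (K.C i p) = -K.C i (P.sgn p) := by rw [K.C_sgn, neg_neg]
    rw [twist_mk, part_mk, part_mk, twist_mk, map_smul, map_smul, h, map_neg, K.C_anticomm i j]

theorem d_sub_part : ((tensor P X).d : Module.End (S ⊗[k] R) _) -
      ((List.finRange n).map (K.part X)).sum = BiTensor.map P.sgn X.d := end_ext X fun p x => by
  rw [← Fin.sum_univ_def, LinearMap.sub_apply, LinearMap.sum_apply, sub_eq_iff_eq_add', tensor_d_mk,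
    K.d_eq, sum_mk]
  rfl

/-- The projection `p ⊗ x ↦ π(p) x`. -/
def proj : (tensor P X).carrier →ₗ[S ⊗[k] R] X.carrier :=
  diagTensorLin X.carrier ∘ₗ BiTensor.map K.π LinearMap.id

theorem proj_mk (p : P.carrier) (x : X.carrier) :
    K.proj X (BiTensor.mk k S S R p x) =
      diagTensorLin X.carrier (BiTensor.mk k S S R (K.π p) x) := rfl

theorem π_sgn (p : P.carrier) : K.π (P.sgn p) = K.π p := by
  rw [sgn_apply, odd_apply, map_sub, map_sub, K.π_even, sub_self, sub_zero]

/-- `proj` is compatible only with the differential from which the Koszul part has been removed; the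
sign disappears because `π` vanishes on odd elements. -/
theorem proj_d : ∀ z, X.d (K.proj X z) = K.proj X (BiTensor.map P.sgn X.d z) :=
  tensor_ext _ _ (fun _ _ => by simp only [map_add]) (fun _ _ => by simp only [map_add])
    fun p x => by
      rw [BiTensor.map_mk, proj_mk, proj_mk, π_sgn]
      obtain ⟨r, hr⟩ := (DiagMod.of k S).surjective (K.π p)
      rw [← hr]
      exact X.d.map_smul _ _

theorem proj_even : IsEven (X := tensor P X) (Y := X) (K.proj X) :=
  tensor_ext _ _ (fun _ _ => by simp only [map_add]) (fun _ _ => by simp only [map_add])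
    fun p x => by
      have h : K.π (P.odd p) = 0 := by
        rw [odd_apply, map_sub, K.π_even, sub_self]
      rw [tensor_even_mk, map_add, proj_mk, proj_mk, proj_mk, h, zero_mk, map_zero, add_zero,
        K.π_even]
      obtain ⟨r, hr⟩ := (DiagMod.of k S).surjective (K.π p)
      rw [← hr]
      exact (X.even.map_smul _ _).symm

theorem twist_even (hl : ∀ i, IsOdd (X := X) (Y := X) (l i)) (i : Fin n) :
    ∀ z, K.twist X l i ((tensor P X).even z) = (tensor P X).even (K.twist X l i z) :=
  tensor_ext _ _ (fun _ _ => by simp only [map_add]) (fun _ _ => by simp only [map_add])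
    fun p x => by
      have h := hl i x
      rw [tensor_even_mk, map_add, twist_mk, twist_mk, twist_mk, tensor_even_mk]
      simp only [sgn_apply, odd_apply, map_sub, K.C_odd, P.even_even, h, BiTensor.mk_sub,
        BiTensor.sub_mk]
      abel

/-- The product of the operators `1 - C i ⊗ l i`. -/
def gauge : Module.End (S ⊗[k] R) (tensor P X).carrier :=
  ((List.finRange n).map fun i => 1 - K.twist X l i).prod

/-- Each factor of `gauge` removes one summand `f_i C_i`. Together they carry the full differential
to `sgn ⊗ d`, by `List.prod_one_sub_mul` with the twists as `a_i` and the parts as `E_i`. -/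
theorem gauge_d (hd : ∀ i x, X.d (l i x) + l i (X.d x) = (f i ⊗ₜ[k] (1 : R)) • x)
    (z : (tensor P X).carrier) :
    K.gauge X l ((tensor P X).d z) = BiTensor.map P.sgn X.d (K.gauge X l z) := by
  have h := List.prod_one_sub_mul ((tensor P X).d : Module.End (S ⊗[k] R) _) (K.twist X l)
    (K.part X) (K.commutator X l hd) (K.part_twist X l) (fun i j _ => K.part_comm X l i j)
    (List.finRange n) (List.nodup_finRange n)
  rw [d_sub_part] at h
  exact LinearMap.congr_fun h z

theorem gauge_even (hl : ∀ i, IsOdd (X := X) (Y := X) (l i)) (z : (tensor P X).carrier) :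
    K.gauge X l ((tensor P X).even z) = (tensor P X).even (K.gauge X l z) := by
  rw [gauge]
  induction List.finRange n with
  | nil => rfl
  | cons i t ih =>
    rw [List.map_cons, List.prod_cons, Module.End.mul_apply, Module.End.mul_apply, ih,
      LinearMap.sub_apply, LinearMap.sub_apply, K.twist_even X l hl, map_sub]
    rfl

/-- The vacuum is annihilated by every `C_i`, so all twists vanish on it. This makes the gauged
projection a left inverse of the inclusion. -/
theorem gauge_mk (x : X.carrier) :
    K.gauge X l (BiTensor.mk k S S R K.e x) = BiTensor.mk k S S R K.e x := by
  rw [gauge]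
  induction List.finRange n with
  | nil => rfl
  | cons i t ih =>
    rw [List.map_cons, List.prod_cons, Module.End.mul_apply, ih, LinearMap.sub_apply, twist_mk,
      K.C_sgn, K.C_e, map_zero, neg_zero, zero_mk, sub_zero]
    rfl

theorem odd_e : P.odd K.e = 0 := by rw [odd_apply, K.even_e, sub_self]

/-- The inclusion `x ↦ e ⊗ x`. -/
def inclusion : Mor X (tensor P X) where
  lin :=
    { toFun := BiTensor.mk k S S R K.e
      map_add' := BiTensor.mk_add k S S R K.e
      map_smul' := fun a x => by
        rw [RingHom.id_apply]
        induction a with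
        | zero => rw [zero_smul, zero_smul, mk_zero]
        | add a b ha hb => rw [add_smul, add_smul, mk_add, ha, hb]
        -- The two actions of `S` agree on the vacuum, so a coefficient from `S` can be carried
        -- across to `x`.
        | tmul s r =>
          rw [BiTensor.smul_mk, K.smul_e, mk_balanced, smul_smul,
            Algebra.TensorProduct.tmul_mul_tmul, mul_one, one_mul] }
  isEven x := by
    change BiTensor.mk k S S R K.e (X.even x) = (tensor P X).even (BiTensor.mk k S S R K.e x)
    rw [tensor_even_mk, K.even_e, odd_e, zero_mk, add_zero]
  comm x := by
    change (tensor P X).d (BiTensor.mk k S S R K.e x) = BiTensor.mk k S S R K.e (X.d x)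
    rw [tensor_d_mk, sgn_apply, odd_e, K.even_e, sub_zero, K.d_eq,
      Finset.sum_eq_zero fun i _ => by rw [K.C_e, smul_zero], zero_mk, zero_add]

/-- A factorisation on which the `fᵢ` are null-homotopic is a retract of its Koszul complex. -/
theorem nonempty_retract (K : KoszulData P f)
    (h : ∀ i, ∃ l : X.carrier →ₗ[S ⊗[k] R] X.carrier, IsOdd (X := X) (Y := X) l ∧
      ∀ x, X.d (l x) + l (X.d x) = (f i ⊗ₜ[k] (1 : R)) • x) : Nonempty (Retract X (tensor P X)) := by
  choose l hl hd using h
  exact ⟨{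
    i := (K.inclusion X).cls
    r := Mor.cls
      -- `gauge` removes the Koszul part of the differential and `proj` respects what is left, so
      -- the composite is a morphism.
      { lin := K.proj X ∘ₗ K.gauge X l
        isEven := fun z => (congrArg (K.proj X) (K.gauge_even X l hl z)).trans (K.proj_even X _)
        comm := fun z => (K.proj_d X _).trans (congrArg (K.proj X) (K.gauge_d X l hd z).symm) }
    retract := Mor.cls_eq fun x => by
      change K.proj X (K.gauge X l (BiTensor.mk k S S R K.e x)) = x
      rw [gauge_mk, proj_mk, K.π_e, diagTensorLin_mk_one] }⟩

end KoszulData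

end Retract

section Jacobi

variable {k : Type u} [CommRing k] {n : ℕ}

theorem baseChange_contract_even (i : Fin n) (z : Poly k n ⊗[k] Ext k n) :
    (Ext.contract k i).baseChange (Poly k n) ((Ext.even k n).baseChange _ z) =
      (Ext.contract k i).baseChange (Poly k n) z -
        (Ext.even k n).baseChange _ ((Ext.contract k i).baseChange (Poly k n) z) := by
  induction z with
  | zero => simp
  | add x y hx hy => simp only [map_add, hx, hy]; abel
  | tmul r x => simp only [LinearMap.baseChange_tmul, Ext.contract_even, tmul_sub]

theorem baseChange_contract_contract (i : Fin n) (z : Poly k n ⊗[k] Ext k n) :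
    (Ext.contract k i).baseChange (Poly k n) ((Ext.contract k i).baseChange (Poly k n) z) = 0 := by
  induction z with
  | zero => simp
  | add x y hx hy => simp only [map_add, hx, hy, add_zero]
  | tmul r x => simp only [LinearMap.baseChange_tmul, Ext.contract_contract, tmul_zero]

theorem baseChange_contract_anticomm (i j : Fin n) (z : Poly k n ⊗[k] Ext k n) :
    (Ext.contract k i).baseChange (Poly k n) ((Ext.contract k j).baseChange (Poly k n) z) =
      -(Ext.contract k j).baseChange (Poly k n) ((Ext.contract k i).baseChange (Poly k n) z) := by
  induction z with
  | zero => simp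
  | add x y hx hy => simp only [map_add, hx, hy]; abel
  | tmul r x =>
    simp only [LinearMap.baseChange_tmul]
    rw [eq_neg_of_add_eq_zero_left (Ext.contract_contract_add i j x), tmul_neg]

theorem koszul_eq_sum (f : Fin n → Poly k n) (z : Poly k n ⊗[k] Ext k n) :
    koszul k f z = ∑ i, f i • (Ext.contract k i).baseChange (Poly k n) z := by
  induction z with
  | zero => simp
  | add x y hx hy => simp only [map_add, hx, hy, smul_add, Finset.sum_add_distrib]
  | tmul r x => simp only [koszul_tmul, LinearMap.baseChange_tmul, smul_tmul', smul_eq_mul]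

theorem Ext.contract_one (i : Fin n) : Ext.contract k i (1 : Ext k n) = 0 := by
  rw [← map_one (algebraMap k (Ext k n)), Ext.contract_algebraMap]

theorem koszulAug_one_tmul_one :
    koszulAug k (Poly k n) ((1 : Poly k n) ⊗ₜ[k] (1 : Ext k n)) = 1 := by
  rw [koszulAug_tmul, map_one, one_smul]

/-- The Koszul complex of the partial derivatives. -/
def koszulData (W : Poly k n) : KoszulData (koszulFact W) fun i => MvPolynomial.pderiv i W where
  π := DiagMod.map (M := Poly k n ⊗[k] Ext k n) (N := Poly k n) k (koszulAug k (Poly k n))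
  e := DiagMod.of k (Poly k n) ((1 : Poly k n) ⊗ₜ[k] (1 : Ext k n))
  C i := DiagMod.map (M := Poly k n ⊗[k] Ext k n) (N := Poly k n ⊗[k] Ext k n) k
    ((Ext.contract k i).baseChange (Poly k n))
  C_odd := baseChange_contract_even
  C_C := baseChange_contract_contract
  C_anticomm := baseChange_contract_anticomm
  d_eq x := by
    refine (koszul_eq_sum _ (show Poly k n ⊗[k] Ext k n from x)).trans ?_
    refine Finset.sum_congr rfl fun i _ => ?_
    refine congrArg (· • (Ext.contract k i).baseChange (Poly k n) (show Poly k n ⊗[k] Ext k n from x))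
      ?_
    exact ((Algebra.TensorProduct.lmul'_apply_tmul _ _).trans (one_mul _)).symm
  π_even := koszulAug_even
  even_e := congrArg ((1 : Poly k n) ⊗ₜ[k] ·) Ext.even_one
  C_e i := (congrArg ((1 : Poly k n) ⊗ₜ[k] ·) (Ext.contract_one i)).trans (tmul_zero _ _)
  π_e := koszulAug_one_tmul_one
  smul_e s := by
    refine (DiagMod.tmul_smul_of (M := Poly k n ⊗[k] Ext k n) s 1 _).trans ?_
    refine Eq.trans ?_ (DiagMod.tmul_smul_of (M := Poly k n ⊗[k] Ext k n) 1 s _).symm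
    rw [mul_one, one_mul]

end Jacobi

/-! ### Composites of 1-morphisms are 1-morphisms. -/

section CompClosed

variable {k G R : Type u} [CommRing k] [CommRing G] [CommRing R] [Algebra k G] [Algebra k R]
  {n : ℕ} {U : G} {V : Poly k n} {W : R}

/-- A matrix factorisation is a retract of its Koszul complex of partial derivatives. -/
theorem nonempty_retract_koszulFact (X : BiFact k (Poly k n) R V W) (hX : X.IsMF) :
    Nonempty (Retract X (tensor (koszulFact V) X)) :=
  (koszulData V).nonempty_retract X fun i => exists_nullHomotopy X hX (MvPolynomial.pderiv i)

/-- The tensor product of retracts. -/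
def tensorRetract {S : Type u} [CommRing S] [Algebra k S] {V : S} {Y Y' : BiFact k G S U V}
    {X X' : BiFact k S R V W} (r : Retract Y Y')
    (s : Retract X X') : Retract (tensor Y X) (tensor Y' X') where
  i := tensorHom r.i s.i
  r := tensorHom r.r s.r
  retract := by rw [← tensorHom_comp, r.retract, s.retract, tensorHom_id]

/-- The contraction of the Koszul complex onto the Jacobi ring is only `k`-linear. Tensoring with
the free `X` makes it right linear, tensoring with the free `Y` left linear, and then
`Contraction.isIso` applies. -/
theorem tensor_jacobiMor_isIso (hV : IsPotential k V) {Y : BiFact k G (Poly k n) U V}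
    {X : BiFact k (Poly k n) R V W} (hY : Y.IsMF) (hX : X.IsMF) :
    IsIso (tensorMor (Mor.id Y) (tensorMor (jacobiMor V) (Mor.id X))).cls := by
  obtain ⟨c⟩ := exists_jacobiContraction hV
  have : Module.Free _ Y.carrier := hY
  have : Module.Free _ X.carrier := hX
  let b := Module.Free.chooseBasis (Poly k n ⊗[k] R) X.carrier
  let b' := Module.Free.chooseBasis (G ⊗[k] Poly k n) Y.carrier
  exact ((c.tensorRight X b).tensorLeft Y b').isIso ((c.tensorRight X b).tensorLeft_leftLin Y b')
    ((c.tensorRight X b).tensorLeft_rightLin Y b' (c.tensorRight_rightLin X b))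

/-- If `Y` and `X` are retracts of finite-rank `Y'` and `X'`, then `Y ⊗ X` is a retract of `Y' ⊗
X'`, hence of `Y' ⊗ (K ⊗ X')` with `K` the Koszul complex. The latter is equivalent to `Y' ⊗ (J ⊗
X')` with `J` the Jacobi ring, which has finite rank. -/
theorem tensor_isSummandMF (hV : IsPotential k V) {Y : BiFact k G (Poly k n) U V}
    {X : BiFact k (Poly k n) R V W} (hY : Y.IsSummandMF) (hX : X.IsSummandMF) :
    (tensor Y X).IsSummandMF := by
  obtain ⟨hY, Y', hY', ⟨r⟩⟩ := hY
  obtain ⟨hX, X', hX', ⟨s⟩⟩ := hX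
  obtain ⟨t⟩ := nonempty_retract_koszulFact X' hX'.1
  have := tensor_jacobiMor_isIso hV hY'.1 hX'.1
  exact ⟨tensor_isMF hY hX, _, tensor_jacobi_isFiniteMF hV hY' hX',
    ⟨(tensorRetract r (s.trans t)).trans (Retract.ofIso
      (asIso (tensorMor (Mor.id Y') (tensorMor (jacobiMor V) (Mor.id X'))).cls))⟩⟩

theorem LG.compClosed (k : Type u) [CommRing k] : LG.CompClosed k := fun _ b _ X Y =>
  tensor_isSummandMF b.isPotential Y.isSummandMF X.isSummandMF

end CompClosed

end LandauGinzburg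

end

/-- The bicategory of Landau-Ginzburg models over `k` has shadows `Z ↦ H^*(Z ⊗_{Rᵉ} R)` in
`ℤ/2`-graded `k`-modules, with `θ` induced by the graded swap. That composites of 1-morphisms are
again 1-morphisms and that the unit actions are invertible, so that there is such a bicategory, is
part of the claim. -/
theorem proposition10p2 (k : Type u) [CommRing k] :
    ∃ (hc : LandauGinzburg.LG.CompClosed k) (hu : LandauGinzburg.LG.UnitorsInvertible k),
      letI : Bicategory (LandauGinzburg.LG k) := LandauGinzburg.LG.bicategory hc hu
      LandauGinzburg.IsShadow (B := LandauGinzburg.LG k)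
        (C := GradedObject (ZMod 2) (ModuleCat.{u} k))
        (LandauGinzburg.LG.shadow k)
        (fun f g => LandauGinzburg.swapCohomology g.fact f.fact) :=
  ⟨LandauGinzburg.LG.compClosed k, LandauGinzburg.LG.unitorsInvertible k,
    LandauGinzburg.LG.isShadow k _ _⟩
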